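/- In this statement a digraph is a finite directed graph with no loops, no multiple edges and no pair of antiparallel edges (that is, an orientation of a finite simple graph), and $|H|$ denotes the number of vertices of $H$. A tournament is a digraph in which any two distinct vertices are joined by exactly one directed edge. A copy of $H$ in a tournament $K$ is a subgraph of $K$ (a set of vertices and a set of edges of $K$ between them) that is isomorphic to $H$. A digraph $H$ is called impartial if for some integer $n \ge |H|$ all $n$-vertex tournaments contain the same number of copies of $H$. The recursively bridge-mirrored digraphs are, up to isomorphism, those obtained as follows: the one-vertex digraph is recursively bridge-mirrored; and if $T$ is recursively bridge-mirrored and $r$ is any vertex of $T$, then the digraph formed by two disjoint copies of $T$ and one new directed edge from the vertex $r$ of one copy to the vertex $r$ of the other copy is recursively bridge-mirrored. **Theorem.** A digraph is impartial if and only if it is a disjoint union of (finitely many, possibly zero) recursively bridge-mirrored digraphs. -/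

import Mathlib

universe u v

namespace Digraph

/-- A digraph is oriented if it has no loops and no pair of antiparallel arcs, i.e. it arises from
a simple graph by directing every edge (taking `x = y` excludes loops). -/
def IsOriented {V : Type u} (H : Digraph V) : Prop :=
  ∀ x y : V, H.Adj x y → ¬ H.Adj y x

/-- A tournament: no loops, and exactly one of the two arcs between any two distinct vertices. -/
def IsTournament {V : Type u} (K : Digraph V) : Prop :=
  (∀ x : V, ¬ K.Adj x x) ∧ ∀ x y : V, x ≠ y → Xor (K.Adj x y) (K.Adj y x)

/-- Two digraphs are isomorphic. -/
def Isomorphic {V : Type u} {W : Type v} (G : Digraph V) (H : Digraph W) : Prop :=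
  Nonempty (G.Adj ≃r H.Adj)

/-- A subgraph of a digraph `K`: a set of vertices of `K` together with a set of arcs of `K`
both of whose ends lie in that set of vertices. -/
@[ext]
structure Subgraph {V : Type u} (K : Digraph V) where
  /-- The vertices of the subgraph. -/
  verts : Set V
  /-- The arcs of the subgraph. -/
  Adj : V → V → Prop
  adj_sub : ∀ {x y : V}, Adj x y → K.Adj x y
  fst_mem : ∀ {x y : V}, Adj x y → x ∈ verts
  snd_mem : ∀ {x y : V}, Adj x y → y ∈ verts

/-- A subgraph regarded as a digraph on its own set of vertices. -/
def Subgraph.coe {V : Type u} {K : Digraph V} (S : K.Subgraph) : Digraph S.verts where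
  Adj x y := S.Adj x y

/-- The number of (unlabelled) copies of `H` in `K`: the number of subgraphs of `K`
that are isomorphic to `H`. It is used only for digraphs `K` with finitely many vertices,
where the set of subgraphs is finite. -/
noncomputable def copyCount {V : Type u} {W : Type v} (H : Digraph V) (K : Digraph W) : ℕ :=
  Nat.card {S : K.Subgraph // H.Isomorphic S.coe}

/-- `H` is impartial if for some `n ≥ |H|` all `n`-vertex tournaments contain the same number
of copies of `H`. -/
def IsImpartial {V : Type u} (H : Digraph V) : Prop :=
  ∃ n : ℕ, Nat.card V ≤ n ∧
    ∀ K L : Digraph (Fin n), K.IsTournament → L.IsTournament → H.copyCount K = H.copyCount L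

/-- Two disjoint copies of `T` together with one new arc, from the vertex `r` of the first copy
to the same vertex `r` of the second copy. -/
def bridgeMirror {V : Type u} (T : Digraph V) (r : V) : Digraph (V ⊕ V) where
  Adj
    | .inl x, .inl y => T.Adj x y
    | .inr x, .inr y => T.Adj x y
    | .inl x, .inr y => x = r ∧ y = r
    | .inr _, .inl _ => False

/-- Recursively bridge-mirrored digraphs. The last clause says that the notion is invariant
under isomorphism. -/
inductive IsRecursivelyBridgeMirrored : ∀ {V : Type u}, Digraph V → Prop
  | single {V : Type u} [Unique V] : IsRecursivelyBridgeMirrored (⊥ : Digraph V)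
  | mirror {V : Type u} {T : Digraph V} (r : V) :
      IsRecursivelyBridgeMirrored T → IsRecursivelyBridgeMirrored (T.bridgeMirror r)
  | iso {V W : Type u} {T : Digraph V} {T' : Digraph W} :
      T.Isomorphic T' → IsRecursivelyBridgeMirrored T → IsRecursivelyBridgeMirrored T'

/-- The disjoint union of a family of digraphs. -/
def disjointUnion {ι : Type v} {W : ι → Type u} (G : ∀ i, Digraph (W i)) :
    Digraph (Σ i, W i) where
  Adj x y := ∃ (i : ι) (a b : W i), x = ⟨i, a⟩ ∧ y = ⟨i, b⟩ ∧ (G i).Adj a b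

/-- `H` is (isomorphic to) a disjoint union of finitely many recursively bridge-mirrored
digraphs. The empty union is allowed; it is the digraph without vertices. -/
def IsDisjointUnionOfRBM {V : Type u} (H : Digraph V) : Prop :=
  ∃ (k : ℕ) (W : Fin k → Type u) (G : ∀ i, Digraph (W i)),
    (∀ i, (G i).IsRecursivelyBridgeMirrored) ∧ H.Isomorphic (disjointUnion G)

end Digraph

namespace Digraph

open Finset

/-! ### Weighted homomorphism sums -/

section HomSum

variable {V : Type*} {X : Type*} {R : Type*} [CommRing R]

/-! The count of copies is turned into a polynomial identity. For an antisymmetric weight `f`,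
`homSum` adds up, over all maps `x`, the product of `1 + f (x a) (x b)` over the arcs `a → b`. If
`f` is the sign function of a tournament, the same sum over injective maps is the number of copies
times the number of automorphisms times `2 ^ #H.arcs`. It is affine in the value of `f` at each
pair, so constancy on tournaments spreads to all antisymmetric weights; averaging over pullbacks
removes injectivity, and inclusion-exclusion restores it when the target has as many points as `H`.
Thus impartial means `Balanced` (`isImpartial_iff_balanced`). The sum is multiplicative over
disjoint unions, and bridge-mirroring squares it, because exchanging the two copies cancels the
bridge term. Scaling `f` by a variable makes the sums polynomials, so both facts can be reversed by
comparing degrees. This gives one implication and reduces the other to connected `H`.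

Let `H` be connected and balanced. Testing a transitive tournament shows that `2 ^ #H.arcs` divides
the factorial of the number of vertices, which forces the underlying graph `T` to be a tree.
Expanding the products, balance says that the signs of the arcs are uncorrelated under permutations
(`Balanced.sum_prod_sgn`). A graph `F` without an automorphism exchanging the ends of an edge has an
orientation invariant under automorphisms, so every copy of `F` in `T` has a well-defined sign;
these signs sum to zero if `F` has an edge, and the number of copies is even.

A tree with a flipped edge consists of two mirrored copies of a tree `K`. Modulo 2 its central edge
may be deleted, since subgraphs containing it pair off under reflection (`parityEq_mirror`).
Iteration reduces `T` to a flip-free spanning subgraph `R` of which `T` has an odd number of copies,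
so `R` has no edges. Hence `T` is an iterated mirror, its order is a power of 2, and an automorphism
with a fixed vertex is trivial.

It remains to see that the two halves of `T` are oriented alike. Let `B` be the set of edges where
they disagree. For mirrored signs the signed number of copies of `F` is divisible by 4, and modulo 4
each edge of `B` changes it by twice the number of copies through that edge. So the numbers of
copies of `F` in `T - e`, summed over `e ∈ B`, give an even total
(`IsInvariantOrientation.even_sum_copies`). Take for `F` the reduction of some `T - e` with the most
edges: if reductions of distinct `T - e` are never isomorphic, only `e` itself contributes an odd
number, a contradiction. That they are not isomorphic is a reconstruction argument
(`IsReduction.eq_of_iso`): as the order is a power of 2, component sizes in the reduction reveal the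
larger side of `e`, and the centroid of that side together with rigidity locates `e`. So `B` is
empty, `H` is a bridge-mirror of a balanced half, and induction on the order finishes. -/

open Classical in
/-- The product of `1 + f (x a) (x b)` over the arcs `a → b` of `H`. -/
noncomputable def wt (H : Digraph V) (f : X → X → R) (x : V → X) : R :=
  ∏ᶠ a : V, ∏ᶠ b : V, if H.Adj a b then 1 + f (x a) (x b) else 1

/-- The sum of the weights of all maps from the vertices of `H` to `X`. -/
noncomputable def homSum (H : Digraph V) (f : X → X → R) : R :=
  ∑ᶠ x : V → X, H.wt f x

open Classical in
lemma wt_eq [Fintype V] (H : Digraph V) (f : X → X → R) (x : V → X) :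
    H.wt f x = ∏ a : V, ∏ b : V, if H.Adj a b then 1 + f (x a) (x b) else 1 := by
  simp only [wt, finprod_eq_prod_of_fintype]

lemma homSum_eq [Fintype V] [DecidableEq V] [Fintype X] (H : Digraph V) (f : X → X → R) :
    H.homSum f = ∑ x : V → X, H.wt f x := by
  simp only [homSum, finsum_eq_sum_of_fintype]

/-- `H` has the same homomorphism sum for all antisymmetric weights on a given finite set. -/
def Balanced (H : Digraph V) : Prop :=
  ∀ (N : ℕ) (f : Fin N → Fin N → ℤ), (∀ i j, f i j = -f j i) →
    H.homSum f = (N : ℤ) ^ Nat.card V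

lemma wt_comp {Y : Type*} (H : Digraph V) (f : Y → Y → R) (g : X → Y) (x : V → X) :
    H.wt (fun a b => f (g a) (g b)) x = H.wt f (g ∘ x) := rfl

lemma homSum_congr_right {Y : Type*} (H : Digraph V) (f : Y → Y → R) (e : X ≃ Y) :
    H.homSum (fun a b => f (e a) (e b)) = H.homSum f := by
  unfold homSum
  rw [← finsum_comp_equiv (Equiv.arrowCongr (Equiv.refl V) e)]
  rfl

open Classical in
lemma wt_iso {W : Type*} {H : Digraph V} {G : Digraph W} (e : H.Adj ≃r G.Adj) (f : X → X → R)
    (x : W → X) : H.wt f (x ∘ e) = G.wt f x := by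
  unfold wt
  rw [← finprod_comp_equiv e.toEquiv]
  refine finprod_congr fun a => ?_
  rw [← finprod_comp_equiv e.toEquiv]
  refine finprod_congr fun b => ?_
  have h : G.Adj (e a) (e b) ↔ H.Adj a b := e.map_rel_iff
  exact if_congr h.symm rfl rfl

lemma homSum_iso {W : Type*} {H : Digraph V} {G : Digraph W} (e : H.Adj ≃r G.Adj)
    (f : X → X → R) : H.homSum f = G.homSum f := by
  unfold homSum
  rw [← finsum_comp_equiv (Equiv.arrowCongr e.toEquiv (Equiv.refl X))]
  refine finsum_congr fun x => ?_
  rw [← wt_iso e]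
  congr 1
  ext a
  exact congrArg x (e.symm_apply_apply a).symm

lemma Balanced.iso {W : Type*} {H : Digraph V} {G : Digraph W} (e : H.Adj ≃r G.Adj)
    (h : H.Balanced) : G.Balanced := fun N f hf => by
  rw [← homSum_iso e, h N f hf, Nat.card_congr e.toEquiv]

lemma Balanced.homSum [Finite X] {H : Digraph V} (h : H.Balanced) (f : X → X → ℤ)
    (hf : ∀ i j, f i j = -f j i) : H.homSum f = (Nat.card X : ℤ) ^ Nat.card V := by
  rw [← homSum_congr_right H f (Finite.equivFin X).symm]
  exact h _ _ fun i j => hf _ _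

open Classical in
lemma wt_map {S : Type*} [CommRing S] [Finite V] (φ : R →+* S) (H : Digraph V) (f : X → X → R)
    (x : V → X) : φ (H.wt f x) = H.wt (fun a b => φ (f a b)) x := by
  have := Fintype.ofFinite V
  simp only [wt_eq, map_prod, apply_ite φ, map_add, map_one]

lemma homSum_map {S : Type*} [CommRing S] [Finite V] [Finite X] (φ : R →+* S) (H : Digraph V)
    (f : X → X → R) : φ (H.homSum f) = H.homSum (fun a b => φ (f a b)) := by
  classical
  have := Fintype.ofFinite V
  have := Fintype.ofFinite X
  simp only [homSum_eq, map_sum, wt_map]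

/-- The polynomial whose values are the homomorphism sums of the multiples of `f`. -/
noncomputable def homPoly (H : Digraph V) (f : X → X → ℤ) : Polynomial ℤ :=
  H.homSum fun a b => Polynomial.X * Polynomial.C (f a b)

lemma homPoly_eval [Finite V] [Finite X] (H : Digraph V) (f : X → X → ℤ) (z : ℤ) :
    (H.homPoly f).eval z = H.homSum fun a b => z * f a b := by
  have := homSum_map (Polynomial.evalRingHom z) H
    (fun a b => Polynomial.X * Polynomial.C (f a b))
  simpa [homPoly] using this

lemma homSum_zero [Finite V] [Finite X] (H : Digraph V) :
    H.homSum (fun _ _ : X => (0 : ℤ)) = (Nat.card X : ℤ) ^ Nat.card V := by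
  classical
  have := Fintype.ofFinite V
  have := Fintype.ofFinite X
  simp [homSum_eq, wt_eq]

/-- An integer multiple of an antisymmetric weight is antisymmetric, so the polynomial takes the
same value at every integer. -/
lemma Balanced.homPoly [Finite V] [Finite X] {H : Digraph V} (h : H.Balanced) (f : X → X → ℤ)
    (hf : ∀ i j, f i j = -f j i) : H.homPoly f = Polynomial.C ((Nat.card X : ℤ) ^ Nat.card V) := by
  refine Polynomial.funext fun z => ?_
  rw [homPoly_eval, Polynomial.eval_C, h.homSum]
  intro i j
  rw [hf i j]
  ring

/-- If `homPoly` is constant, then its value is that of the zero weight. -/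
lemma balanced_of_natDegree [Finite V] {H : Digraph V}
    (h : ∀ (N : ℕ) (f : Fin N → Fin N → ℤ), (∀ i j, f i j = -f j i) →
      (H.homPoly f).natDegree = 0) : H.Balanced := by
  intro N f hf
  have h1 := Polynomial.eq_C_of_natDegree_eq_zero (h N f hf)
  have h2 := homPoly_eval H f 1
  have h3 := homPoly_eval H f 0
  rw [h1] at h2 h3
  simp only [Polynomial.eval_C, zero_mul, one_mul, homSum_zero, Nat.card_eq_fintype_card,
    Fintype.card_fin] at h2 h3
  rw [← h2, h3]

end HomSum

/-! ### Disjoint unions and bridge-mirroring -/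

section Constructions

variable {X : Type*} {R : Type*} [CommRing R]

lemma disjointUnion_adj_same {ι : Type v} {W : ι → Type u} (G : ∀ i, Digraph (W i)) (i : ι)
    (a b : W i) : (disjointUnion G).Adj ⟨i, a⟩ ⟨i, b⟩ ↔ (G i).Adj a b := by
  constructor
  · rintro ⟨j, a', b', h1, h2, h⟩
    cases h1
    cases h2
    exact h
  · intro h
    exact ⟨i, a, b, rfl, rfl, h⟩

lemma disjointUnion_adj_ne {ι : Type v} {W : ι → Type u} (G : ∀ i, Digraph (W i)) {i j : ι}
    (hij : i ≠ j) (a : W i) (b : W j) : ¬ (disjointUnion G).Adj ⟨i, a⟩ ⟨j, b⟩ := by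
  rintro ⟨k, a', b', h1, h2, h⟩
  cases h1
  cases h2
  exact hij rfl

lemma wt_disjointUnion {ι : Type v} [Fintype ι] {W : ι → Type u} [∀ i, Finite (W i)]
    (G : ∀ i, Digraph (W i)) (f : X → X → R) (x : (Σ i, W i) → X) :
    (disjointUnion G).wt f x = ∏ i, (G i).wt f (fun a => x ⟨i, a⟩) := by
  classical
  have := fun i => Fintype.ofFinite (W i)
  simp only [wt_eq, Fintype.prod_sigma]
  refine prod_congr rfl fun i _ => prod_congr rfl fun a _ => ?_
  rw [Fintype.prod_eq_single i]
  · simp only [disjointUnion_adj_same]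
  · intro j hj
    refine prod_eq_one fun b _ => ?_
    rw [if_neg (disjointUnion_adj_ne G (Ne.symm hj) a b)]

lemma homSum_disjointUnion {ι : Type v} [Fintype ι] {W : ι → Type u} [∀ i, Finite (W i)]
    [Finite X] (G : ∀ i, Digraph (W i)) (f : X → X → R) :
    (disjointUnion G).homSum f = ∏ i, (G i).homSum f := by
  classical
  have := fun i => Fintype.ofFinite (W i)
  have := Fintype.ofFinite X
  simp only [homSum_eq, wt_disjointUnion]
  rw [Finset.prod_univ_sum, Fintype.piFinset_univ,
    ← (Equiv.piCurry (fun (i : ι) (_ : W i) => X)).sum_comp]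
  rfl

/-- Multiplicativity gives one direction at once. For the other, a product in `ℤ[X]` that is a
nonzero constant has only factors of degree 0. -/
lemma balanced_disjointUnion {ι : Type v} [Fintype ι] {W : ι → Type u} [∀ i, Finite (W i)]
    {G : ∀ i, Digraph (W i)} : (disjointUnion G).Balanced ↔ ∀ i, (G i).Balanced := by
  classical
  have := fun i => Fintype.ofFinite (W i)
  constructor
  · intro h i
    refine balanced_of_natDegree fun N f hf => ?_
    -- On the empty set the constant value may be 0, so the degree argument needs `N > 0`.
    rcases Nat.eq_zero_or_pos N with rfl | hN
    · have : f = 0 := Subsingleton.elim _ _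
      subst this
      have : (G i).homPoly (0 : Fin 0 → Fin 0 → ℤ) =
          Polynomial.C ((Nat.card (Fin 0) : ℤ) ^ Nat.card (W i)) := by
        refine Polynomial.funext fun z => ?_
        rw [homPoly_eval, Polynomial.eval_C, ← homSum_zero (G i)]
        simp
      rw [this, Polynomial.natDegree_C]
    · have h1 := h.homPoly f hf
      have h2 : (disjointUnion G).homPoly f = ∏ i, (G i).homPoly f :=
        homSum_disjointUnion G _
      have h3 : (∏ i, (G i).homPoly f) ≠ 0 := by
        rw [← h2, h1, Ne, Polynomial.C_eq_zero]
        simp only [Nat.card_eq_fintype_card, Fintype.card_fin]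
        positivity
      have h4 : (∏ i, (G i).homPoly f).natDegree = 0 := by
        rw [← h2, h1, Polynomial.natDegree_C]
      rw [Polynomial.natDegree_prod _ _ fun i hi => Finset.prod_ne_zero_iff.1 h3 i hi,
        Finset.sum_eq_zero_iff] at h4
      exact h4 i (mem_univ i)
  · intro h N f hf
    rw [homSum_disjointUnion, Finset.prod_congr rfl fun i _ => h i N f hf,
      Finset.prod_pow_eq_pow_sum]
    simp [Nat.card_eq_fintype_card]

open Classical in
lemma wt_bridgeMirror {V : Type u} [Finite V] (T : Digraph V) (r : V) (f : X → X → R)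
    (x : V ⊕ V → X) : (T.bridgeMirror r).wt f x =
      T.wt f (x ∘ Sum.inl) * T.wt f (x ∘ Sum.inr) *
        (1 + f (x (Sum.inl r)) (x (Sum.inr r))) := by
  have := Fintype.ofFinite V
  have h1 : ∀ a b : V, (T.bridgeMirror r).Adj (.inl a) (.inl b) ↔ T.Adj a b := fun _ _ => Iff.rfl
  have h2 : ∀ a b : V, (T.bridgeMirror r).Adj (.inr a) (.inr b) ↔ T.Adj a b := fun _ _ => Iff.rfl
  have h3 : ∀ a b : V, (T.bridgeMirror r).Adj (.inl a) (.inr b) ↔ a = r ∧ b = r :=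
    fun _ _ => Iff.rfl
  have h4 : ∀ a b : V, (T.bridgeMirror r).Adj (.inr a) (.inl b) ↔ False := fun _ _ => Iff.rfl
  simp only [wt_eq, Fintype.prod_sum_type, h1, h2, h3, h4, if_false, prod_const_one,
    Finset.prod_mul_distrib, Function.comp]
  have h5 : (∏ a : V, ∏ b : V, if a = r ∧ b = r then 1 + f (x (.inl a)) (x (.inr b)) else 1) =
      1 + f (x (Sum.inl r)) (x (Sum.inr r)) := by
    rw [Fintype.prod_eq_single r, Fintype.prod_eq_single r]
    · simp
    · intro b hb
      simp [hb]
    · intro a ha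
      simp [ha]
  rw [h5]
  ring

/-- Exchanging the two copies keeps their weights and negates the contribution of the bridge, which
therefore sums to zero. Only the absence of 2-torsion is assumed of the ring, so that the identity
is available both over `ℤ` and over `ℤ[X]`. -/
lemma homSum_bridgeMirror {V : Type u} [Finite V] [Finite X] (T : Digraph V) (r : V)
    (f : X → X → R) (hf : ∀ i j, f i j = -f j i) (h2 : ∀ a : R, 2 * a = 0 → a = 0) :
    (T.bridgeMirror r).homSum f = T.homSum f ^ 2 := by
  classical
  have := Fintype.ofFinite V
  have := Fintype.ofFinite X
  have h0 : ∑ p : (V → X) × (V → X), T.wt f p.1 * T.wt f p.2 * f (p.1 r) (p.2 r) = 0 := by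
    apply h2
    rw [two_mul]
    nth_rewrite 2 [← (Equiv.prodComm (V → X) (V → X)).sum_comp]
    rw [← Finset.sum_add_distrib]
    refine Finset.sum_eq_zero fun p _ => ?_
    simp only [Equiv.prodComm_apply, Prod.fst_swap, Prod.snd_swap]
    rw [hf (p.2 r)]
    ring
  rw [homSum_eq, homSum_eq, ← (Equiv.sumArrowEquivProdArrow V V X).symm.sum_comp]
  simp only [wt_bridgeMirror]
  have h1 : ∀ p : (V → X) × (V → X),
      T.wt f ((Equiv.sumArrowEquivProdArrow V V X).symm p ∘ Sum.inl) *
        T.wt f ((Equiv.sumArrowEquivProdArrow V V X).symm p ∘ Sum.inr) *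
        (1 + f ((Equiv.sumArrowEquivProdArrow V V X).symm p (Sum.inl r))
          ((Equiv.sumArrowEquivProdArrow V V X).symm p (Sum.inr r))) =
      T.wt f p.1 * T.wt f p.2 + T.wt f p.1 * T.wt f p.2 * f (p.1 r) (p.2 r) := by
    intro p
    rw [mul_add, mul_one]
    rfl
  rw [Finset.sum_congr rfl fun p _ => h1 p, Finset.sum_add_distrib, h0, add_zero, sq,
    Finset.sum_mul_sum, Fintype.sum_prod_type]

lemma Balanced.bridgeMirror {V : Type u} [Finite V] {T : Digraph V} (h : T.Balanced) (r : V) :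
    (T.bridgeMirror r).Balanced := by
  intro N f hf
  rw [homSum_bridgeMirror T r f hf fun a ha => by omega, h N f hf]
  have := Fintype.ofFinite V
  simp only [Nat.card_eq_fintype_card, Fintype.card_sum]
  ring

/-- The square of the polynomial is constant, hence so is the polynomial; no choice of a square root
is needed. -/
lemma Balanced.of_bridgeMirror {V : Type u} [Finite V] {T : Digraph V} {r : V}
    (h : (T.bridgeMirror r).Balanced) : T.Balanced := by
  refine balanced_of_natDegree fun N f hf => ?_
  have h1 := h.homPoly f hf
  have h2 : (T.bridgeMirror r).homPoly f = T.homPoly f ^ 2 := by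
    refine homSum_bridgeMirror T r _ (fun i j => ?_) fun a ha => ?_
    · rw [hf i j]
      simp
    · simpa using ha
  have h3 : (T.homPoly f ^ 2).natDegree = 0 := by
    rw [← h2, h1, Polynomial.natDegree_C]
  rw [Polynomial.natDegree_pow] at h3
  omega

lemma isRecursivelyBridgeMirrored_balanced {V : Type u} {H : Digraph V}
    (h : H.IsRecursivelyBridgeMirrored) : Finite V ∧ H.Balanced := by
  induction h with
  | @single V _ =>
    refine ⟨inferInstance, fun N f hf => ?_⟩
    classical
    have := Fintype.ofFinite V
    have : ∀ x : V → Fin N, wt (⊥ : Digraph V) f x = 1 := by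
      intro x
      rw [wt_eq]
      refine prod_eq_one fun a _ => prod_eq_one fun b _ => ?_
      rw [if_neg]
      exact fun h => h
    simp [homSum_eq, this]
  | mirror r _ ih =>
    have := ih.1
    exact ⟨inferInstance, ih.2.bridgeMirror r⟩
  | iso e _ ih =>
    obtain ⟨e⟩ := e
    have := ih.1
    exact ⟨Finite.of_equiv _ e.toEquiv, ih.2.iso e⟩

end Constructions

end Digraph

namespace Digraph

open Finset

/-! ### Impartial digraphs and homomorphism sums -/

section Impartial

variable {V : Type*} {X : Type*}

open Classical in
/-- The finite set of arcs of a digraph. -/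
noncomputable def arcs [Fintype V] (H : Digraph V) : Finset (V × V) :=
  univ.filter fun p => H.Adj p.1 p.2

lemma mem_arcs [Fintype V] {H : Digraph V} {p : V × V} : p ∈ H.arcs ↔ H.Adj p.1 p.2 := by
  simp [arcs]

lemma wt_eq_arcs {R : Type*} [CommRing R] [Fintype V] (H : Digraph V) (f : X → X → R)
    (x : V → X) : H.wt f x = ∏ p ∈ H.arcs, (1 + f (x p.1) (x p.2)) := by
  classical
  rw [wt_eq, arcs, prod_filter, Fintype.prod_prod_type]

open Classical in
/-- The sign of an ordered pair of vertices: `1` on arcs, `-1` on reversed arcs. -/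
noncomputable def sgn (K : Digraph X) (i j : X) : ℤ :=
  (if K.Adj i j then 1 else 0) - if K.Adj j i then 1 else 0

lemma sgn_antisymm (K : Digraph X) (i j : X) : K.sgn i j = -K.sgn j i := by
  unfold sgn
  ring

open Classical in
/-- The sum of the weights of the injective maps from the vertices of `H`. -/
noncomputable def injSum [Fintype V] [Fintype X] (H : Digraph V) (f : X → X → ℤ) : ℤ :=
  ∑ x : V → X with Function.Injective x, H.wt f x

lemma injSum_eq [Fintype V] [DecidableEq V] [Fintype X]
    [DecidablePred (Function.Injective (α := V) (β := X))]
    (H : Digraph V) (f : X → X → ℤ) :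
    H.injSum f = ∑ x : V → X with Function.Injective x, H.wt f x := by
  unfold injSum
  congr!

/-- Injective homomorphisms. -/
def InjHom (H : Digraph V) (K : Digraph X) : Type _ :=
  {x : V → X // Function.Injective x ∧ ∀ a b, H.Adj a b → K.Adj (x a) (x b)}

lemma IsOriented.ne {H : Digraph V} (hH : H.IsOriented) {a b : V} (h : H.Adj a b) : a ≠ b := by
  rintro rfl
  exact hH a a h h

/-- Each factor `1 + sgn` is 2 on a preserved arc and 0 on a reversed one. -/
lemma wt_sgn [Fintype V] {H : Digraph V} (hH : H.IsOriented) {K : Digraph X}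
    (hK : K.IsTournament) {x : V → X} (hx : Function.Injective x) [Decidable
      (∀ a b, H.Adj a b → K.Adj (x a) (x b))] :
    H.wt K.sgn x = if ∀ a b, H.Adj a b → K.Adj (x a) (x b) then 2 ^ #H.arcs else 0 := by
  rw [wt_eq_arcs]
  split_ifs with h
  · rw [prod_congr rfl (g := fun _ => (2 : ℤ)), prod_const]
    intro p hp
    have h1 := h _ _ (mem_arcs.1 hp)
    have h2 : ¬ K.Adj (x p.2) (x p.1) := by
      have := hK.2 _ _ (hx.ne (hH.ne (mem_arcs.1 hp)))
      rcases this with h | h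
      · exact h.2
      · exact absurd h1 h.2
    simp [sgn, h1, h2]
  · push Not at h
    obtain ⟨a, b, h1, h2⟩ := h
    refine prod_eq_zero (i := (a, b)) (mem_arcs.2 h1) ?_
    have h3 : K.Adj (x b) (x a) := by
      have := hK.2 _ _ (hx.ne (hH.ne h1))
      rcases this with h | h
      · exact absurd h.1 h2
      · exact h.1
    simp [sgn, h2, h3]

lemma injSum_sgn [Fintype V] [Fintype X] {H : Digraph V} (hH : H.IsOriented) {K : Digraph X}
    (hK : K.IsTournament) : H.injSum K.sgn = Nat.card (H.InjHom K) * 2 ^ #H.arcs := by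
  classical
  unfold InjHom
  rw [injSum_eq, sum_congr rfl (g := fun x => if ∀ a b, H.Adj a b → K.Adj (x a) (x b) then
    (2 : ℤ) ^ #H.arcs else 0), ← sum_filter, sum_const, filter_filter, Nat.card_eq_fintype_card,
    Fintype.card_subtype, nsmul_eq_mul]
  intro x hx
  exact wt_sgn hH hK (mem_filter.1 hx).2

/-- The image of a digraph under an injective homomorphism. -/
def InjHom.image {H : Digraph V} {K : Digraph X} (x : H.InjHom K) : K.Subgraph where
  verts := Set.range x.1
  Adj i j := ∃ a b, H.Adj a b ∧ x.1 a = i ∧ x.1 b = j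
  adj_sub := by
    rintro _ _ ⟨a, b, h, rfl, rfl⟩
    exact x.2.2 a b h
  fst_mem := by
    rintro _ _ ⟨a, b, h, rfl, rfl⟩
    exact ⟨a, rfl⟩
  snd_mem := by
    rintro _ _ ⟨a, b, h, rfl, rfl⟩
    exact ⟨b, rfl⟩

/-- A digraph is isomorphic to its image under an injective homomorphism. -/
noncomputable def InjHom.isoImage {H : Digraph V} {K : Digraph X} (x : H.InjHom K) :
    H.Adj ≃r x.image.coe.Adj where
  toEquiv := Equiv.ofInjective x.1 x.2.1
  map_rel_iff' := by
    intro a b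
    constructor
    · rintro ⟨a', b', h, h1, h2⟩
      rw [← x.2.1 h1, ← x.2.1 h2]
      exact h
    · intro h
      exact ⟨a, b, h, rfl, rfl⟩

/-- An isomorphism onto a subgraph as an injective homomorphism. -/
def InjHom.ofIso {H : Digraph V} {K : Digraph X} {S : K.Subgraph} (e : H.Adj ≃r S.coe.Adj) :
    H.InjHom K :=
  ⟨fun a => (e a).1, fun _ _ h => e.injective (Subtype.ext h), fun _ _ h =>
    S.adj_sub (e.map_rel_iff.2 h)⟩

lemma InjHom.image_ofIso {H : Digraph V} {K : Digraph X} {S : K.Subgraph}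
    (e : H.Adj ≃r S.coe.Adj) : (InjHom.ofIso e).image = S := by
  have h0 : ∀ a b, H.Adj a b ↔ S.Adj (e a).1 (e b).1 := fun a b => e.map_rel_iff.symm
  ext i j
  · constructor
    · rintro ⟨a, rfl⟩
      exact (e a).2
    · intro hi
      exact ⟨e.symm ⟨i, hi⟩, congrArg Subtype.val (e.apply_symm_apply ⟨i, hi⟩)⟩
  · constructor
    · rintro ⟨a, b, h, rfl, rfl⟩
      exact (h0 a b).1 h
    · intro h
      refine ⟨e.symm ⟨i, S.fst_mem h⟩, e.symm ⟨j, S.snd_mem h⟩, ?_,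
        congrArg Subtype.val (e.apply_symm_apply ⟨i, _⟩),
        congrArg Subtype.val (e.apply_symm_apply ⟨j, _⟩)⟩
      rw [h0]
      simpa using h

/-- Injective homomorphisms correspond to copies together with an isomorphism. -/
noncomputable def InjHom.equivSigma (H : Digraph V) (K : Digraph X) :
    H.InjHom K ≃ Σ S : {S : K.Subgraph // H.Isomorphic S.coe}, (H.Adj ≃r S.1.coe.Adj) where
  toFun x := ⟨⟨x.image, ⟨x.isoImage⟩⟩, x.isoImage⟩
  invFun p := InjHom.ofIso p.2
  left_inv x := rfl
  right_inv := by
    rintro ⟨⟨S, hS⟩, e⟩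
    -- With a variable subgraph `S'` in place of the image, the equality `S' = S` can be eliminated
    -- and no transport of the isomorphism is needed.
    have key : ∀ (S' : K.Subgraph) (hS' : H.Isomorphic S'.coe) (e' : H.Adj ≃r S'.coe.Adj),
        S' = S → (∀ a, (e' a).1 = (e a).1) →
        (⟨⟨S', hS'⟩, e'⟩ : Σ S : {S : K.Subgraph // H.Isomorphic S.coe},
          (H.Adj ≃r S.1.coe.Adj)) = ⟨⟨S, hS⟩, e⟩ := by
      rintro S' hS' e' rfl h
      congr 1
      ext a
      exact h a
    exact key _ _ _ (InjHom.image_ofIso e) fun a => rfl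

lemma card_injHom [Finite V] [Finite X] (H : Digraph V) (K : Digraph X) :
    Nat.card (H.InjHom K) = H.copyCount K * Nat.card (H.Adj ≃r H.Adj) := by
  have : Finite (H.InjHom K) := by unfold InjHom; infer_instance
  have hfin := Finite.of_equiv _ (InjHom.equivSigma H K)
  have hS : Finite {S : K.Subgraph // H.Isomorphic S.coe} := by
    refine Finite.of_surjective
      (Sigma.fst : (Σ S : {S : K.Subgraph // H.Isomorphic S.coe}, (H.Adj ≃r S.1.coe.Adj)) → _) ?_
    rintro ⟨S, ⟨e⟩⟩
    exact ⟨⟨⟨S, ⟨e⟩⟩, e⟩, rfl⟩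
  have hc : ∀ S : {S : K.Subgraph // H.Isomorphic S.coe},
      Nonempty ((H.Adj ≃r S.1.coe.Adj) ≃ (H.Adj ≃r H.Adj)) := by
    rintro ⟨S, ⟨e⟩⟩
    exact ⟨⟨fun g => g.trans e.symm, fun g => g.trans e,
      fun g => by ext; simp, fun g => by ext; simp⟩⟩
  have c := fun S => (hc S).some
  rw [Nat.card_congr (InjHom.equivSigma H K), Nat.card_congr (Equiv.sigmaEquivProdOfEquiv c),
    Nat.card_prod, copyCount]

/-- The antisymmetric weight `f` with its value at the pair `p` replaced by `a`. -/
def updatePair [DecidableEq X] (f : X → X → ℤ) (p : X × X) (a : ℤ) : X → X → ℤ :=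
  fun i j => if (i, j) = p then a else if (j, i) = p then -a else f i j

/-- At most one arc of an oriented graph is sent by an injective map onto the pair `p`, in either
direction. So the weight is affine in `a` and is interpolated from `a = 1` and `a = -1`; the factor
2 clears the denominator. -/
lemma wt_updatePair [Fintype V] [DecidableEq X] {H : Digraph V} (hH : H.IsOriented)
    (f : X → X → ℤ) {p : X × X} (hp : p.1 ≠ p.2) (a : ℤ) {x : V → X}
    (hx : Function.Injective x) :
    2 * H.wt (updatePair f p a) x =
      (1 + a) * H.wt (updatePair f p 1) x + (1 - a) * H.wt (updatePair f p (-1)) x := by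
  classical
  simp only [wt_eq_arcs]
  by_cases h : ∃ q ∈ H.arcs, (x q.1, x q.2) = p ∨ (x q.2, x q.1) = p
  · obtain ⟨q, hq, h⟩ := h
    have h1 : ∀ c c', ∏ q ∈ H.arcs.erase q, (1 + updatePair f p c (x q.1) (x q.2)) =
        ∏ q ∈ H.arcs.erase q, (1 + updatePair f p c' (x q.1) (x q.2)) := by
      intro c c'
      refine prod_congr rfl fun q' hq' => ?_
      rw [mem_erase] at hq'
      have ho := hH _ _ (mem_arcs.1 hq)
      have hn : (x q'.1, x q'.2) ≠ p ∧ (x q'.2, x q'.1) ≠ p := by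
        constructor
        · rintro rfl
          simp only [Prod.mk.injEq, hx.eq_iff] at h
          rcases h with h | h
          · exact hq'.1 (Prod.ext h.1.symm h.2.symm)
          · rw [h.2, h.1] at ho
            exact ho (mem_arcs.1 hq'.2)
        · rintro rfl
          simp only [Prod.mk.injEq, hx.eq_iff] at h
          rcases h with h | h
          · rw [h.2, h.1] at ho
            exact ho (mem_arcs.1 hq'.2)
          · exact hq'.1 (Prod.ext h.2.symm h.1.symm)
      simp [updatePair, hn.1, hn.2]
    rw [← mul_prod_erase _ _ hq, ← mul_prod_erase _ _ hq, ← mul_prod_erase _ _ hq, h1 a 0,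
      h1 1 0, h1 (-1) 0]
    rcases h with h | h
    · simp [updatePair, h]
      ring
    · have h' : (x q.1, x q.2) ≠ p := by
        rintro rfl
        simp only [Prod.mk.injEq] at h
        exact hp h.2
      simp [updatePair, h, h']
      ring
  · push Not at h
    have h1 : ∀ c c', ∏ q ∈ H.arcs, (1 + updatePair f p c (x q.1) (x q.2)) =
        ∏ q ∈ H.arcs, (1 + updatePair f p c' (x q.1) (x q.2)) := by
      intro c c'
      refine prod_congr rfl fun q' hq' => ?_
      simp [updatePair, (h q' hq').1, (h q' hq').2]
    rw [h1 a 0, h1 1 0, h1 (-1) 0]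
    ring

lemma injSum_updatePair [Fintype V] [Fintype X] [DecidableEq X] {H : Digraph V}
    (hH : H.IsOriented) (f : X → X → ℤ) {p : X × X} (hp : p.1 ≠ p.2) (a : ℤ) :
    2 * H.injSum (updatePair f p a) =
      (1 + a) * H.injSum (updatePair f p 1) + (1 - a) * H.injSum (updatePair f p (-1)) := by
  classical
  simp only [injSum_eq]
  rw [mul_sum, mul_sum, mul_sum, ← sum_add_distrib]
  refine sum_congr rfl fun x hx => ?_
  exact wt_updatePair hH f hp a (mem_filter.1 hx).2

lemma updatePair_self [DecidableEq X] {f : X → X → ℤ} (hf : ∀ i j, f i j = -f j i) (p : X × X) :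
    updatePair f p (f p.1 p.2) = f := by
  funext i j
  unfold updatePair
  split_ifs with h h
  · rw [← h]
  · rw [← h, hf i j]
  · rfl

lemma updatePair_antisymm [DecidableEq X] {f : X → X → ℤ} (hf : ∀ i j, f i j = -f j i)
    {p : X × X} (hp : p.1 ≠ p.2) (a : ℤ) (i j : X) :
    updatePair f p a i j = -updatePair f p a j i := by
  unfold updatePair
  split_ifs with h h' h'
  · rw [← h] at h'
    simp only [Prod.mk.injEq] at h'
    rw [← h] at hp
    exact absurd h'.2 hp
  · simp
  · rfl
  · exact hf i j

/-- By affinity the values at the pairs can be replaced one at a time by `1` or `-1`, and a weight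
with only these values off the diagonal is the sign function of a tournament. -/
lemma injSum_const [Fintype V] [Fintype X] {H : Digraph V} (hH : H.IsOriented) {c : ℤ}
    (hc : ∀ K : Digraph X, K.IsTournament → H.injSum K.sgn = c) (f : X → X → ℤ)
    (hf : ∀ i j, f i j = -f j i) : H.injSum f = c := by
  classical
  -- `D` contains the pairs at which the value is still unrestricted.
  have key : ∀ (D : Finset (X × X)) (f : X → X → ℤ), (∀ i j, f i j = -f j i) →
      (∀ i j, i ≠ j → (i, j) ∉ D → (j, i) ∉ D → f i j = 1 ∨ f i j = -1) → H.injSum f = c := by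
    intro D
    induction D using Finset.induction_on with
    | empty =>
      intro f hf h
      have hd : ∀ i, f i i = 0 := fun i => by have := hf i i; omega
      have ht : IsTournament (⟨fun i j => f i j = 1⟩ : Digraph X) := by
        refine ⟨fun i h => by have := hd i; simp only at h; omega, fun i j hij => ?_⟩
        have h1 := h i j hij (by simp) (by simp)
        have h2 := hf i j
        simp only [xor_def]
        omega
      rw [← hc _ ht]
      congr 1
      funext i j
      by_cases hij : i = j
      · subst hij
        simp [sgn, hd]
      · have h1 := h i j hij (by simp) (by simp)
        have h2 := hf i j
        simp only [sgn]
        split_ifs <;> omega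
    | insert p D hp ih =>
      intro f hf h
      by_cases hpp : p.1 = p.2
      · refine ih f hf fun i j hij h1 h2 => h i j hij ?_ ?_
        · rw [mem_insert, not_or]
          refine ⟨?_, h1⟩
          rintro rfl
          exact hij hpp
        · rw [mem_insert, not_or]
          refine ⟨?_, h2⟩
          rintro rfl
          exact hij hpp.symm
      · have h1 : ∀ a : ℤ, a = 1 ∨ a = -1 → H.injSum (updatePair f p a) = c := by
          intro a ha
          refine ih _ (updatePair_antisymm hf hpp a) fun i j hij h1 h2 => ?_
          unfold updatePair
          split_ifs with h3 h4
          · exact ha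
          · omega
          · refine h i j hij ?_ ?_ <;> simp [*]
        have h2 := injSum_updatePair hH f hpp (f p.1 p.2)
        rw [updatePair_self hf, h1 1 (by simp), h1 (-1) (by simp)] at h2
        linarith
  refine key univ f hf fun i j hij h => absurd (mem_univ _) h

/-- A map on `X` is a map on the range of `x` together with a free choice elsewhere, which yields
the power of `Fintype.card Y`. -/
lemma sum_comp_injective {Y : Type*} [Fintype V] [DecidableEq V] [Fintype X] [DecidableEq X]
    [Fintype Y] {x : V → X} (hx : Function.Injective x) (g : (V → Y) → ℤ) :
    ∑ y : X → Y, g (y ∘ x) =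
      (Fintype.card Y : ℤ) ^ (Fintype.card X - Fintype.card V) * ∑ z : V → Y, g z := by
  classical
  rw [← (Equiv.piEquivPiSubtypeProd (fun i => i ∈ Set.range x) (fun _ => Y)).symm.sum_comp,
    Fintype.sum_prod_type]
  have h1 : ∀ (a : {i // i ∈ Set.range x} → Y) (b : {i // i ∉ Set.range x} → Y),
      ((Equiv.piEquivPiSubtypeProd (fun i => i ∈ Set.range x) (fun _ => Y)).symm (a, b)) ∘ x =
        a ∘ Equiv.ofInjective x hx := by
    intro a b
    funext v
    simp [Equiv.piEquivPiSubtypeProd, Equiv.ofInjective_apply]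
  simp only [h1, sum_const]
  rw [Finset.mul_sum,
    ← (Equiv.arrowCongr (Equiv.ofInjective x hx) (Equiv.refl Y)).sum_comp]
  refine sum_congr rfl fun z _ => ?_
  have h2 : (Equiv.arrowCongr (Equiv.ofInjective x hx) (Equiv.refl Y)) z ∘
      Equiv.ofInjective x hx = z := by
    funext v
    simp [Equiv.arrowCongr]
  rw [h2, nsmul_eq_mul]
  congr 1
  rw [card_univ, Fintype.card_fun, Fintype.card_subtype_compl]
  push_cast
  congr 2
  exact (Fintype.card_congr (Equiv.ofInjective x hx)).symm

/-- Pull `f` back along every map `Fin n → Fin N` and add up the injective sums, which do not depend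
on `f`. Each injection of `V` into `Fin n` then contributes a fixed multiple of the full
homomorphism sum of `f`. -/
theorem IsImpartial.balanced [Finite V] {H : Digraph V} (hH : H.IsOriented)
    (h : H.IsImpartial) : H.Balanced := by
  classical
  have := Fintype.ofFinite V
  obtain ⟨n, hn, h⟩ := h
  rw [Nat.card_eq_fintype_card] at hn
  have h1 : ∀ f : Fin n → Fin n → ℤ, (∀ i j, f i j = -f j i) → H.injSum f =
      H.injSum (fun _ _ : Fin n => (0 : ℤ)) := by
    have h2 : ∃ c : ℤ, ∀ K : Digraph (Fin n), K.IsTournament → H.injSum K.sgn = c := by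
      -- Without a tournament any constant would do, so none has to be constructed.
      by_cases hK : ∃ K : Digraph (Fin n), K.IsTournament
      · obtain ⟨K, hK⟩ := hK
        refine ⟨H.injSum K.sgn, fun L hL => ?_⟩
        rw [injSum_sgn hH hL, injSum_sgn hH hK, card_injHom, card_injHom, h K L hK hL]
      · exact ⟨0, fun K hK' => absurd ⟨K, hK'⟩ hK⟩
    obtain ⟨c, hc⟩ := h2
    intro f hf
    rw [injSum_const hH hc f hf, injSum_const hH hc _ (by simp)]
  intro N f hf
  rw [Nat.card_eq_fintype_card]
  rcases Nat.eq_zero_or_pos N with rfl | hN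
  · have : f = fun _ _ => 0 := Subsingleton.elim _ _
    subst this
    rw [homSum_zero]
    simp [Nat.card_eq_fintype_card]
  · have h2 : ∀ f : Fin N → Fin N → ℤ, ∑ y : Fin n → Fin N, H.injSum (fun i j => f (y i) (y j)) =
        #{x : V → Fin n | Function.Injective x} *
          ((N : ℤ) ^ (n - Fintype.card V) * H.homSum f) := by
      intro f
      simp only [injSum_eq]
      rw [sum_comm, ← nsmul_eq_mul, ← sum_const]
      refine sum_congr rfl fun x hx => ?_
      simp only [wt_comp]
      rw [sum_comp_injective (mem_filter.1 hx).2 (fun z => H.wt f z), homSum_eq]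
      simp
    have h3 := h2 f
    rw [sum_congr rfl fun y _ => h1 _ fun i j => hf _ _, h2 (fun _ _ => 0), homSum_zero] at h3
    -- The hypothesis `n ≥ |H|` enters here: some injection exists, and its count can be cancelled.
    have h4 : (#{x : V → Fin n | Function.Injective x} : ℤ) ≠ 0 := by
      rw [Nat.cast_ne_zero, ← Nat.pos_iff_ne_zero, card_pos]
      have : Nonempty (V ↪ Fin n) := Function.Embedding.nonempty_of_card_le (by simpa using hn)
      obtain ⟨x⟩ := this
      exact ⟨x, by simpa using x.injective⟩
    have h5 : (N : ℤ) ^ (n - Fintype.card V) ≠ 0 := by positivity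
    have h6 := mul_left_cancel₀ h5 (mul_left_cancel₀ h4 h3)
    simpa [Nat.card_eq_fintype_card] using h6.symm

/-- Inclusion-exclusion over the set `Z` of avoided points: the maps avoiding `Z` are all the maps
into its complement, and balance fixes their total weight. -/
lemma Balanced.sum_surjective [Fintype V] [DecidableEq V] [Fintype X] [DecidableEq X]
    {H : Digraph V} (h : H.Balanced)
    (f : X → X → ℤ) (hf : ∀ i j, f i j = -f j i) :
    ∑ x : V → X with Finset.univ.image x = Finset.univ, H.wt f x =
      ∑ x : V → X with Finset.univ.image x = Finset.univ, H.wt (fun _ _ => (0 : ℤ)) x := by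
  classical
  have h1 : ∀ f : X → X → ℤ, (∀ i j, f i j = -f j i) →
      ∑ x : V → X with Finset.univ.image x = Finset.univ, H.wt f x =
      ∑ Z : Finset X, (-1) ^ #Z * (Nat.card {i // i ∉ Z} : ℤ) ^ Nat.card V := by
    intro f hf
    have h2 : ∀ Z : Finset X, ∑ x : V → X with ∀ a, x a ∉ Z, H.wt f x =
        (Nat.card {i // i ∉ Z} : ℤ) ^ Nat.card V := by
      intro Z
      rw [← h.homSum (fun i j : {i // i ∉ Z} => f i j) fun i j => hf _ _, homSum_eq]
      symm
      refine sum_bij' (fun x _ => fun a => (x a).1)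
        (fun x hx => fun a => ⟨x a, (mem_filter.1 hx).2 a⟩) ?_ ?_ ?_ ?_ ?_
      · intro x _
        exact mem_filter.2 ⟨mem_univ _, fun a => (x a).2⟩
      · intro x _
        exact mem_univ _
      · intro x _
        rfl
      · intro x _
        rfl
      · intro x _
        rfl
    simp only [← h2]
    simp only [mul_sum, sum_filter]
    rw [sum_comm]
    refine sum_congr rfl fun x _ => ?_
    simp only [mul_ite, mul_zero]
    rw [← sum_filter]
    -- The sets avoided by `x` are the subsets of the complement of its image; their alternating
    -- count vanishes unless that complement is empty.
    have h3 : (univ.filter fun Z : Finset X => ∀ a, x a ∉ Z) = (univ.image x)ᶜ.powerset := by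
      ext Z
      simp only [mem_filter, mem_univ, true_and, mem_powerset]
      constructor
      · intro hZ i hi
        simp only [mem_compl, mem_image, mem_univ, true_and, not_exists]
        rintro a rfl
        exact hZ a hi
      · intro hZ a ha
        have := hZ ha
        simp at this
    rw [h3, ← sum_mul, sum_powerset_neg_one_pow_card]
    simp only [compl_eq_empty_iff]
    split_ifs <;> simp
  rw [h1 f hf, h1 _ (by simp)]

lemma Balanced.injSum [Fintype V] [Fintype X] (hc : Fintype.card V = Fintype.card X)
    {H : Digraph V} (h : H.Balanced) (f : X → X → ℤ) (hf : ∀ i j, f i j = -f j i) :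
    H.injSum f = H.injSum fun _ _ : X => (0 : ℤ) := by
  classical
  have h1 : (univ.filter fun x : V → X => Function.Injective x) =
      univ.filter fun x : V → X => Finset.univ.image x = Finset.univ := by
    ext x
    simp only [mem_filter, mem_univ, true_and]
    have h2 : Finset.univ.image x = Finset.univ ↔ Function.Surjective x := by
      rw [Finset.eq_univ_iff_forall]
      simp [Function.Surjective]
    rw [h2]
    have h3 := Fintype.bijective_iff_injective_and_card x
    have h4 := Fintype.bijective_iff_surjective_and_card x
    tauto
  have := h.sum_surjective f hf
  rw [injSum_eq, injSum_eq, h1, this]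

lemma Balanced.sum_perm [Fintype V] [DecidableEq V] {H : Digraph V} (h : H.Balanced)
    (f : V → V → ℤ) (hf : ∀ i j, f i j = -f j i) :
    ∑ π : Equiv.Perm V, H.wt f π = (Fintype.card V).factorial := by
  classical
  have h1 : ∀ f : V → V → ℤ, H.injSum f = ∑ π : Equiv.Perm V, H.wt f π := by
    intro f
    rw [injSum_eq]
    have : (univ.filter fun x : V → V => Function.Injective x) =
        univ.image fun π : Equiv.Perm V => (π : V → V) := by
      ext x
      simp only [mem_filter, mem_univ, true_and, mem_image]
      constructor
      · intro hx
        exact ⟨Equiv.ofBijective x (Finite.injective_iff_bijective.1 hx), rfl⟩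
      · rintro ⟨π, rfl⟩
        exact π.injective
    rw [this, sum_image]
    intro π _ π' _ hππ
    exact Equiv.coe_fn_injective hππ
  rw [← h1, h.injSum rfl f hf, h1]
  simp [wt_eq_arcs, Fintype.card_perm]

theorem Balanced.isImpartial [Finite V] {H : Digraph V} (hH : H.IsOriented)
    (h : H.Balanced) : H.IsImpartial := by
  classical
  have := Fintype.ofFinite V
  -- For `n = |H|` injective and surjective maps coincide, so the inclusion-exclusion formula
  -- applies to injections.
  refine ⟨Nat.card V, le_rfl, fun K L hK hL => ?_⟩
  have h0 : Fintype.card V = Fintype.card (Fin (Nat.card V)) := by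
    simp [Nat.card_eq_fintype_card]
  have h1 := h.injSum h0 K.sgn K.sgn_antisymm
  rw [← h.injSum h0 L.sgn L.sgn_antisymm, injSum_sgn hH hK, injSum_sgn hH hL, card_injHom,
    card_injHom] at h1
  have h2 : Nat.card (H.Adj ≃r H.Adj) ≠ 0 := by
    have : Finite (H.Adj ≃r H.Adj) :=
      Finite.of_injective (fun e : H.Adj ≃r H.Adj => e.toEquiv) RelIso.toEquiv_injective
    have : Nonempty (H.Adj ≃r H.Adj) := ⟨RelIso.refl _⟩
    exact Nat.card_pos.ne'
  have h3 := mul_right_cancel₀ (by positivity : (2 : ℤ) ^ #H.arcs ≠ 0) h1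
  exact Nat.eq_of_mul_eq_mul_right (Nat.pos_of_ne_zero h2) (by exact_mod_cast h3)

theorem isImpartial_iff_balanced [Finite V] {H : Digraph V} (hH : H.IsOriented) :
    H.IsImpartial ↔ H.Balanced :=
  ⟨fun h => h.balanced hH, fun h => h.isImpartial hH⟩

end Impartial

/-! ### Connected components -/

section Components

lemma toSimpleGraphInclusive_adj {V : Type*} {H : Digraph V} {a b : V} :
    H.toSimpleGraphInclusive.Adj a b ↔ a ≠ b ∧ (H.Adj a b ∨ H.Adj b a) :=
  SimpleGraph.fromRel_adj _ _ _

/-- A finite digraph is the disjoint union of its connected components. -/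
lemma exists_isomorphic_disjointUnion {V : Type u} [Finite V] {H : Digraph V}
    (hH : H.IsOriented) : ∃ (k : ℕ) (W : Fin k → Type u) (G : ∀ i, Digraph (W i)),
      (∀ i, Finite (W i)) ∧ (∀ i, (G i).toSimpleGraphInclusive.Connected) ∧
      (∀ i, (G i).IsOriented) ∧ H.Isomorphic (disjointUnion G) := by
  classical
  let C := H.toSimpleGraphInclusive.ConnectedComponent
  have : Finite C := Quot.finite _
  let e : C ≃ Fin (Nat.card C) := Finite.equivFin C
  have hadj : ∀ a b, H.Adj a b → H.toSimpleGraphInclusive.Adj a b := fun a b h =>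
    toSimpleGraphInclusive_adj.2 ⟨hH.ne h, Or.inl h⟩
  let G : ∀ i, Digraph {v // H.toSimpleGraphInclusive.connectedComponentMk v = e.symm i} :=
    fun i => ⟨fun a b => H.Adj a b⟩
  refine ⟨Nat.card C, _, G, fun i => inferInstance, fun i => ?_, fun i a b => hH a b, ⟨?_⟩⟩
  · have h1 := (e.symm i).connected_toSimpleGraph
    refine SimpleGraph.Connected.mono (fun a b h => ?_) h1
    have h2 : H.toSimpleGraphInclusive.Adj a.1 b.1 := h
    rw [toSimpleGraphInclusive_adj] at h2 ⊢
    exact ⟨fun h => h2.1 (congrArg _ h), h2.2⟩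
  · refine ⟨⟨fun v => ⟨e (H.toSimpleGraphInclusive.connectedComponentMk v), v, by simp⟩,
      fun p => p.2.1, fun v => rfl, ?_⟩, ?_⟩
    · rintro ⟨i, v, hv⟩
      have : e (H.toSimpleGraphInclusive.connectedComponentMk v) = i := by
        rw [hv, e.apply_symm_apply]
      subst this
      rfl
    · intro a b
      constructor
      · rintro ⟨i, a', b', h1, h2, h⟩
        have h3 := congrArg (fun p => p.2.1) h1
        have h4 := congrArg (fun p => p.2.1) h2
        simp only [Equiv.coe_fn_mk] at h3 h4
        rw [h3, h4]
        exact h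
      · intro h
        have h1 : H.toSimpleGraphInclusive.connectedComponentMk a =
            H.toSimpleGraphInclusive.connectedComponentMk b :=
          SimpleGraph.ConnectedComponent.sound (hadj a b h).reachable
        refine ⟨e (H.toSimpleGraphInclusive.connectedComponentMk a), ⟨a, by simp⟩,
          ⟨b, by simp [h1]⟩, rfl, ?_, h⟩
        simp only [Equiv.coe_fn_mk]
        congr 1
        · rw [h1]
        · congr! 1
          rw [h1]

/-- The characterization of impartial digraphs follows from the connected case. -/
lemma isImpartial_iff_of_connected {V : Type u} [Finite V] {H : Digraph V} (hH : H.IsOriented)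
    (main : ∀ {W : Type u} [Finite W] {G : Digraph W}, G.IsOriented →
      G.toSimpleGraphInclusive.Connected → G.Balanced → G.IsRecursivelyBridgeMirrored) :
    H.IsImpartial ↔ H.IsDisjointUnionOfRBM := by
  rw [isImpartial_iff_balanced hH]
  constructor
  · intro h
    obtain ⟨k, W, G, h1, h2, h3, h4⟩ := exists_isomorphic_disjointUnion hH
    refine ⟨k, W, G, fun i => ?_, h4⟩
    obtain ⟨e⟩ := h4
    exact main (h3 i) (h2 i) (balanced_disjointUnion.1 (h.iso e) i)
  · rintro ⟨k, W, G, h1, ⟨e⟩⟩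
    have := fun i => (isRecursivelyBridgeMirrored_balanced (h1 i)).1
    exact (balanced_disjointUnion.2 fun i =>
      (isRecursivelyBridgeMirrored_balanced (h1 i)).2).iso e.symm

end Components

end Digraph

namespace SimpleGraph

/-! ### Reachability and deletion of an edge -/

section Reach

variable {V : Type*} {W : Type*} {G : SimpleGraph V}

lemma Reachable.induction {p u : V} (h : G.Reachable p u) {P : V → Prop} (h0 : P p)
    (hs : ∀ u w, G.Reachable p u → P u → G.Adj u w → P w) : P u := by
  rw [reachable_iff_reflTransGen] at h
  induction h with
  | refl => exact h0
  | tail h1 h2 ih => exact hs _ _ ((reachable_iff_reflTransGen _ _).2 h1) ih h2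

/-- The graph with the edge `xy` deleted. -/
def del (G : SimpleGraph V) (x y : V) : SimpleGraph V := G.deleteEdges {s(x, y)}

lemma del_adj {x y a b : V} :
    (G.del x y).Adj a b ↔ G.Adj a b ∧ ¬ (a = x ∧ b = y ∨ a = y ∧ b = x) := by
  simp [del]

lemma del_comm (x y : V) : G.del x y = G.del y x := by
  unfold del
  rw [Sym2.eq_swap]

lemma del_le (x y : V) : G.del x y ≤ G := deleteEdges_le _

lemma reachable_del {x y v : V} (h : G.Reachable x v) :
    (G.del x y).Reachable x v ∨ (G.del x y).Reachable y v := by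
  refine h.induction (P := fun v => (G.del x y).Reachable x v ∨ (G.del x y).Reachable y v)
    (Or.inl .rfl) fun u w _ ih huw => ?_
  by_cases h1 : u = x ∧ w = y ∨ u = y ∧ w = x
  · rcases h1 with ⟨rfl, rfl⟩ | ⟨rfl, rfl⟩
    · exact Or.inr .rfl
    · exact Or.inl .rfl
  · have h2 : (G.del x y).Reachable u w := (del_adj.2 ⟨huw, h1⟩).reachable
    exact ih.imp (fun h => h.trans h2) fun h => h.trans h2

lemma IsAcyclic.not_reachable_del (hG : G.IsAcyclic) {x y : V} (h : G.Adj x y) :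
    ¬ (G.del x y).Reachable x y :=
  isBridge_iff.1 (isAcyclic_iff_forall_adj_isBridge.1 hG h)

lemma IsAcyclic.del (hG : G.IsAcyclic) (x y : V) : (G.del x y).IsAcyclic :=
  hG.anti (del_le x y)

end Reach

/-! ### Flips -/

section Flip

variable {V : Type*} {W : Type*}

/-- No automorphism exchanges the ends of an edge. -/
def FlipFree (F : SimpleGraph V) : Prop :=
  ∀ φ : F ≃g F, ∀ x y, F.Adj x y → φ x = y → φ y ≠ x

lemma FlipFree.iso {F : SimpleGraph V} {F' : SimpleGraph W} (e : F ≃g F') (h : F.FlipFree) :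
    F'.FlipFree := by
  intro φ x y hxy h1 h2
  refine h ((e.trans φ).trans e.symm) (e.symm x) (e.symm y) (e.symm.map_rel_iff.2 hxy) ?_ ?_
  · simp [h1]
  · simp [h2]

/-- A map that is a local automorphism on the component of `x` and that keeps the component
extends to an automorphism. -/
lemma exists_iso_of_local [Finite V] {G : SimpleGraph V} {x : V} (f : V → V)
    (hx : G.Reachable x (f x))
    (hinj : ∀ u w, G.Reachable x u → G.Reachable x w → f u = f w → u = w)
    (hadj : ∀ u w, G.Reachable x u → G.Reachable x w → (G.Adj u w ↔ G.Adj (f u) (f w))) :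
    ∃ g : G ≃g G, (∀ u, G.Reachable x u → g u = f u) ∧ ∀ u, ¬ G.Reachable x u → g u = u := by
  classical
  have h1 : ∀ u, G.Reachable x u → G.Reachable x (f u) := by
    intro u hu
    refine hu.induction (P := fun u => G.Reachable x (f u)) hx fun a b ha hfa hab => ?_
    exact hfa.trans ((hadj a b ha (ha.trans hab.reachable)).1 hab).reachable
  let g : V → V := fun u => if G.Reachable x u then f u else u
  have hg1 : ∀ u, G.Reachable x u → g u = f u := fun u hu => if_pos hu
  have hg2 : ∀ u, ¬ G.Reachable x u → g u = u := fun u hu => if_neg hu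
  have hg : Function.Injective g := by
    intro u w huw
    by_cases hu : G.Reachable x u <;> by_cases hw : G.Reachable x w
    · rw [hg1 u hu, hg1 w hw] at huw
      exact hinj u w hu hw huw
    · rw [hg1 u hu, hg2 w hw] at huw
      exact absurd (huw ▸ h1 u hu) hw
    · rw [hg2 u hu, hg1 w hw] at huw
      exact absurd (huw ▸ h1 w hw) hu
    · rwa [hg2 u hu, hg2 w hw] at huw
  refine ⟨⟨Equiv.ofBijective g (Finite.injective_iff_bijective.1 hg), ?_⟩, hg1, hg2⟩
  intro u w
  simp only [Equiv.ofBijective_apply]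
  by_cases hu : G.Reachable x u <;> by_cases hw : G.Reachable x w
  · rw [hg1 u hu, hg1 w hw]
    exact (hadj u w hu hw).symm
  · rw [hg1 u hu, hg2 w hw]
    exact ⟨fun h => absurd ((h1 u hu).trans h.reachable) hw,
      fun h => absurd (hu.trans h.reachable) hw⟩
  · rw [hg2 u hu, hg1 w hw]
    exact ⟨fun h => absurd ((h1 w hw).trans h.symm.reachable) hu,
      fun h => absurd (hw.trans h.symm.reachable) hu⟩
  · rw [hg2 u hu, hg2 w hw]

lemma sum_reachable_inl {G : SimpleGraph V} {H : SimpleGraph W} {u : V} {x : V ⊕ W}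
    (h : (G ⊕g H).Reachable (.inl u) x) : ∃ v, x = .inl v ∧ G.Reachable u v := by
  refine h.induction (P := fun x => ∃ v, x = .inl v ∧ G.Reachable u v) ⟨u, rfl, .rfl⟩ ?_
  rintro _ (b | b) _ ⟨v, rfl, hv⟩ hab
  · exact ⟨b, rfl, hv.trans (sum_adj_inl.1 hab).reachable⟩
  · simp at hab

lemma sum_reachable_inl_inl {G : SimpleGraph V} {H : SimpleGraph W} {u v : V} :
    (G ⊕g H).Reachable (.inl u) (.inl v) ↔ G.Reachable u v := by
  constructor
  · intro h
    obtain ⟨w, h1, h2⟩ := sum_reachable_inl h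
    cases h1
    exact h2
  · intro h
    exact h.map (Embedding.sumInl (G := G) (H := H)).toHom

lemma sum_reachable_inr_inr {G : SimpleGraph V} {H : SimpleGraph W} {u v : W} :
    (G ⊕g H).Reachable (.inr u) (.inr v) ↔ H.Reachable u v := by
  rw [← sum_reachable_inl_inl (G := H) (H := G)]
  exact (Iso.reachable_iff (φ := Iso.sumComm (G := G) (H := H)) (u := .inr u) (v := .inr v)).symm

lemma not_sum_reachable {G : SimpleGraph V} {H : SimpleGraph W} {u : V} {v : W} :
    ¬ (G ⊕g H).Reachable (.inl u) (.inr v) := by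
  intro h
  obtain ⟨w, h1, h2⟩ := sum_reachable_inl h
  cases h1

/-- The exchanged vertices are adjacent, so their component, which lies in the left summand, is
preserved. The restriction to it, extended by the identity, flips an edge of `G`. -/
lemma flip_inl_of_sum [Finite V] {G : SimpleGraph V} {H : SimpleGraph W}
    (φ : G ⊕g H ≃g G ⊕g H) {x y : V} (hxy : G.Adj x y) (h1 : φ (.inl x) = .inl y)
    (h2 : φ (.inl y) = .inl x) : ¬ G.FlipFree := by
  -- The value `v` for images in the right summand is a dummy; it does not occur on the component of
  -- `x`.
  let f : V → V := fun v => Sum.elim id (fun _ => v) (φ (.inl v))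
  have hf : ∀ v, G.Reachable x v → φ (.inl v) = .inl (f v) := by
    intro v hv
    have h3 : (G ⊕g H).Reachable (φ (.inl x)) (φ (.inl v)) :=
      (Iso.reachable_iff (φ := φ)).2 (sum_reachable_inl_inl.2 hv)
    rw [h1] at h3
    obtain ⟨w, hw, -⟩ := sum_reachable_inl h3
    simp [f, hw]
  have hx : f x = y := by simp [f, h1]
  have hy : f y = x := by simp [f, h2]
  obtain ⟨g, hg, -⟩ := exists_iso_of_local (G := G) (x := x) f (by rw [hx]; exact hxy.reachable)
    (fun u w hu hw huw => by
      have : φ (.inl u) = φ (.inl w) := by rw [hf u hu, hf w hw, huw]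
      exact Sum.inl_injective (φ.injective this))
    fun u w hu hw => by
      rw [← sum_adj_inl (G := G) (H := H), ← sum_adj_inl (G := G) (H := H) (v := f u),
        ← hf u hu, ← hf w hw]
      exact (φ.map_rel_iff).symm
  intro h
  refine h g x y hxy ?_ ?_
  · rw [hg x .rfl, hx]
  · rw [hg y hxy.reachable, hy]

lemma FlipFree.sum [Finite V] [Finite W] {G : SimpleGraph V} {H : SimpleGraph W}
    (hG : G.FlipFree) (hH : H.FlipFree) : (G ⊕g H).FlipFree := by
  rintro φ (x | x) (y | y) hxy h1 h2
  · exact flip_inl_of_sum φ (sum_adj_inl.1 hxy) h1 h2 hG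
  · simp at hxy
  · simp at hxy
  · refine flip_inl_of_sum ((Iso.sumComm.trans φ).trans Iso.sumComm) (sum_adj_inr.1 hxy) ?_ ?_ hH
    · simp [h1]
    · simp [h2]

lemma FlipFree.of_sum {G : SimpleGraph V} {H : SimpleGraph W} (h : (G ⊕g H).FlipFree) :
    G.FlipFree := by
  intro φ x y hxy h1 h2
  refine h (Iso.sumCongr φ Iso.refl) (.inl x) (.inl y) (sum_adj_inl.2 hxy) ?_ ?_
  · simp [h1]
  · simp [h2]

lemma FlipFree.of_sum_right {G : SimpleGraph V} {H : SimpleGraph W} (h : (G ⊕g H).FlipFree) :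
    H.FlipFree :=
  (h.iso Iso.sumComm).of_sum

end Flip

/-! ### Parity equivalence of spanning subgraph sums -/

section Parity

variable {V : Type*} {W : Type*}

/-- The finite set of spanning subgraphs. -/
noncomputable def subs [Finite V] (G : SimpleGraph V) : Finset (SimpleGraph V) :=
  (Set.toFinite {F | F ≤ G}).toFinset

@[simp] lemma mem_subs [Finite V] {G F : SimpleGraph V} : F ∈ G.subs ↔ F ≤ G := by
  simp [subs]

/-- Every isomorphism invariant modulo `2` that vanishes at graphs that are not flip-free has the
same sum over the spanning subgraphs of `G` as over those of `R`. -/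
def ParityEq [Finite V] (G R : SimpleGraph V) : Prop :=
  ∀ M : SimpleGraph V → ZMod 2, (∀ F F' : SimpleGraph V, Nonempty (F ≃g F') → M F = M F') →
    (∀ F, ¬ F.FlipFree → M F = 0) → ∑ F ∈ G.subs, M F = ∑ F ∈ R.subs, M F

lemma ParityEq.refl [Finite V] (G : SimpleGraph V) : ParityEq G G := fun _ _ _ => rfl

lemma ParityEq.trans [Finite V] {G R S : SimpleGraph V} (h1 : ParityEq G R)
    (h2 : ParityEq R S) : ParityEq G S := fun M h h' => (h1 M h h').trans (h2 M h h')

/-- Spanning subgraphs correspond under an isomorphism. -/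
lemma sum_subs_comap [Finite V] [Finite W] {A : Type*} [AddCommMonoid A] (e : V ≃ W)
    (G : SimpleGraph W) (M : SimpleGraph V → A) :
    ∑ F ∈ (G.comap e).subs, M F = ∑ F ∈ G.subs, M (F.comap e) := by
  refine Finset.sum_bij' (fun F _ => F.comap e.symm) (fun F _ => F.comap e) ?_ ?_ ?_ ?_ ?_
  · intro F hF
    rw [mem_subs] at hF ⊢
    intro a b hab
    simpa using hF hab
  · intro F hF
    rw [mem_subs] at hF ⊢
    intro a b hab
    exact hF hab
  · intro F _
    ext a b
    simp
  · intro F _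
    ext a b
    simp
  · intro F _
    congr 1
    ext a b
    simp

lemma ParityEq.comap [Finite V] [Finite W] (e : V ≃ W) {G R : SimpleGraph W}
    (h : ParityEq G R) : ParityEq (G.comap e) (R.comap e) := by
  intro M h1 h2
  rw [sum_subs_comap, sum_subs_comap]
  refine h (fun F => M (F.comap e)) ?_ ?_
  · rintro F F' ⟨φ⟩
    exact h1 _ _ ⟨((Iso.comap e F).trans φ).trans (Iso.comap e F').symm⟩
  · intro F hF
    exact h2 _ fun h => hF (h.iso (Iso.comap e F))

lemma sum_subs_sum [Finite V] [Finite W] {A : Type*} [AddCommMonoid A]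
    (G : SimpleGraph V) (H : SimpleGraph W) (M : SimpleGraph (V ⊕ W) → A) :
    ∑ F ∈ (G ⊕g H).subs, M F = ∑ F1 ∈ G.subs, ∑ F2 ∈ H.subs, M (F1 ⊕g F2) := by
  rw [← Finset.sum_product']
  refine Finset.sum_bij' (fun F _ => (F.comap Sum.inl, F.comap Sum.inr))
    (fun P _ => P.1 ⊕g P.2) ?_ ?_ ?_ ?_ ?_
  · intro F hF
    rw [Finset.mem_product, mem_subs, mem_subs]
    rw [mem_subs] at hF
    exact ⟨fun a b hab => sum_adj_inl.1 (hF hab), fun a b hab => sum_adj_inr.1 (hF hab)⟩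
  · rintro ⟨F1, F2⟩ hF
    rw [Finset.mem_product, mem_subs, mem_subs] at hF
    rw [mem_subs]
    rintro (a | a) (b | b) hab
    · exact sum_adj_inl.2 (hF.1 (sum_adj_inl.1 hab))
    · simp at hab
    · simp at hab
    · exact sum_adj_inr.2 (hF.2 (sum_adj_inr.1 hab))
  · intro F hF
    rw [mem_subs] at hF
    ext (a | a) (b | b)
    · simp
    · simpa using fun h => by simpa using hF h
    · simpa using fun h => by simpa using hF h
    · simp
  · rintro ⟨F1, F2⟩ _
    ext a b <;> simp
  · intro F hF
    rw [mem_subs] at hF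
    congr 1
    ext (a | a) (b | b)
    · simp
    · simpa using fun h => by simpa using hF h
    · simpa using fun h => by simpa using hF h
    · simp

/-- With one summand fixed, `M` is an admissible test function of the other, since a flip in a
summand is a flip of the sum. -/
lemma ParityEq.sum [Finite V] [Finite W] {G R : SimpleGraph V} {H S : SimpleGraph W}
    (h1 : ParityEq G R) (h2 : ParityEq H S) : ParityEq (G ⊕g H) (R ⊕g S) := by
  intro M hM hM'
  rw [sum_subs_sum, sum_subs_sum]
  have h3 : ∀ F1 : SimpleGraph V, ∑ F2 ∈ H.subs, M (F1 ⊕g F2) = ∑ F2 ∈ S.subs, M (F1 ⊕g F2) := by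
    intro F1
    refine h2 (fun F2 => M (F1 ⊕g F2)) ?_ ?_
    · rintro F F' ⟨φ⟩
      exact hM _ _ ⟨Iso.sumCongr Iso.refl φ⟩
    · intro F hF
      exact hM' _ fun h => hF h.of_sum_right
  simp only [h3]
  rw [Finset.sum_comm, Finset.sum_comm (s := R.subs)]
  refine Finset.sum_congr rfl fun F2 _ => ?_
  refine h1 (fun F1 => M (F1 ⊕g F2)) ?_ ?_
  · rintro F F' ⟨φ⟩
    exact hM _ _ ⟨Iso.sumCongr φ Iso.refl⟩
  · intro F hF
    exact hM' _ fun h => hF h.of_sum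

/-- Two copies of `K` with an edge between the two copies of `r`. -/
def mirror (K : SimpleGraph W) (r : W) : SimpleGraph (W ⊕ W) where
  Adj
    | .inl x, .inl y => K.Adj x y
    | .inr x, .inr y => K.Adj x y
    | .inl x, .inr y => x = r ∧ y = r
    | .inr x, .inl y => x = r ∧ y = r
  symm := ⟨by
    rintro (x | x) (y | y) h
    · exact SimpleGraph.Adj.symm (G := K) h
    · exact h.symm
    · exact h.symm
    · exact SimpleGraph.Adj.symm (G := K) h⟩
  loopless := ⟨by
    rintro (x | x) h
    · exact K.irrefl h
    · exact K.irrefl h⟩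

variable {K : SimpleGraph W} {r : W}

@[simp] lemma mirror_inl_inl {x y : W} : (K.mirror r).Adj (.inl x) (.inl y) ↔ K.Adj x y := Iff.rfl

@[simp] lemma mirror_inr_inr {x y : W} : (K.mirror r).Adj (.inr x) (.inr y) ↔ K.Adj x y := Iff.rfl

@[simp] lemma mirror_inl_inr {x y : W} :
    (K.mirror r).Adj (.inl x) (.inr y) ↔ x = r ∧ y = r := Iff.rfl

@[simp] lemma mirror_inr_inl {x y : W} :
    (K.mirror r).Adj (.inr x) (.inl y) ↔ x = r ∧ y = r := Iff.rfl

lemma sum_le_mirror : K ⊕g K ≤ K.mirror r := by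
  rintro (a | a) (b | b) h <;> simp at h ⊢ <;> exact h

lemma le_sum_of_le_mirror {F : SimpleGraph (W ⊕ W)} (h : F ≤ K.mirror r)
    (hF : ¬ F.Adj (.inl r) (.inr r)) : F ≤ K ⊕g K := by
  rintro (a | a) (b | b) hab
  · exact sum_adj_inl.2 (h hab)
  · obtain ⟨rfl, rfl⟩ := h hab
    exact absurd hab hF
  · obtain ⟨rfl, rfl⟩ := h hab
    exact absurd hab.symm hF
  · exact sum_adj_inr.2 (h hab)

/-- The reflection of a spanning subgraph of a mirrored graph. -/
abbrev reflect (F : SimpleGraph (W ⊕ W)) : SimpleGraph (W ⊕ W) := F.comap (Equiv.sumComm W W)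

lemma reflect_reflect (F : SimpleGraph (W ⊕ W)) : F.reflect.reflect = F := by
  ext a b
  simp

lemma reflect_le_mirror {F : SimpleGraph (W ⊕ W)} (h : F ≤ K.mirror r) :
    F.reflect ≤ K.mirror r := by
  rintro (a | a) (b | b) hab
  · exact (mirror_inr_inr (K := K) (r := r)).1 (h (show F.Adj (.inr a) (.inr b) from hab))
  · exact (mirror_inr_inl (K := K) (r := r)).1 (h (show F.Adj (.inr a) (.inl b) from hab))
  · exact (mirror_inl_inr (K := K) (r := r)).1 (h (show F.Adj (.inl a) (.inr b) from hab))
  · exact (mirror_inl_inl (K := K) (r := r)).1 (h (show F.Adj (.inl a) (.inl b) from hab))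

lemma not_flipFree_of_reflect {F : SimpleGraph (W ⊕ W)} (h : F.reflect = F)
    (hF : F.Adj (.inl r) (.inr r)) : ¬ F.FlipFree := by
  intro h'
  have hφ : ∀ a b, F.Adj (Equiv.sumComm W W a) (Equiv.sumComm W W b) ↔ F.Adj a b := by
    intro a b
    conv_rhs => rw [← h]
    rfl
  exact h' ⟨Equiv.sumComm W W, hφ _ _⟩ _ _ hF rfl rfl

/-- Spanning subgraphs without the central edge are those of `K ⊕g K`. Those with it are paired with
their isomorphic reflections and cancel modulo 2; if one equals its reflection, its central edge is
flipped and `M` vanishes at it. -/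
lemma parityEq_mirror [Finite W] (K : SimpleGraph W) (r : W) :
    ParityEq (K.mirror r) (K ⊕g K) := by
  classical
  intro M hM hM'
  rw [← Finset.sum_filter_add_sum_filter_not _
    (fun F : SimpleGraph (W ⊕ W) => F.Adj (.inl r) (.inr r))]
  have h1 : ((K.mirror r).subs.filter fun F => ¬ F.Adj (.inl r) (.inr r)) = (K ⊕g K).subs := by
    ext F
    rw [Finset.mem_filter, mem_subs, mem_subs]
    refine ⟨fun h => le_sum_of_le_mirror h.1 h.2, fun h => ⟨h.trans sum_le_mirror, fun h' => ?_⟩⟩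
    simpa using h h'
  rw [h1, Finset.sum_involution fun F _ => F.reflect, zero_add]
  · intro F _
    rw [hM F.reflect F ⟨Iso.comap (Equiv.sumComm W W) F⟩]
    exact CharTwo.add_self_eq_zero _
  · intro F hF hMF h
    exact hMF (hM' F (not_flipFree_of_reflect h (Finset.mem_filter.1 hF).2))
  · intro F hF
    rw [Finset.mem_filter, mem_subs] at hF ⊢
    exact ⟨reflect_le_mirror hF.1, hF.2.symm⟩
  · intro F _
    exact reflect_reflect F

end Parity

end SimpleGraph

namespace SimpleGraph

/-! ### Trees with flips and their reductions -/

section FlipStructure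

variable {V : Type u} {W : Type v}

/-- A tree with a flipped edge is a mirrored tree. -/
lemma exists_mirror_iso [Finite V] {G : SimpleGraph V} (hG : G.IsTree) (h : ¬ G.FlipFree) :
    ∃ (W : Type u) (_ : Finite W) (K : SimpleGraph W) (r : W),
      K.IsTree ∧ Nonempty (K.mirror r ≃g G) := by
  classical
  unfold FlipFree at h
  push Not at h
  obtain ⟨φ, x, y, hxy, h1, h2⟩ := h
  let G' := G.del x y
  have hφ : ∀ a b, G'.Adj (φ a) (φ b) ↔ G'.Adj a b := by
    intro a b
    simp only [G', del_adj, φ.map_adj_iff]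
    have e1 : ∀ a, φ a = x ↔ a = y := fun a => by rw [← h2, φ.injective.eq_iff]
    have e2 : ∀ a, φ a = y ↔ a = x := fun a => by rw [← h1, φ.injective.eq_iff]
    rw [e1, e2, e1, e2]
    tauto
  let φ' : G' ≃g G' := ⟨φ.toEquiv, hφ _ _⟩
  have hnr : ¬ G'.Reachable x y := hG.isAcyclic.not_reachable_del hxy
  have hr : ∀ v, G'.Reachable x v ∨ G'.Reachable y v := fun v =>
    reachable_del (hG.connected.preconnected x v)
  have hφr : ∀ v, G'.Reachable y (φ v) ↔ G'.Reachable x v := by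
    intro v
    have := Iso.reachable_iff (φ := φ') (u := x) (v := v)
    rwa [show φ' x = y from h1] at this
  -- Without the edge `xy` there are two sides, which `φ` exchanges; so `s` and its image under `φ`
  -- partition the vertices.
  let s : Set V := (G'.connectedComponentMk x).supp
  have hs : ∀ v, v ∈ s ↔ G'.Reachable x v := fun v => by
    simp only [s, ConnectedComponent.mem_supp_iff, ConnectedComponent.eq]
    exact ⟨fun h => h.symm, fun h => h.symm⟩
  let f : s ⊕ s → V := Sum.elim (fun w => w.1) fun w => φ w.1
  have hf : Function.Bijective f := by
    constructor
    · rintro (a | a) (b | b) hab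
      · exact congrArg _ (Subtype.ext hab)
      · exfalso
        have ha := (hs _).1 a.2
        have hb := (hφr _).2 ((hs _).1 b.2)
        rw [show a.1 = φ b.1 from hab] at ha
        exact hnr (ha.trans hb.symm)
      · exfalso
        have ha := (hs _).1 b.2
        have hb := (hφr _).2 ((hs _).1 a.2)
        rw [show φ a.1 = b.1 from hab] at hb
        exact hnr (ha.trans hb.symm)
      · exact congrArg _ (Subtype.ext (φ.injective hab))
    · intro v
      rcases hr v with h | h
      · exact ⟨.inl ⟨v, (hs v).2 h⟩, rfl⟩
      · obtain ⟨w, rfl⟩ := φ.surjective v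
        exact ⟨.inr ⟨w, (hs w).2 ((hφr w).1 h)⟩, rfl⟩
  have hcross : ∀ a b, G'.Reachable x a → G'.Reachable x b →
      (G.Adj a (φ b) ↔ a = x ∧ b = x) := by
    intro a b ha hb
    constructor
    · intro h
      by_contra hne
      have h3 : G'.Adj a (φ b) := by
        refine del_adj.2 ⟨h, ?_⟩
        rintro (⟨rfl, h4⟩ | ⟨rfl, h4⟩)
        · exact hne ⟨rfl, φ.injective (h4.trans h1.symm)⟩
        · exact hnr ha
      exact hnr ((ha.trans h3.reachable).trans ((hφr b).2 hb).symm)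
    · rintro ⟨rfl, rfl⟩
      rwa [h1]
  have hK : (G.induce s).IsTree := by
    refine ⟨?_, hG.isAcyclic.induce s⟩
    have h3 := (G'.connectedComponentMk x).connected_toSimpleGraph
    exact h3.mono fun a b hab => del_le x y hab
  refine ⟨s, inferInstance, G.induce s, ⟨x, (hs x).2 .rfl⟩, hK, ⟨Equiv.ofBijective f hf, ?_⟩⟩
  rintro (a | a) (b | b)
  · rfl
  · have := hcross a.1 b.1 ((hs _).1 a.2) ((hs _).1 b.2)
    simp only [Equiv.ofBijective_apply, mirror_inl_inr, Subtype.ext_iff]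
    exact this
  · have := hcross b.1 a.1 ((hs _).1 b.2) ((hs _).1 a.2)
    simp only [Equiv.ofBijective_apply, mirror_inr_inl, Subtype.ext_iff]
    rw [and_comm, ← this]
    exact G.adj_comm _ _
  · exact φ.map_adj_iff

lemma sum_reachable_isLeft {G : SimpleGraph V} {H : SimpleGraph W} {x y : V ⊕ W}
    (h : (G ⊕g H).Reachable x y) : x.isLeft = y.isLeft := by
  rcases x with x | x <;> rcases y with y | y
  · rfl
  · exact absurd h not_sum_reachable
  · exact absurd h.symm not_sum_reachable
  · rfl

lemma Sum.elim_id_injective_of {x y : W ⊕ W} (h : x.isLeft = y.isLeft)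
    (h' : Sum.elim id id x = Sum.elim id id y) : x = y := by
  rcases x with x | x <;> rcases y with y | y <;> simp at h h' <;> rw [h']

lemma card_reachable_inl {G : SimpleGraph V} {H : SimpleGraph W} (v : V) :
    Nat.card {w // (G ⊕g H).Reachable (.inl v) w} = Nat.card {w // G.Reachable v w} := by
  refine Nat.card_congr (Equiv.ofBijective (fun w : {w // G.Reachable v w} =>
    (⟨.inl w.1, sum_reachable_inl_inl.2 w.2⟩ : {w // (G ⊕g H).Reachable (.inl v) w})) ⟨?_, ?_⟩).symm
  · intro a b hab
    exact Subtype.ext (Sum.inl_injective (congrArg Subtype.val hab))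
  · rintro ⟨w, hw⟩
    obtain ⟨u, rfl, hu⟩ := sum_reachable_inl hw
    exact ⟨⟨u, hu⟩, rfl⟩

lemma card_reachable_inr {G : SimpleGraph V} {H : SimpleGraph W} (v : W) :
    Nat.card {w // (G ⊕g H).Reachable (.inr v) w} = Nat.card {w // H.Reachable v w} := by
  rw [← card_reachable_inl (G := H) (H := G)]
  exact Nat.card_congr ((Equiv.sumComm V W).subtypeEquiv fun w =>
    (Iso.reachable_iff (φ := Iso.sumComm (G := G) (H := H))).symm)

variable {K : SimpleGraph W} {r : W}

/-- The reflection of a mirrored graph. -/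
@[simps!]
def mirrorSwap (K : SimpleGraph W) (r : W) : K.mirror r ≃g K.mirror r where
  toEquiv := Equiv.sumComm W W
  map_rel_iff' := by
    rintro (a | a) (b | b) <;> simp

lemma mirror_del : (K.mirror r).del (.inl r) (.inr r) = K ⊕g K := by
  ext (a | a) (b | b) <;> simp [del_adj]

/-- An automorphism of a mirrored connected graph does not map the central edge into the left
copy. -/
lemma mirror_iso_not_inl [Finite W] (hK : K.Connected) (φ : K.mirror r ≃g K.mirror r) {a b : W}
    (ha : φ (.inl r) = .inl a) (hb : φ (.inr r) = .inl b) : False := by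
  have hr : ∀ u v, ((K.mirror r).del (.inl a) (.inl b)).Adj (φ u) (φ v) ↔ (K ⊕g K).Adj u v := by
    intro u v
    rw [← mirror_del (r := r), del_adj, del_adj, φ.map_adj_iff, ← ha, ← hb]
    simp only [φ.injective.eq_iff]
  let ψ : K ⊕g K ≃g (K.mirror r).del (.inl a) (.inl b) := ⟨φ.toEquiv, hr _ _⟩
  have h1 : ∀ w, ((K.mirror r).del (.inl a) (.inl b)).Reachable (.inl r) (.inr w) := by
    intro w
    have h2 : ((K.mirror r).del (.inl a) (.inl b)).Adj (.inl r) (.inr r) := by simp [del_adj]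
    refine h2.reachable.trans (((sum_reachable_inr_inr (G := (⊥ : SimpleGraph W))).2
      (hK.preconnected r w)).mono ?_)
    rintro (u | u) (v | v) huv
    · simp at huv
    · simp at huv
    · simp at huv
    · simpa [del_adj] using huv
  have h2 : ∀ z, ((K.mirror r).del (.inl a) (.inl b)).Reachable (.inl r) z →
      (ψ.symm z).isLeft = (ψ.symm (.inl r)).isLeft := fun z hz =>
    (sum_reachable_isLeft ((Iso.reachable_iff (φ := ψ.symm)).2 hz)).symm
  have h3 : ∀ z z', ((K.mirror r).del (.inl a) (.inl b)).Reachable (.inl r) z →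
      ((K.mirror r).del (.inl a) (.inl b)).Reachable (.inl r) z' →
      Sum.elim id id (ψ.symm z) = Sum.elim id id (ψ.symm z') → z = z' := by
    intro z z' hz hz' h
    refine ψ.symm.injective (Sum.elim_id_injective_of ((h2 z hz).trans (h2 z' hz').symm) h)
  have := Fintype.ofFinite W
  -- After deletion of `ab` the vertex `inl r` is still joined to the entire right copy. These `|W|
  -- + 1` vertices, indexed by `Option W`, land in a single summand under `ψ.symm`, which has only
  -- `|W|` vertices.
  have h4 := Fintype.card_le_of_injective
    (fun o : Option W => Sum.elim id id (ψ.symm (o.elim (.inl r) .inr))) (by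
      have h5 : ∀ o : Option W, ((K.mirror r).del (.inl a) (.inl b)).Reachable (.inl r)
          (o.elim (.inl r) .inr) := by
        rintro (_ | w)
        · exact .rfl
        · exact h1 w
      rintro (_ | w) (_ | w') h
      · rfl
      · exact absurd (h3 _ _ (h5 none) (h5 (some w')) h) (by simp)
      · exact absurd (h3 _ _ (h5 (some w)) (h5 none) h) (by simp)
      · have := h3 _ _ (h5 (some w)) (h5 (some w')) h
        simpa using this)
  rw [Fintype.card_option] at h4
  omega

/-- The image of the central edge lies neither in the left copy nor, after composition with the
reflection, in the right copy; the only other edge is the central one. -/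
lemma mirror_iso_inl [Finite W] (hK : K.Connected) (φ : K.mirror r ≃g K.mirror r) :
    (φ (.inl r) = .inl r ∧ φ (.inr r) = .inr r) ∨
      (φ (.inl r) = .inr r ∧ φ (.inr r) = .inl r) := by
  have h : (K.mirror r).Adj (φ (.inl r)) (φ (.inr r)) := φ.map_adj_iff.2 (by simp)
  rcases ha : φ (.inl r) with a | a <;> rcases hb : φ (.inr r) with b | b
  · exact (mirror_iso_not_inl hK φ ha hb).elim
  · rw [ha, hb, mirror_inl_inr] at h
    simp [h]
  · rw [ha, hb, mirror_inr_inl] at h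
    simp [h]
  · exfalso
    refine mirror_iso_not_inl hK (φ.trans (mirrorSwap K r)) (a := a) (b := b) ?_ ?_
    · simp [ha]
    · simp [hb]

/-- If automorphisms of `K` with a fixed vertex are trivial, so are those of a mirror of `K`. -/
lemma mirror_rigid [Finite W] (hK : K.Connected)
    (h : ∀ φ : K ≃g K, ∀ v, φ v = v → ∀ w, φ w = w) (φ : K.mirror r ≃g K.mirror r)
    {v : W ⊕ W} (hv : φ v = v) (w : W ⊕ W) : φ w = w := by
  have hφ : ∀ u v, (K ⊕g K).Adj (φ u) (φ v) ↔ (K ⊕g K).Adj u v := by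
    intro u v
    rw [← mirror_del (r := r), del_adj, del_adj, φ.map_adj_iff]
    have e1 := φ.injective.eq_iff (a := u) (b := .inl r)
    have e2 := φ.injective.eq_iff (a := u) (b := .inr r)
    have e3 := φ.injective.eq_iff (a := v) (b := .inl r)
    have e4 := φ.injective.eq_iff (a := v) (b := .inr r)
    rcases mirror_iso_inl hK φ with ⟨h1, h2⟩ | ⟨h1, h2⟩ <;> rw [h1] at e1 e3 <;>
      rw [h2] at e2 e4 <;> rw [e1, e2, e3, e4]
    tauto
  let ψ : K ⊕g K ≃g K ⊕g K := ⟨φ.toEquiv, hφ _ _⟩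
  have hleft : ∀ u v : W ⊕ W, u.isLeft = v.isLeft → (φ u).isLeft = (φ v).isLeft := by
    intro u v huv
    refine sum_reachable_isLeft (G := K) (H := K) ((Iso.reachable_iff (φ := ψ)).2 ?_)
    rcases u with u | u <;> rcases v with v | v <;> simp at huv
    · exact sum_reachable_inl_inl.2 (hK.preconnected u v)
    · exact sum_reachable_inr_inr.2 (hK.preconnected u v)
  -- An automorphism that exchanges the two roots exchanges the whole copies and has no fixed
  -- vertex.
  have hfix : φ (.inl r) = .inl r ∧ φ (.inr r) = .inr r := by
    refine (mirror_iso_inl hK φ).resolve_right ?_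
    rintro ⟨h1, h2⟩
    rcases v with v | v
    · have := hleft (.inl v) (.inl r) rfl
      rw [hv, h1] at this
      simp at this
    · have := hleft (.inr v) (.inr r) rfl
      rw [hv, h2] at this
      simp at this
  have h1 : ∀ u, ∃ u', φ (.inl u) = .inl u' := by
    intro u
    have := hleft (.inl u) (.inl r) rfl
    rw [hfix.1] at this
    exact Sum.isLeft_iff.1 this
  have h2 : ∀ u, ∃ u', φ (.inr u) = .inr u' := by
    intro u
    have := hleft (.inr u) (.inr r) rfl
    rw [hfix.2] at this
    exact Sum.isRight_iff.1 (by simpa using this)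
  choose f hf using h1
  choose g hg using h2
  have hfi : Function.Injective f := fun a b hab => Sum.inl_injective (φ.injective (by
    rw [hf, hf, hab]))
  have hgi : Function.Injective g := fun a b hab => Sum.inr_injective (φ.injective (by
    rw [hg, hg, hab]))
  rcases w with w | w
  · have := h ⟨Equiv.ofBijective f (Finite.injective_iff_bijective.1 hfi), fun {a b} => by
      have := hφ (.inl a) (.inl b)
      rwa [hf, hf, sum_adj_inl, sum_adj_inl] at this⟩ r
      (Sum.inl_injective ((hf r).symm.trans hfix.1)) w
    rw [hf]
    exact congrArg _ this
  · have := h ⟨Equiv.ofBijective g (Finite.injective_iff_bijective.1 hgi), fun {a b} => by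
      have := hφ (.inr a) (.inr b)
      rwa [hg, hg, sum_adj_inr, sum_adj_inr] at this⟩ r
      (Sum.inr_injective ((hg r).symm.trans hfix.2)) w
    rw [hg]
    exact congrArg _ this

/-- A tree reduces to a flip-free spanning subgraph whose components have equal sizes. -/
lemma IsTree.exists_reduction {V : Type u} [Finite V] {G : SimpleGraph V} (hG : G.IsTree) :
    ∃ R ≤ G, R.FlipFree ∧ ParityEq G R ∧
      (∃ i : ℕ, (∀ v, Nat.card {w // R.Reachable v w} * 2 ^ i = Nat.card V) ∧
        (i = 0 → R = G) ∧ (i ≠ 0 → ¬ G.FlipFree)) ∧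
      (R = ⊥ → ∀ φ : G ≃g G, ∀ v, φ v = v → ∀ w, φ w = w) := by
  induction hn : Nat.card V using Nat.strong_induction_on generalizing V with
  | _ n ih =>
    subst hn
    -- A flip-free tree is its own reduction. Otherwise the tree is a mirror of some `K`, and two
    -- copies of a reduction of `K` reduce it, one halving more.
    by_cases hf : G.FlipFree
    · refine ⟨G, le_rfl, hf, ParityEq.refl G, ⟨0, fun v => ?_, fun _ => rfl, fun h => (h rfl).elim⟩,
        fun h φ v _ w => ?_⟩
      · rw [pow_zero, mul_one]
        exact Nat.card_congr (Equiv.subtypeUnivEquiv fun w => hG.connected.preconnected v w)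
      · subst h
        have := hG.connected.preconnected (φ w) w
        rwa [reachable_bot] at this
    · obtain ⟨W, _, K, r, hK, ⟨e⟩⟩ := exists_mirror_iso hG hf
      have hcard : Nat.card V = Nat.card W * 2 := by
        rw [← Nat.card_congr e.toEquiv, Nat.card_sum]
        ring
      have hpos : 0 < Nat.card W := by
        have : Nonempty W := ⟨r⟩
        exact Nat.card_pos
      obtain ⟨R, hR, hRf, hKR, ⟨i, hi, -, -⟩, hrig⟩ := ih (Nat.card W) (by omega) hK rfl
      have he : ∀ a b, (K.mirror r).Adj (e.symm a) (e.symm b) ↔ G.Adj a b := fun a b =>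
        e.symm.map_adj_iff
      have hGe : G = (K.mirror r).comap e.toEquiv.symm := by
        ext a b
        exact (he a b).symm
      refine ⟨(R ⊕g R).comap e.toEquiv.symm, ?_, (hRf.sum hRf).iso (Iso.comap _ _).symm, ?_,
        ⟨i + 1, ?_, by simp, fun _ => hf⟩, ?_⟩
      · intro a b hab
        rw [← he]
        refine sum_le_mirror (r := r) ?_
        have hab' : (R ⊕g R).Adj (e.symm a) (e.symm b) := hab
        rcases ha : e.symm a with u | u <;> rcases hb : e.symm b with v | v <;>
          rw [ha, hb] at hab' <;> simp at hab' ⊢ <;> exact hR hab'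
      · have h1 := ((parityEq_mirror K r).trans (hKR.sum hKR)).comap e.toEquiv.symm
        rwa [← hGe] at h1
      · intro v
        have h1 : Nat.card {w // ((R ⊕g R).comap e.toEquiv.symm).Reachable v w} =
            Nat.card {w // (R ⊕g R).Reachable (e.symm v) w} :=
          Nat.card_congr (e.symm.toEquiv.subtypeEquiv fun w =>
            (Iso.reachable_iff (φ := Iso.comap e.toEquiv.symm (R ⊕g R))).symm)
        rw [h1, hcard, pow_succ, ← mul_assoc]
        congr 1
        rcases e.symm v with u | u
        · rw [card_reachable_inl, hi]
        · rw [card_reachable_inr, hi]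
      · intro h
        have hbot : R = ⊥ := by
          ext a b
          have h1 : ((R ⊕g R).comap e.toEquiv.symm).Adj (e (.inl a)) (e (.inl b)) ↔ R.Adj a b := by
            show (R ⊕g R).Adj (e.symm (e (.inl a))) (e.symm (e (.inl b))) ↔ _
            rw [e.symm_apply_apply, e.symm_apply_apply, sum_adj_inl]
          rw [← h1, h]
          simp
        intro φ v hv w
        have h2 := mirror_rigid hK.connected (hrig hbot) ((e.trans φ).trans e.symm)
          (v := e.symm v) (by simp [hv]) (e.symm w)
        simpa using h2

end FlipStructure

end SimpleGraph

namespace SimpleGraph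

/-! ### Reduction of a tree with a deleted edge -/

section ReductionDel

variable {V : Type u}

lemma card_reachable_comap {W : Type*} (e : V ≃ W) (R : SimpleGraph W) (v : V) :
    Nat.card {w // (R.comap e).Reachable v w} = Nat.card {w // R.Reachable (e v) w} :=
  Nat.card_congr (e.subtypeEquiv fun _ => (Iso.reachable_iff (φ := Iso.comap e R)).symm)

lemma mem_supp_iff_reachable {G : SimpleGraph V} {x v : V} :
    v ∈ (G.connectedComponentMk x).supp ↔ G.Reachable x v := by
  rw [ConnectedComponent.mem_supp_iff, ConnectedComponent.eq]
  exact ⟨fun h => h.symm, fun h => h.symm⟩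

lemma IsAcyclic.isTree_induce_supp {G : SimpleGraph V} (hG : G.IsAcyclic)
    (c : G.ConnectedComponent) : (G.induce c.supp).IsTree :=
  ⟨c.connected_toSimpleGraph, hG.induce _⟩

/-- A graph with two components is the sum of these. -/
lemma exists_iso_sum {G : SimpleGraph V} {x y : V} (hxy : ¬ G.Reachable x y)
    (h : ∀ v, G.Reachable x v ∨ G.Reachable y v) :
    ∃ e : G.induce (G.connectedComponentMk x).supp ⊕g
        G.induce (G.connectedComponentMk y).supp ≃g G,
      (∀ a, e (.inl a) = a.1) ∧ ∀ a, e (.inr a) = a.1 := by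
  let f : (G.connectedComponentMk x).supp ⊕ (G.connectedComponentMk y).supp → V :=
    Sum.elim (fun a => a.1) fun a => a.1
  have hx : ∀ a : (G.connectedComponentMk x).supp, G.Reachable x a := fun a =>
    mem_supp_iff_reachable.1 a.2
  have hy : ∀ a : (G.connectedComponentMk y).supp, G.Reachable y a := fun a =>
    mem_supp_iff_reachable.1 a.2
  have hf : Function.Bijective f := by
    constructor
    · rintro (a | a) (b | b) hab
      · exact congrArg _ (Subtype.ext hab)
      · exact absurd ((hx a).trans ((show a.1 = b.1 from hab) ▸ (hy b).symm)) hxy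
      · exact absurd ((hx b).trans ((show a.1 = b.1 from hab) ▸ (hy a).symm)) hxy
      · exact congrArg _ (Subtype.ext hab)
    · intro v
      rcases h v with h | h
      · exact ⟨.inl ⟨v, mem_supp_iff_reachable.2 h⟩, rfl⟩
      · exact ⟨.inr ⟨v, mem_supp_iff_reachable.2 h⟩, rfl⟩
  refine ⟨⟨Equiv.ofBijective f hf, ?_⟩, fun _ => rfl, fun _ => rfl⟩
  rintro (a | a) (b | b)
  · rfl
  · simp only [Equiv.ofBijective_apply, f, Sum.elim_inl, Sum.elim_inr]
    refine ⟨fun h' => absurd (((hx a).trans h'.reachable).trans (hy b).symm) hxy, fun h' => ?_⟩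
    simp at h'
  · simp only [Equiv.ofBijective_apply, f, Sum.elim_inl, Sum.elim_inr]
    refine ⟨fun h' => absurd (((hx b).trans h'.symm.reachable).trans (hy a).symm) hxy,
      fun h' => ?_⟩
    simp at h'
  · rfl

/-- The reduction of a tree with a deleted edge. -/
lemma IsTree.exists_reduction_del [Finite V] {T : SimpleGraph V} (hT : T.IsTree) {x y : V}
    (hxy : T.Adj x y) : ∃ R ≤ T.del x y, R.FlipFree ∧ ParityEq (T.del x y) R ∧ ∃ i j : ℕ,
      (∀ v, (T.del x y).Reachable x v → Nat.card {w // R.Reachable v w} * 2 ^ i =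
        Nat.card {w // (T.del x y).Reachable x w}) ∧
      (∀ v, (T.del x y).Reachable y v → Nat.card {w // R.Reachable v w} * 2 ^ j =
        Nat.card {w // (T.del x y).Reachable y w}) ∧
      (j = 0 → ∀ u w, (T.del x y).Reachable y u → (T.del x y).Adj u w → R.Adj u w) ∧
      (j ≠ 0 → ∃ φ : T.del x y ≃g T.del x y, ∃ a b, (T.del x y).Adj a b ∧
        (T.del x y).Reachable y a ∧ φ a = b ∧ φ b = a) := by
  have hnr := hT.isAcyclic.not_reachable_del hxy
  have hr : ∀ v, (T.del x y).Reachable x v ∨ (T.del x y).Reachable y v := fun v =>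
    reachable_del (hT.connected.preconnected x v)
  generalize hGdef : T.del x y = G at *
  have hG : G.IsAcyclic := hGdef ▸ hT.isAcyclic.del x y
  obtain ⟨e, hex, hey⟩ := exists_iso_sum hnr hr
  -- The two sides of the deleted edge are trees and are reduced independently.
  obtain ⟨A, hA, hAf, hAp, ⟨i, hi, -, -⟩, -⟩ :=
    (hG.isTree_induce_supp (G.connectedComponentMk x)).exists_reduction
  obtain ⟨B, hB, hBf, hBp, ⟨j, hj, hj0, hj1⟩, -⟩ :=
    (hG.isTree_induce_supp (G.connectedComponentMk y)).exists_reduction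
  have hGe : G = (G.induce (G.connectedComponentMk x).supp ⊕g
      G.induce (G.connectedComponentMk y).supp).comap e.toEquiv.symm := by
    ext a b
    exact e.symm.map_adj_iff.symm
  have hx : ∀ v (h : G.Reachable x v), e.toEquiv.symm v =
      .inl ⟨v, mem_supp_iff_reachable.2 h⟩ := fun v h => by
    rw [Equiv.symm_apply_eq]
    exact (hex ⟨v, mem_supp_iff_reachable.2 h⟩).symm
  have hy : ∀ v (h : G.Reachable y v), e.toEquiv.symm v =
      .inr ⟨v, mem_supp_iff_reachable.2 h⟩ := fun v h => by
    rw [Equiv.symm_apply_eq]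
    exact (hey ⟨v, mem_supp_iff_reachable.2 h⟩).symm
  have hsupp : ∀ z, Nat.card {w // G.Reachable z w} =
      Nat.card (G.connectedComponentMk z).supp := fun z =>
    Nat.card_congr (Equiv.subtypeEquivRight fun w => mem_supp_iff_reachable.symm)
  refine ⟨(A ⊕g B).comap e.toEquiv.symm, ?_, (hAf.sum hBf).iso (Iso.comap _ _).symm, ?_, i, j,
    ?_, ?_, ?_, ?_⟩
  · conv_rhs => rw [hGe]
    intro a b
    simp only [SimpleGraph.comap_adj]
    rcases e.toEquiv.symm a with u | u <;> rcases e.toEquiv.symm b with v | v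
    · exact fun h => sum_adj_inl.2 (hA (sum_adj_inl.1 h))
    · simp
    · simp
    · exact fun h => sum_adj_inr.2 (hB (sum_adj_inr.1 h))
  · have := (hAp.sum hBp).comap e.toEquiv.symm
    rwa [← hGe] at this
  · intro v hv
    rw [card_reachable_comap, hx v hv, card_reachable_inl, hi, hsupp]
  · intro v hv
    rw [card_reachable_comap, hy v hv, card_reachable_inr, hj, hsupp]
  · intro h0 u w hu huw
    rw [SimpleGraph.comap_adj, hy u hu, hy w (hu.trans huw.reachable), sum_adj_inr, hj0 h0]
    exact huw
  · intro h0
    have h1 := hj1 h0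
    unfold FlipFree at h1
    push Not at h1
    obtain ⟨φ, a, b, hab, h2, h3⟩ := h1
    refine ⟨(e.symm.trans (Iso.sumCongr Iso.refl φ)).trans e, a.1, b.1, hab,
      mem_supp_iff_reachable.1 a.2, ?_, ?_⟩
    · have := hy a.1 (mem_supp_iff_reachable.1 a.2)
      show e ((Iso.sumCongr Iso.refl φ) (e.toEquiv.symm a.1)) = b.1
      rw [this, ← h2]
      exact hey (φ a)
    · have := hy b.1 (mem_supp_iff_reachable.1 b.2)
      show e ((Iso.sumCongr Iso.refl φ) (e.toEquiv.symm b.1)) = a.1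
      rw [this, ← h3]
      exact hey (φ b)

end ReductionDel

end SimpleGraph

namespace SimpleGraph

/-! ### Rooted isomorphisms, branches and rigidity -/

section RootedIso

variable {V : Type*}

/-- A permutation restricts to an isomorphism from the component of `p` in `G` onto the component
of `p'` in `G'`. -/
def IsRootedIso (G : SimpleGraph V) (p : V) (G' : SimpleGraph V) (p' : V)
    (φ : Equiv.Perm V) : Prop :=
  φ p = p' ∧ ∀ u w, G.Reachable p u → (G.Adj u w ↔ G'.Adj (φ u) (φ w))

/-- The component of `p` in `G` and the component of `p'` in `G'` are isomorphic as rooted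
graphs. -/
def RootedIso (G : SimpleGraph V) (p : V) (G' : SimpleGraph V) (p' : V) : Prop :=
  ∃ φ : Equiv.Perm V, IsRootedIso G p G' p' φ

variable {G G' G'' : SimpleGraph V} {p p' p'' : V} {φ ψ : Equiv.Perm V}

lemma IsRootedIso.reachable (h : IsRootedIso G p G' p' φ) {u : V} (hu : G.Reachable p u) :
    G'.Reachable p' (φ u) := by
  refine hu.induction (P := fun u => G'.Reachable p' (φ u)) (by rw [h.1]) ?_
  intro u w hu ih huw
  exact ih.trans ((h.2 u w hu).1 huw).reachable

lemma IsRootedIso.symm (h : IsRootedIso G p G' p' φ) : IsRootedIso G' p' G p φ⁻¹ := by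
  have h1 : φ⁻¹ p' = p := by rw [← h.1]; exact φ.symm_apply_apply p
  have h2 : ∀ u, G'.Reachable p' u → G.Reachable p (φ⁻¹ u) := by
    intro u hu
    refine hu.induction (P := fun u => G.Reachable p (φ⁻¹ u)) (by rw [h1]) ?_
    intro u w hu ih huw
    refine ih.trans (((h.2 _ (φ⁻¹ w) ih).2 ?_)).reachable
    simpa using huw
  refine ⟨h1, fun u w hu => ?_⟩
  rw [h.2 _ _ (h2 u hu)]
  simp

lemma IsRootedIso.trans (h : IsRootedIso G p G' p' φ) (h' : IsRootedIso G' p' G'' p'' ψ) :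
    IsRootedIso G p G'' p'' (ψ * φ) := by
  refine ⟨by rw [Equiv.Perm.mul_apply, h.1, h'.1], fun u w hu => ?_⟩
  rw [h.2 u w hu, h'.2 _ _ (h.reachable hu)]
  rfl

/-- The root may be moved inside its component. -/
lemma IsRootedIso.root (h : IsRootedIso G p G' p' φ) {y : V} (hy : G.Reachable p y) :
    IsRootedIso G y G' (φ y) φ :=
  ⟨rfl, fun u w hu => h.2 u w (hy.trans hu)⟩

lemma RootedIso.symm (h : RootedIso G p G' p') : RootedIso G' p' G p :=
  let ⟨_, h⟩ := h
  ⟨_, h.symm⟩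

lemma RootedIso.trans (h : RootedIso G p G' p') (h' : RootedIso G' p' G'' p'') :
    RootedIso G p G'' p'' :=
  let ⟨_, h⟩ := h
  let ⟨_, h'⟩ := h'
  ⟨_, h.trans h'⟩

lemma RootedIso.of_adj_iff (h : ∀ u w, G.Reachable p u → (G.Adj u w ↔ G'.Adj u w)) :
    RootedIso G p G' p := ⟨1, rfl, h⟩

lemma IsRootedIso.of_iso (e : G ≃g G') (p : V) : IsRootedIso G p G' (e p) e.toEquiv :=
  ⟨rfl, fun _ _ _ => e.map_adj_iff.symm⟩

/-- The number of vertices in the component of `p`. -/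
noncomputable def compCard (G : SimpleGraph V) (p : V) : ℕ := {w | G.Reachable p w}.ncard

lemma compCard_eq_natCard (G : SimpleGraph V) (p : V) :
    G.compCard p = Nat.card {w // G.Reachable p w} := rfl

lemma compCard_le [Finite V] (h : ∀ w, G.Reachable p w → G'.Reachable p' w) :
    G.compCard p ≤ G'.compCard p' :=
  Set.ncard_le_ncard (fun w hw => h w hw) (Set.toFinite _)

lemma compCard_lt [Finite V] (h : ∀ w, G.Reachable p w → G'.Reachable p' w) {z : V}
    (hz : G'.Reachable p' z) (hz' : ¬ G.Reachable p z) : G.compCard p < G'.compCard p' :=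
  Set.ncard_lt_ncard ⟨fun w hw => h w hw, fun h' => hz' (h' hz)⟩ (Set.toFinite _)

lemma compCard_congr (h : ∀ w, G.Reachable p w ↔ G'.Reachable p' w) :
    G.compCard p = G'.compCard p' := by
  unfold compCard
  congr 1
  ext w
  exact h w

lemma compCard_reachable (h : G.Reachable p p') : G.compCard p = G.compCard p' :=
  compCard_congr fun _ => ⟨fun h' => h.symm.trans h', fun h' => h.trans h'⟩

lemma IsRootedIso.compCard_eq (h : IsRootedIso G p G' p' φ) : G.compCard p = G'.compCard p' := by
  unfold compCard
  rw [← Set.ncard_image_of_injective _ φ.injective]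
  congr 1
  ext w
  constructor
  · rintro ⟨u, hu, rfl⟩
    exact h.reachable hu
  · intro hw
    refine ⟨φ⁻¹ w, h.symm.reachable hw, by simp⟩

lemma RootedIso.compCard_eq (h : RootedIso G p G' p') : G.compCard p = G'.compCard p' :=
  let ⟨_, h⟩ := h
  h.compCard_eq

/-- The graph with all edges at `p` deleted. -/
def cut (G : SimpleGraph V) (p : V) : SimpleGraph V where
  Adj a b := G.Adj a b ∧ a ≠ p ∧ b ≠ p
  symm := ⟨fun _ _ h => ⟨h.1.symm, h.2.2, h.2.1⟩⟩
  loopless := ⟨fun _ h => G.irrefl h.1⟩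

lemma cut_adj {a b : V} : (G.cut p).Adj a b ↔ G.Adj a b ∧ a ≠ p ∧ b ≠ p := Iff.rfl

lemma cut_le : G.cut p ≤ G := fun _ _ h => h.1

lemma cut_le_del (y : V) : G.cut p ≤ G.del p y := fun _ _ h =>
  del_adj.2 ⟨h.1, fun h' => h'.elim (fun h' => h.2.1 h'.1) fun h' => h.2.2 h'.2⟩

lemma cut_del (a b : V) : (G.del a b).cut p = (G.cut p).del a b := by
  ext u w
  simp only [cut_adj, del_adj]
  tauto

lemma ne_of_cut_reachable {y u : V} (hy : y ≠ p) (h : (G.cut p).Reachable y u) : u ≠ p :=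
  h.induction (P := fun u => u ≠ p) hy fun _ _ _ _ h => h.2.2

lemma IsRootedIso.cut (h : IsRootedIso G p G' p' φ) {x y : V} (hx : G.Reachable p x)
    (hy : G.Adj x y) : IsRootedIso (G.cut x) y (G'.cut (φ x)) (φ y) φ := by
  refine ⟨rfl, fun u w hu => ?_⟩
  rw [cut_adj, cut_adj, h.2 u w ((hx.trans hy.reachable).trans (hu.mono cut_le)),
    φ.injective.ne_iff, φ.injective.ne_iff]

lemma IsRootedIso.del (h : IsRootedIso G p G' p' φ) {x y z : V} (hz : G.Reachable p z) :
    IsRootedIso (G.del x y) z (G'.del (φ x) (φ y)) (φ z) φ := by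
  refine ⟨rfl, fun u w hu => ?_⟩
  rw [del_adj, del_adj, h.2 u w (hz.trans (hu.mono (del_le x y)))]
  simp only [φ.injective.eq_iff]

/-- A vertex of the component of `p` lies in a branch at `p`. -/
lemma exists_cut_reachable {u : V} (h : G.Reachable p u) (hu : u ≠ p) :
    ∃ y, G.Adj p y ∧ (G.cut p).Reachable y u := by
  refine (h.induction (P := fun u => u = p ∨ ∃ y, G.Adj p y ∧ (G.cut p).Reachable y u)
    (Or.inl rfl) ?_).resolve_left hu
  intro a b _ ih hab
  by_cases hb : b = p
  · exact Or.inl hb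
  by_cases ha : a = p
  · exact Or.inr ⟨b, ha ▸ hab, .rfl⟩
  · obtain ⟨y, hy, hya⟩ := ih.resolve_left ha
    exact Or.inr ⟨y, hy, hya.trans (Adj.reachable ⟨hab, ha, hb⟩)⟩

/-- Distinct branches at a vertex of a forest are disjoint. -/
lemma IsAcyclic.eq_of_cut_reachable (hG : G.IsAcyclic) {y y' : V} (hy : G.Adj p y)
    (hy' : G.Adj p y') (h : (G.cut p).Reachable y y') : y = y' := by
  by_contra hne
  refine hG.not_reachable_del hy ?_
  have h1 : (G.del p y).Adj p y' := by
    refine del_adj.2 ⟨hy', ?_⟩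
    rintro (⟨-, h⟩ | ⟨h, -⟩)
    · exact hne h.symm
    · exact hy.ne h
  exact h1.reachable.trans (h.mono (cut_le_del y)).symm

/-- The side of `y` with respect to an edge `yp` of a forest avoids `p`. -/
lemma IsAcyclic.cut_reachable_of_del (hG : G.IsAcyclic) {y u : V} (hy : G.Adj p y)
    (h : (G.del p y).Reachable y u) : (G.cut p).Reachable y u := by
  refine h.induction (P := fun u => (G.cut p).Reachable y u) .rfl fun a b ha ih hab => ?_
  refine ih.trans (Adj.reachable ⟨del_le _ _ hab, ?_, ?_⟩)
  · rintro rfl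
    exact hG.not_reachable_del hy ha.symm
  · rintro rfl
    exact hG.not_reachable_del hy (ha.trans hab.reachable).symm

/-- Automorphisms fixing `p` are trivial on the component of `p`. -/
def RigidAt (G : SimpleGraph V) (p : V) : Prop :=
  ∀ φ : G ≃g G, φ p = p → ∀ u, G.Reachable p u → φ u = u

/-- An automorphism of the graph without the edges at `p` that respects the neighbours of `p`. -/
def isoOfCut (g : G.cut p ≃g G.cut p) (hp : g p = p) (h : ∀ u, G.Adj p (g u) ↔ G.Adj p u) :
    G ≃g G where
  toEquiv := g.toEquiv
  map_rel_iff' := by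
    intro a b
    show G.Adj (g a) (g b) ↔ G.Adj a b
    by_cases ha : a = p
    · subst ha
      rw [hp]
      exact h b
    by_cases hb : b = p
    · subst hb
      rw [hp, G.adj_comm, G.adj_comm a]
      exact h a
    have h1 := g.map_adj_iff (v := a) (w := b)
    rw [cut_adj, cut_adj] at h1
    have h2 : ∀ c, c ≠ p → g c ≠ p := fun c hc h' => hc (g.injective (h'.trans hp.symm))
    have h3 := h2 a ha
    have h4 := h2 b hb
    tauto

/-- An automorphism of a branch fixing its root `y` extends by the identity to the whole forest: `y`
is the only neighbour of `p` in its branch, so the edges at `p` are respected. -/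
lemma RigidAt.cut [Finite V] (hG : G.IsAcyclic) (h : G.RigidAt p) {y : V} (hy : G.Adj p y) :
    (G.cut p).RigidAt y := by
  intro φ hφ u hu
  obtain ⟨g, hg1, hg2⟩ := exists_iso_of_local (G := G.cut p) (x := y) φ (by rw [hφ])
    (fun _ _ _ _ h => φ.injective h) fun _ _ _ _ => φ.map_adj_iff.symm
  have hp : g p = p := hg2 p fun h' => ne_of_cut_reachable hy.ne' h' rfl
  have := h (isoOfCut g hp fun w => ?_) hp u (hy.reachable.trans (hu.mono cut_le))
  · rw [← hg1 u hu]
    exact this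
  · by_cases hw : (G.cut p).Reachable y w
    · have h1 : (G.cut p).Reachable y (g w) := by
        have := (Iso.reachable_iff (φ := g)).2 hw
        rwa [hg1 y .rfl, hφ] at this
      have h2 : g y = y := by rw [hg1 y .rfl, hφ]
      constructor
      · intro h3
        have h4 := hG.eq_of_cut_reachable hy h3 h1
        rw [← h2] at h4
        rw [← g.injective h4]
        exact hy
      · intro h3
        rw [← hG.eq_of_cut_reachable hy h3 hw, h2]
        exact hy
    · rw [hg2 w hw]

/-- Two isomorphic components may be exchanged. -/
lemma RootedIso.exists_swap {y1 y2 : V} (h : RootedIso G y1 G y2)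
    (hne : ¬ G.Reachable y1 y2) :
    ∃ g : G ≃g G, g y1 = y2 ∧ g y2 = y1 ∧
      ∀ u, ¬ G.Reachable y1 u → ¬ G.Reachable y2 u → g u = u := by
  classical
  obtain ⟨φ, hφ⟩ := h
  have hdisj : ∀ u, G.Reachable y1 u → ¬ G.Reachable y2 u := fun u h1 h2 => hne (h1.trans h2.symm)
  let f : V → V := fun u => if G.Reachable y1 u then φ u else
    if G.Reachable y2 u then φ⁻¹ u else u
  have f1 : ∀ u, G.Reachable y1 u → f u = φ u := fun u hu => if_pos hu
  have f2 : ∀ u, G.Reachable y2 u → f u = φ⁻¹ u := fun u hu => by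
    simp only [f]
    rw [if_neg fun h => hdisj u h hu, if_pos hu]
  have f3 : ∀ u, ¬ G.Reachable y1 u → ¬ G.Reachable y2 u → f u = u := fun u hu hu' => by
    simp only [f]
    rw [if_neg hu, if_neg hu']
  have hff : Function.Involutive f := by
    intro u
    by_cases h1 : G.Reachable y1 u
    · rw [f1 u h1, f2 _ (hφ.reachable h1)]
      exact φ.symm_apply_apply u
    by_cases h2 : G.Reachable y2 u
    · rw [f2 u h2, f1 _ (hφ.symm.reachable h2)]
      exact φ.apply_symm_apply u
    · rw [f3 u h1 h2, f3 u h1 h2]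
  have hadj : ∀ u w, G.Adj u w → G.Adj (f u) (f w) := by
    intro u w huw
    by_cases h1 : G.Reachable y1 u
    · rw [f1 u h1, f1 w (h1.trans huw.reachable)]
      exact (hφ.2 u w h1).1 huw
    by_cases h2 : G.Reachable y2 u
    · rw [f2 u h2, f2 w (h2.trans huw.reachable)]
      exact (hφ.symm.2 u w h2).1 huw
    · rw [f3 u h1 h2, f3 w (fun h => h1 (h.trans huw.symm.reachable))
        fun h => h2 (h.trans huw.symm.reachable)]
      exact huw
  refine ⟨⟨hff.toPerm, fun {u w} => ⟨fun h => ?_, hadj u w⟩⟩, ?_, ?_, f3⟩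
  · have := hadj _ _ h
    simpa [hff u, hff w] using this
  · exact (f1 _ .rfl).trans hφ.1
  · exact (f2 _ .rfl).trans hφ.symm.1

/-- Branches at a rigid root of a forest are pairwise not isomorphic. -/
lemma RigidAt.eq_of_rootedIso (hG : G.IsAcyclic) (h : G.RigidAt p) {y1 y2 : V}
    (h1 : G.Adj p y1) (h2 : G.Adj p y2) (hiso : RootedIso (G.cut p) y1 (G.cut p) y2) :
    y1 = y2 := by
  by_contra hne
  have hnr : ¬ (G.cut p).Reachable y1 y2 := fun h' => hne (hG.eq_of_cut_reachable h1 h2 h')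
  -- Exchanging the two branches gives a nontrivial automorphism that fixes `p`.
  obtain ⟨g, hg1, hg2, hg3⟩ := hiso.exists_swap hnr
  have hp : g p = p := hg3 p (fun h' => ne_of_cut_reachable h1.ne' h' rfl)
    fun h' => ne_of_cut_reachable h2.ne' h' rfl
  have hgg : ∀ u, G.Adj p u → G.Adj p (g u) := by
    intro u hu
    by_cases hu1 : (G.cut p).Reachable y1 u
    · rw [← hG.eq_of_cut_reachable h1 hu hu1, hg1]
      exact h2
    by_cases hu2 : (G.cut p).Reachable y2 u
    · rw [← hG.eq_of_cut_reachable h2 hu hu2, hg2]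
      exact h1
    · rwa [hg3 u hu1 hu2]
  have hgg' : ∀ u, G.Adj p (g u) → G.Adj p u := by
    intro u hu
    by_cases hu1 : (G.cut p).Reachable y1 (g u)
    · have h3 := hG.eq_of_cut_reachable h1 hu hu1
      rw [← hg2] at h3
      rw [← g.injective h3]
      exact h2
    by_cases hu2 : (G.cut p).Reachable y2 (g u)
    · have h3 := hG.eq_of_cut_reachable h2 hu hu2
      rw [← hg1] at h3
      rw [← g.injective h3]
      exact h1
    · have := hg3 (g u) hu1 hu2
      rwa [g.injective this] at hu
  have h4 : g y1 = y1 := h (isoOfCut g hp fun u => ⟨hgg' u, hgg u⟩) hp y1 h1.reachable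
  exact hne (h4.symm.trans hg1)

end RootedIso

end SimpleGraph

namespace SimpleGraph

/-! ### Recovery of an edge from a rooted deletion -/

section Pseudosimilar

variable {V : Type*} {G G' G'' : SimpleGraph V} {p p' : V}

/-- A rooted isomorphism carries branches to branches. The number of branches of a given rooted type
is the invariant by which deletions of edges are told apart. -/
lemma RootedIso.card_eq [Fintype V] (h : RootedIso G p G' p') (Q : SimpleGraph V → V → Prop)
    (hQ : ∀ H y H' y', RootedIso H y H' y' → (Q H y ↔ Q H' y'))
    [DecidablePred fun y => G.Adj p y ∧ Q (G.cut p) y]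
    [DecidablePred fun y => G'.Adj p' y ∧ Q (G'.cut p') y] :
    (Finset.univ.filter fun y => G.Adj p y ∧ Q (G.cut p) y).card =
      (Finset.univ.filter fun y => G'.Adj p' y ∧ Q (G'.cut p') y).card := by
  obtain ⟨φ, hφ⟩ := h
  refine Finset.card_equiv φ fun y => ?_
  rw [Finset.mem_filter, Finset.mem_filter, ← hφ.1, ← hφ.2 p y .rfl]
  simp only [Finset.mem_univ, true_and]
  refine and_congr_right fun hy => hQ _ _ _ _ ⟨φ, hφ.cut .rfl hy⟩

/-- `y` is the neighbour of `p` such that the edge `ab` lies in the branch of `y`. -/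
def IsBranchOf (G : SimpleGraph V) (p a b y : V) : Prop :=
  G.Adj p y ∧ (s(a, b) = s(p, y) ∨ ((G.cut p).Adj a b ∧ (G.cut p).Reachable y a))

lemma exists_isBranchOf {a b : V} (hab : G.Adj a b) (ha : G.Reachable p a) :
    ∃ y, G.IsBranchOf p a b y := by
  by_cases h1 : a = p
  · subst h1
    exact ⟨b, hab, Or.inl rfl⟩
  by_cases h2 : b = p
  · subst h2
    exact ⟨a, hab.symm, Or.inl Sym2.eq_swap⟩
  · obtain ⟨y, hy, hya⟩ := exists_cut_reachable ha h1
    exact ⟨y, hy, Or.inr ⟨⟨hab, h1, h2⟩, hya⟩⟩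

/-- Deleting an edge does not change the branches that do not contain it. -/
lemma IsBranchOf.rootedIso (hG : G.IsAcyclic) {a b y y' : V} (h : G.IsBranchOf p a b y)
    (hy' : G.Adj p y') (hne : y' ≠ y) :
    RootedIso ((G.del a b).cut p) y' (G.cut p) y' := by
  rw [cut_del]
  refine RootedIso.of_adj_iff fun u w hu => ?_
  have hu' := hu.mono (del_le a b)
  rw [del_adj]
  refine ⟨fun h => h.1, fun huw => ⟨huw, fun h' => ?_⟩⟩
  rcases h.2 with h2 | ⟨h2, h3⟩
  · have hu1 := ne_of_cut_reachable hy'.ne' hu'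
    have hw1 := ne_of_cut_reachable hy'.ne' (hu'.trans huw.reachable)
    rw [Sym2.eq_iff] at h2
    rcases h' with ⟨rfl, rfl⟩ | ⟨rfl, rfl⟩ <;> rcases h2 with ⟨h4, h5⟩ | ⟨h4, h5⟩
    · exact hu1 h4
    · exact hw1 h5
    · exact hw1 h4
    · exact hu1 h5
  · refine hne (hG.eq_of_cut_reachable hy' h.1 (hu'.trans ?_))
    rcases h' with ⟨rfl, rfl⟩ | ⟨rfl, rfl⟩
    · exact h3.symm
    · exact h2.symm.reachable.trans h3.symm

lemma IsBranchOf.del_adj_iff {a b y y' : V} (h : G.IsBranchOf p a b y) (hne : y' ≠ y) :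
    (G.del a b).Adj p y' ↔ G.Adj p y' := by
  rw [del_adj]
  refine ⟨fun h => h.1, fun h' => ⟨h', fun h1 => ?_⟩⟩
  rcases h.2 with h2 | ⟨h2, -⟩
  · rw [Sym2.eq_iff] at h2
    rcases h1 with ⟨rfl, rfl⟩ | ⟨rfl, rfl⟩ <;> rcases h2 with ⟨h4, h5⟩ | ⟨h4, h5⟩
    · exact hne h5
    · exact h'.ne h5.symm
    · exact h'.ne h4.symm
    · exact hne h4
  · rcases h1 with ⟨rfl, rfl⟩ | ⟨rfl, rfl⟩
    · exact h2.2.1 rfl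
    · exact h2.2.2 rfl

/-- A branch from which an edge was deleted is smaller. -/
lemma IsBranchOf.not_rootedIso [Finite V] (hG : G.IsAcyclic) {a b y : V}
    (h : G.IsBranchOf p a b y) :
    ¬ ((G.del a b).Adj p y ∧ RootedIso ((G.del a b).cut p) y (G.cut p) y) := by
  rintro ⟨h1, h2⟩
  rcases h.2 with h3 | ⟨h3, h4⟩
  · rw [del_adj, ← Sym2.eq_iff] at h1
    exact h1.2 h3.symm
  · have h5 := h2.compCard_eq
    rw [cut_del] at h5
    have hcut : (G.cut p).IsAcyclic := hG.anti cut_le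
    have hnr := hcut.not_reachable_del h3
    by_cases h6 : ((G.cut p).del a b).Reachable y a
    · exact (compCard_lt (fun w hw => hw.mono (del_le a b)) (h4.trans h3.reachable)
        fun h7 => hnr (h6.symm.trans h7)).ne h5
    · exact (compCard_lt (fun w hw => hw.mono (del_le a b)) h4 h6).ne h5

/-- In a forest that is rigid at `p`, the edges of the component of `p` are determined by the
rooted isomorphism types of the components of `p` after their deletion. -/
theorem RigidAt.eq_of_rootedIso_del [Finite V] (hG : G.IsAcyclic) (hr : G.RigidAt p)
    {a b c d : V} (hab : G.Adj a b) (ha : G.Reachable p a) (hcd : G.Adj c d)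
    (hc : G.Reachable p c) (h : RootedIso (G.del a b) p (G.del c d) p) : s(a, b) = s(c, d) := by
  classical
  have := Fintype.ofFinite V
  induction hn : G.compCard p using Nat.strong_induction_on generalizing G p with
  | _ n ih =>
    subst hn
    obtain ⟨y1, hy1⟩ := exists_isBranchOf hab ha
    obtain ⟨y2, hy2⟩ := exists_isBranchOf hcd hc
    have hQ : ∀ (K : SimpleGraph V) (z : V), ∀ H y H' y', RootedIso H y H' y' →
        (RootedIso H y K z ↔ RootedIso H' y' K z) := fun K z H y H' y' h =>
      ⟨fun h1 => h.symm.trans h1, fun h1 => h.trans h1⟩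
    -- Either both edges belong to one branch at `p`, where the degree of `p` or the induction
    -- inside the branch decides, or they damage different branches.
    by_cases hne : y1 = y2
    · subst hne
      by_cases h1 : s(a, b) = s(p, y1) <;> by_cases h2 : s(c, d) = s(p, y1)
      · rw [h1, h2]
      · exfalso
        have hcard := h.card_eq (fun _ _ => True) fun _ _ _ _ _ => Iff.rfl
        refine (Finset.card_lt_card ?_).ne hcard
        rw [Finset.ssubset_iff_of_subset]
        · refine ⟨y1, ?_, ?_⟩
          · rw [Finset.mem_filter, del_adj, ← Sym2.eq_iff]
            exact ⟨Finset.mem_univ _, ⟨hy1.1, Ne.symm h2⟩, trivial⟩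
          · rw [Finset.mem_filter, del_adj, ← Sym2.eq_iff]
            exact fun h => h.2.1.2 h1.symm
        · intro z hz
          rw [Finset.mem_filter, del_adj, ← Sym2.eq_iff] at hz ⊢
          refine ⟨hz.1, ⟨hz.2.1.1, fun h3 => ?_⟩, trivial⟩
          by_cases hzy : z = y1
          · rw [hzy] at h3
            exact h2 h3.symm
          · have h4 := (hy2.del_adj_iff hzy).2 hz.2.1.1
            rw [del_adj, ← Sym2.eq_iff] at h4
            exact h4.2 h3
      · exfalso
        have hcard := h.card_eq (fun _ _ => True) fun _ _ _ _ _ => Iff.rfl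
        refine (Finset.card_lt_card ?_).ne hcard.symm
        rw [Finset.ssubset_iff_of_subset]
        · refine ⟨y1, ?_, ?_⟩
          · rw [Finset.mem_filter, del_adj, ← Sym2.eq_iff]
            exact ⟨Finset.mem_univ _, ⟨hy1.1, Ne.symm h1⟩, trivial⟩
          · rw [Finset.mem_filter, del_adj, ← Sym2.eq_iff]
            exact fun h => h.2.1.2 h2.symm
        · intro z hz
          rw [Finset.mem_filter, del_adj, ← Sym2.eq_iff] at hz ⊢
          refine ⟨hz.1, ⟨hz.2.1.1, fun h3 => ?_⟩, trivial⟩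
          by_cases hzy : z = y1
          · rw [hzy] at h3
            exact h1 h3.symm
          · have h4 := (hy1.del_adj_iff hzy).2 hz.2.1.1
            rw [del_adj, ← Sym2.eq_iff] at h4
            exact h4.2 h3
      · obtain ⟨h3, h4⟩ := hy1.2.resolve_left h1
        obtain ⟨h5, h6⟩ := hy2.2.resolve_left h2
        have hadj1 : (G.del a b).Adj p y1 := by
          rw [del_adj, ← Sym2.eq_iff]
          exact ⟨hy1.1, Ne.symm h1⟩
        have hcard := h.card_eq (fun H y => RootedIso H y ((G.del a b).cut p) y1)
          (hQ ((G.del a b).cut p) y1)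
        -- All other branches are intact in both deletions. Equal numbers of branches of the type of
        -- the damaged one force the two damaged branches to be isomorphic.
        have hiso : RootedIso ((G.del c d).cut p) y1 ((G.del a b).cut p) y1 := by
          by_contra hno
          refine (Finset.card_lt_card ?_).ne hcard.symm
          rw [Finset.ssubset_iff_of_subset]
          · refine ⟨y1, ?_, ?_⟩
            · rw [Finset.mem_filter]
              exact ⟨Finset.mem_univ _, hadj1, RootedIso.of_adj_iff fun _ _ _ => Iff.rfl⟩
            · rw [Finset.mem_filter]
              exact fun h => hno h.2.2
          · intro z hz
            rw [Finset.mem_filter] at hz ⊢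
            have hzy : z ≠ y1 := by
              rintro rfl
              exact hno hz.2.2
            have hz' := (hy2.del_adj_iff hzy).1 hz.2.1
            exact ⟨hz.1, (hy1.del_adj_iff hzy).2 hz', ((hy1.rootedIso hG hz' hzy).trans
              (hy2.rootedIso hG hz' hzy).symm).trans hz.2.2⟩
        rw [cut_del, cut_del] at hiso
        refine ih _ ?_ (hG.anti cut_le) (hr.cut hG hy1.1) h3 h4 h5 h6 hiso.symm rfl
        exact compCard_lt (fun w hw => hy1.1.reachable.trans (hw.mono cut_le)) .rfl
          fun h' => ne_of_cut_reachable hy1.1.ne' h' rfl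
    · exfalso
      -- By rigidity only `y2` has a branch of its type in `G`. This branch survives the deletion of
      -- `ab`, but after that of `cd` no branch of this type is left other than one that `ab` spares
      -- too, so the counts differ.
      have hcard := h.card_eq (fun H y => RootedIso H y (G.cut p) y2) (hQ (G.cut p) y2)
      have hy21 := Ne.symm hne
      refine (Finset.card_lt_card ?_).ne hcard.symm
      rw [Finset.ssubset_iff_of_subset]
      · refine ⟨y2, ?_, ?_⟩
        · rw [Finset.mem_filter]
          exact ⟨Finset.mem_univ _, (hy1.del_adj_iff hy21).2 hy2.1, hy1.rootedIso hG hy2.1 hy21⟩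
        · rw [Finset.mem_filter]
          exact fun h' => hy2.not_rootedIso hG h'.2
      · intro z hz
        rw [Finset.mem_filter] at hz ⊢
        have hz2 : z ≠ y2 := by
          rintro rfl
          exact hy2.not_rootedIso hG hz.2
        have hz' := (hy2.del_adj_iff hz2).1 hz.2.1
        have hz3 := (hy2.rootedIso hG hz' hz2).symm.trans hz.2.2
        have hz1 : z ≠ y1 := by
          rintro rfl
          exact hne (hr.eq_of_rootedIso hG hz' hy2.1 hz3)
        exact ⟨hz.1, (hy1.del_adj_iff hz1).2 hz', (hy1.rootedIso hG hz' hz1).trans hz3⟩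

end Pseudosimilar

end SimpleGraph

namespace SimpleGraph

/-! ### Centroids and recovery of a far edge without a root -/

section Centroid

variable {V : Type*} {G G' T : SimpleGraph V} {p p' q : V} {φ : Equiv.Perm V}

/-- No branch at `y` has more than half of the vertices of the component of `y`. -/
def IsCentroid (G : SimpleGraph V) (y : V) : Prop :=
  ∀ z, G.Adj y z → 2 * (G.del y z).compCard z ≤ G.compCard y

lemma IsRootedIso.isCentroid (h : IsRootedIso G p G' p' φ) {y : V} (hy : G.Reachable p y)
    (hc : G.IsCentroid y) : G'.IsCentroid (φ y) := by
  intro z' hz'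
  obtain ⟨z, rfl⟩ := φ.surjective z'
  have hz : G.Adj y z := (h.2 y z hy).2 hz'
  rw [← (h.root hy).compCard_eq,
    ← (h.del (x := y) (y := z) (hy.trans hz.reachable)).compCard_eq]
  exact hc z hz

lemma IsAcyclic.compCard_del_add [Finite V] (hG : G.IsAcyclic) {y z : V} (h : G.Adj y z) :
    (G.del y z).compCard y + (G.del y z).compCard z = G.compCard y := by
  unfold compCard
  rw [← Set.ncard_union_eq _ (Set.toFinite _) (Set.toFinite _)]
  · congr 1
    ext w
    refine ⟨?_, fun hw => reachable_del hw⟩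
    rintro (hw | hw)
    · exact Reachable.mono (del_le y z) hw
    · exact h.reachable.trans (Reachable.mono (del_le y z) hw)
  · rw [Set.disjoint_left]
    intro w hw hw'
    exact hG.not_reachable_del h (Reachable.trans hw (Reachable.symm hw'))

/-- Two centroids of a component of a forest are the ends of an edge that halves it. -/
lemma IsCentroid.adj [Finite V] (hG : G.IsAcyclic) {y v : V} (hy : G.IsCentroid y)
    (hv : G.IsCentroid v) (hyv : G.Reachable y v) (hne : v ≠ y) :
    G.Adj y v ∧ 2 * (G.del y v).compCard v = G.compCard y := by
  obtain ⟨z, hz, hzv⟩ := exists_cut_reachable hyv hne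
  obtain ⟨z', hz', hzy⟩ := exists_cut_reachable hyv.symm hne.symm
  have hnr := hG.not_reachable_del hz
  have h1 : ∀ u, (G.del y z).Reachable y u → (G.cut v).Reachable y u := by
    intro u hu
    refine hu.induction (P := fun u => (G.cut v).Reachable y u) .rfl fun a b ha ih hab => ?_
    have hv : ∀ c, (G.del y z).Reachable y c → c ≠ v := by
      rintro c hc rfl
      exact hnr (hc.trans (hzv.mono (cut_le_del z)).symm)
    exact ih.trans (Adj.reachable ⟨del_le _ _ hab, hv a ha, hv b (ha.trans hab.reachable)⟩)
  -- The side of `y` at `yz` has at least half of the vertices, and the branch at `v` containing it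
  -- has at most half. So they have equal size, which fails if `z` lies strictly between `y` and
  -- `v`.
  have h2 : ∀ u, (G.del y z).Reachable y u → (G.del v z').Reachable z' u := fun u hu =>
    (hzy.trans (h1 u hu)).mono (cut_le_del z')
  have h3 := hG.compCard_del_add hz
  have h4 := hy z hz
  have h5 := hv z' hz'
  rw [← compCard_reachable hyv] at h5
  by_cases hzv' : z = v
  · subst hzv'
    have h6 := compCard_le h2
    exact ⟨hz, by omega⟩
  · exfalso
    have h6 := compCard_lt h2 (z := z)
      ((hzy.trans (Adj.reachable ⟨hz, hne.symm, hzv'⟩)).mono (cut_le_del z')) hnr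
    omega

lemma IsAcyclic.reachable_del_of_reachable_del (hG : G.IsAcyclic) {x y z u : V}
    (hyz : G.Adj y z) (hzx : z ≠ x) (h : (G.del y z).Reachable z u) :
    (G.del x y).Reachable y u := by
  rw [del_comm x y]
  have h1 := (hG.cut_reachable_of_del hyz h).mono (cut_le_del x)
  have h2 : (G.del y x).Adj y z := del_adj.2 ⟨hyz, by
    rintro (⟨-, h⟩ | ⟨-, h⟩)
    · exact hzx h
    · exact hyz.ne h.symm⟩
  exact h2.reachable.trans h1

/-- A dart `x → y` such that more than `N / 2` vertices lie on the side of `y` can be moved to one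
that is extremal with this property. -/
lemma IsAcyclic.exists_extremal_dart [Finite V] (hT : T.IsAcyclic) (N : ℕ) {q p : V}
    (hqp : T.Adj q p) (hN : N < 2 * (T.del q p).compCard p) :
    ∃ x y, T.Adj x y ∧ (∀ u, (T.del x y).Reachable y u → (T.del q p).Reachable p u) ∧
      N < 2 * (T.del x y).compCard y ∧ ∀ z, T.Adj y z → z ≠ x →
        2 * (T.del y z).compCard z ≤ N := by
  induction hn : (T.del q p).compCard p using Nat.strong_induction_on generalizing q p with
  | _ n ih =>
    by_cases h : ∀ z, T.Adj p z → z ≠ q → 2 * (T.del p z).compCard z ≤ N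
    · exact ⟨q, p, hqp, fun _ h => h, hN, h⟩
    · push Not at h
      obtain ⟨z, hz, hzq, hzN⟩ := h
      have h1 : ∀ u, (T.del p z).Reachable z u → (T.del q p).Reachable p u := fun u hu =>
        hT.reachable_del_of_reachable_del hz hzq hu
      have h2 : (T.del p z).compCard z < n := by
        rw [← hn]
        exact compCard_lt h1 .rfl fun h => hT.not_reachable_del hz h.symm
      obtain ⟨x, y, hxy, h3, h4⟩ := ih _ h2 hz hzN rfl
      exact ⟨x, y, hxy, fun u hu => h1 u (h3 u hu), h4⟩

/-- Deleting an edge disjoint from a side of a dart does not change this side. -/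
lemma reachable_del_del_iff {a b u w : V}
    (ha : ¬ (T.del u w).Reachable w a) (hb : ¬ (T.del u w).Reachable w b) (v : V) :
    ((T.del a b).del u w).Reachable w v ↔ (T.del u w).Reachable w v := by
  constructor
  · refine fun h => h.mono fun c d hcd => ?_
    rw [del_adj, del_adj] at hcd
    exact del_adj.2 ⟨hcd.1.1, hcd.2⟩
  · intro h
    refine h.induction (P := fun v => ((T.del a b).del u w).Reachable w v) .rfl
      fun c d hc ih hcd => ih.trans (Adj.reachable ?_)
    rw [del_adj] at hcd
    refine del_adj.2 ⟨del_adj.2 ⟨hcd.1, ?_⟩, hcd.2⟩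
    rintro (⟨rfl, -⟩ | ⟨rfl, -⟩)
    · exact ha hc
    · exact hb hc

lemma compCard_del_del {a b u w : V}
    (ha : ¬ (T.del u w).Reachable w a) (hb : ¬ (T.del u w).Reachable w b) :
    ((T.del a b).del u w).compCard w = (T.del u w).compCard w :=
  compCard_congr (reachable_del_del_iff ha hb)

/-- An automorphism flipping an edge of a forest fixes no vertex of the component. -/
lemma IsAcyclic.ne_of_flip (hG : G.IsAcyclic) (φ : G ≃g G) {u w y : V} (huw : G.Adj u w)
    (h1 : φ u = w) (h2 : φ w = u) (hy : G.Reachable u y) : φ y ≠ y := by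
  intro h
  have hr := (IsRootedIso.of_iso φ y).del (x := u) (y := w) (z := y) .rfl
  have e1 : φ.toEquiv u = w := h1
  have e2 : φ.toEquiv w = u := h2
  have e3 : φ.toEquiv y = y := h
  rw [e1, e2, e3, del_comm w u] at hr
  have hnr := hG.not_reachable_del huw
  rcases reachable_del (y := w) hy with h3 | h3
  · have := hr.reachable h3.symm
    rw [e1] at this
    exact hnr (h3.trans this)
  · have := hr.reachable h3.symm
    rw [e2] at this
    exact hnr (h3.trans this).symm

section EdgeRecovery

variable {N : ℕ}

/-- The data shared by the deleted edges in the recovery of an edge from its deletion: the edge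
avoids the side of `p` with respect to `qp`, and its deletion leaves `N` vertices in the component
of `p`. -/
structure IsFarEdge (T : SimpleGraph V) (q p : V) (N : ℕ) (a b : V) : Prop where
  adj : T.Adj a b
  left : ¬ (T.del q p).Reachable p a
  right : ¬ (T.del q p).Reachable p b
  card : (T.del a b).compCard p = N

/-- An extremal dart on the side of `p` with respect to `qp`. -/
structure IsExtremalDart (T : SimpleGraph V) (q p : V) (N : ℕ) (x y : V) : Prop where
  adj : T.Adj x y
  side : ∀ u, (T.del x y).Reachable y u → (T.del q p).Reachable p u
  lt : N < 2 * (T.del x y).compCard y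
  le : ∀ z, T.Adj y z → z ≠ x → 2 * (T.del y z).compCard z ≤ N

variable {a b c d x y v : V}

lemma IsFarEdge.reachable (h : T.IsFarEdge q p N a b) {u : V}
    (hu : (T.del q p).Reachable p u) : (T.del a b).Reachable p u := by
  refine hu.induction (P := fun u => (T.del a b).Reachable p u) .rfl
    fun c d hc ih hcd => ih.trans (Adj.reachable ?_)
  refine del_adj.2 ⟨del_le _ _ hcd, ?_⟩
  rintro (⟨rfl, -⟩ | ⟨rfl, -⟩)
  · exact h.left hc
  · exact h.right hc

lemma IsExtremalDart.side_of_adj (hT : T.IsAcyclic) (h : T.IsExtremalDart q p N x y)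
    (hv : T.Adj y v) (hvx : v ≠ x) {u : V} (hu : (T.del y v).Reachable v u) :
    (T.del q p).Reachable p u :=
  h.side u (hT.reachable_del_of_reachable_del hv hvx hu)

lemma IsExtremalDart.reachable (h : T.IsExtremalDart q p N x y) (he : T.IsFarEdge q p N a b) :
    (T.del a b).Reachable p y := he.reachable (h.side y .rfl)

lemma IsExtremalDart.compCard_eq (h : T.IsExtremalDart q p N x y) (he : T.IsFarEdge q p N a b) :
    (T.del a b).compCard y = N := by
  rw [← compCard_reachable (h.reachable he), he.card]

/-- The side of `y` is untouched by a far edge and holds more than half of the `N` vertices, so the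
branch towards `x` is a strict minority. -/
lemma IsExtremalDart.compCard_lt [Finite V] (hT : T.IsAcyclic) (h : T.IsExtremalDart q p N x y)
    (he : T.IsFarEdge q p N a b) (hx : (T.del a b).Adj y x) :
    2 * ((T.del a b).del y x).compCard x < N := by
  have h1 := (hT.del a b).compCard_del_add hx
  have h2 : ((T.del a b).del y x).compCard y = (T.del x y).compCard y := by
    rw [del_comm y x]
    exact compCard_del_del (fun h' => he.left (h.side _ h')) fun h' => he.right (h.side _ h')
  rw [h.compCard_eq he, h2] at h1
  have := h.lt
  omega

/-- The branch towards `x` is small, and the others are those of `T`, small by extremality. The dart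
is found without reference to the far edge, so all far edges with the same `N` leave the same
centroid. -/
lemma IsExtremalDart.isCentroid [Finite V] (hT : T.IsAcyclic) (h : T.IsExtremalDart q p N x y)
    (he : T.IsFarEdge q p N a b) : (T.del a b).IsCentroid y := by
  intro z hz
  rw [h.compCard_eq he]
  by_cases hzx : z = x
  · subst hzx
    exact (h.compCard_lt hT he hz).le
  · have hz' := del_le _ _ hz
    rw [compCard_del_del (fun h' => he.left (h.side_of_adj hT hz' hzx h'))
      fun h' => he.right (h.side_of_adj hT hz' hzx h')]
    exact h.le z hz' hzx

/-- If a rooted isomorphism between the components left by two far edges moves the centroid `y`,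
then it exchanges the ends of the edge that halves these components. -/
lemma IsExtremalDart.exists_exchange [Finite V] (hT : T.IsAcyclic)
    (h : T.IsExtremalDart q p N x y) (he : T.IsFarEdge q p N a b) (he' : T.IsFarEdge q p N c d)
    (hφ : IsRootedIso (T.del a b) p (T.del c d) p' φ) (hp : (T.del c d).Reachable p p')
    (hy : φ y ≠ y) : T.Adj y (φ y) ∧ φ y ≠ x ∧ 2 * (T.del y (φ y)).compCard (φ y) = N ∧
      φ (φ y) = y := by
  have hpy := h.reachable he
  have hpy' := h.reachable he'
  -- The vertex `φ y` is a second centroid of the component left by `cd`, hence a neighbour of `y`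
  -- across a halving edge. It is not `x`, whose branch is a strict minority.
  have hcv := hφ.isCentroid hpy (h.isCentroid hT he)
  have hyv : (T.del c d).Reachable y (φ y) := (hpy'.symm.trans hp).trans (hφ.reachable hpy)
  obtain ⟨h1, h2⟩ := (h.isCentroid hT he').adj (hT.del c d) hcv hyv hy
  rw [h.compCard_eq he'] at h2
  have hvx : φ y ≠ x := by
    intro hvx
    rw [hvx] at h1 h2
    have := h.compCard_lt hT he' h1
    omega
  have h3 := del_le _ _ h1
  have hl : ∀ {a b}, T.IsFarEdge q p N a b → ¬ (T.del y (φ y)).Reachable (φ y) a := fun he h' =>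
    he.left (h.side_of_adj hT h3 hvx h')
  have hr : ∀ {a b}, T.IsFarEdge q p N a b → ¬ (T.del y (φ y)).Reachable (φ y) b := fun he h' =>
    he.right (h.side_of_adj hT h3 hvx h')
  rw [compCard_del_del (hl he') (hr he')] at h2
  refine ⟨h3, hvx, h2, ?_⟩
  -- Otherwise the image of the half beyond `φ y` would be a branch lying properly inside that half,
  -- although it has the same size.
  by_contra hne
  have hv1 : (T.del a b).Adj y (φ y) := by
    refine del_adj.2 ⟨h3, ?_⟩
    rintro (⟨h', -⟩ | ⟨h', -⟩)
    · exact he.left (h' ▸ h.side y .rfl)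
    · exact he.right (h' ▸ h.side y .rfl)
  have h4 : (T.del c d).Adj (φ y) (φ (φ y)) := (hφ.2 _ _ hpy).1 hv1
  have h5 := (hφ.del (x := y) (y := φ y) (hpy.trans hv1.reachable)).compCard_eq
  rw [compCard_del_del (hl he) (hr he)] at h5
  have h6 : ∀ u, ((T.del c d).del (φ y) (φ (φ y))).Reachable (φ (φ y)) u →
      ((T.del c d).del y (φ y)).Reachable (φ y) u := fun u hu =>
    (hT.del c d).reachable_del_of_reachable_del h4 hne hu
  have h7 := SimpleGraph.compCard_lt h6 (z := φ y) .rfl fun h' =>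
    (hT.del c d).not_reachable_del h4 h'.symm
  rw [compCard_del_del (hl he') (hr he')] at h7
  omega

/-- After removal of a centroid next to `y`, the remaining branches determine the far edge. -/
lemma IsExtremalDart.eq_of_rootedIso_cut [Finite V] (hT : T.IsTree)
    (hr : ∀ z, T.RigidAt z) (h : T.IsExtremalDart q p N x y) (he : T.IsFarEdge q p N a b)
    (he' : T.IsFarEdge q p N c d) (hv : T.Adj y v) (hvx : v ≠ x)
    (hiso : RootedIso ((T.del a b).cut v) y ((T.del c d).cut v) y) : s(a, b) = s(c, d) := by
  have hA := hT.isAcyclic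
  rw [cut_del, cut_del] at hiso
  have h1 : ∀ {a b}, T.IsFarEdge q p N a b → (T.cut v).Adj a b ∧ (T.cut v).Reachable y a := by
    intro a b he
    have hva : ¬ (T.del y v).Reachable v a := fun h' => he.left (h.side_of_adj hA hv hvx h')
    have hvb : ¬ (T.del y v).Reachable v b := fun h' => he.right (h.side_of_adj hA hv hvx h')
    refine ⟨⟨he.adj, ?_, ?_⟩, ?_⟩
    · rintro rfl
      exact hva .rfl
    · rintro rfl
      exact hvb .rfl
    · refine hA.cut_reachable_of_del hv.symm ?_
      rw [del_comm v y]
      exact (reachable_del (hT.connected.preconnected y a)).resolve_right hva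
  exact ((hr v).cut hA hv.symm).eq_of_rootedIso_del (hA.anti cut_le) (h1 he).1 (h1 he).2
    (h1 he').1 (h1 he').2 hiso

/-- The branch of `v` at `y` lies on the side of `p`, which no far edge meets. -/
lemma IsExtremalDart.rootedIso_cut (hT : T.IsAcyclic) (h : T.IsExtremalDart q p N x y)
    (he : T.IsFarEdge q p N a b) (hv : T.Adj y v) (hvx : v ≠ x) :
    RootedIso ((T.del a b).cut y) v (T.cut y) v := by
  rw [cut_del]
  refine RootedIso.of_adj_iff fun u w hu => ?_
  have h1 := h.side_of_adj hT hv hvx ((hu.mono (del_le a b)).mono (cut_le_del v))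
  rw [del_adj]
  refine ⟨fun h => h.1, fun h' => ⟨h', ?_⟩⟩
  rintro (⟨rfl, -⟩ | ⟨rfl, -⟩)
  · exact he.left h1
  · exact he.right h1

/-- The rooted isomorphism obtained from an exchange of `y` and `v`. -/
lemma IsRootedIso.rootedIso_cut_of_exchange (hφ : IsRootedIso G p G' p' φ)
    (hy : G.Reachable p y) (hyv : G.Adj y v) (h1 : φ y = v) (h2 : φ v = y) :
    RootedIso (G.cut v) y (G'.cut y) v := by
  have := hφ.cut (hy.trans hyv.reachable) hyv.symm
  rw [h1, h2] at this
  exact ⟨φ, this⟩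

lemma IsFarEdge.adj_del (he : T.IsFarEdge q p N a b) (h : T.IsExtremalDart q p N x y)
    (hv : T.Adj y v) : (T.del a b).Adj y v := by
  refine del_adj.2 ⟨hv, ?_⟩
  rintro (⟨rfl, -⟩ | ⟨rfl, -⟩)
  · exact he.left (h.side _ .rfl)
  · exact he.right (h.side _ .rfl)

/-- A far edge is determined by the component of `p` after its deletion. -/
theorem IsFarEdge.eq_of_isRootedIso [Finite V] (hT : T.IsTree) (hr : ∀ z, T.RigidAt z)
    (hqp : T.Adj q p) (hN : N < 2 * (T.del q p).compCard p) (he : T.IsFarEdge q p N a b)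
    (he' : T.IsFarEdge q p N c d) (hφ : IsRootedIso (T.del a b) p (T.del c d) p' φ)
    (hp : (T.del c d).Reachable p p') : s(a, b) = s(c, d) := by
  have hA := hT.isAcyclic
  obtain ⟨x, y, h1, h2, h3, h4⟩ := hA.exists_extremal_dart N hqp hN
  have h : T.IsExtremalDart q p N x y := ⟨h1, h2, h3, h4⟩
  have hpy := h.reachable he
  -- If `φ` fixes the centroid, it is a rooted isomorphism at `y`, and rigidity of `T` at `y`
  -- recovers the edge.
  by_cases hy : φ y = y
  · have h5 := hφ.root hpy
    rw [hy] at h5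
    exact (hr y).eq_of_rootedIso_del hA he.adj (hT.connected.preconnected _ _) he'.adj
      (hT.connected.preconnected _ _) ⟨φ, h5⟩
  · obtain ⟨h5, h6, h7, h8⟩ := h.exists_exchange hA he he' hφ hp hy
    have h9 := hφ.rootedIso_cut_of_exchange hpy (he.adj_del h h5) rfl h8
    have hpv : (T.del c d).Reachable p' (φ y) := hφ.reachable hpy
    have h10 := hφ.symm.rootedIso_cut_of_exchange (y := y) (v := φ y)
      (hp.symm.trans (h.reachable he')) (he'.adj_del h h5)
      (by rw [Equiv.Perm.inv_def, Equiv.symm_apply_eq, h8]) (φ.symm_apply_apply y)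
    -- Both deletions leave the same half at `φ y`. The exchange identifies this half with the half
    -- of `y` in either deletion, so the latter two are isomorphic as rooted trees.
    refine h.eq_of_rootedIso_cut hT hr he he' h5 h6 ?_
    exact ((h9.trans (h.rootedIso_cut hA he' h5 h6)).trans
      (h.rootedIso_cut hA he h5 h6).symm).trans h10.symm

/-- A far edge is unique if the component of `p` after its deletion has a flipped edge. -/
theorem IsFarEdge.eq_of_flip [Finite V] (hT : T.IsTree) (hr : ∀ z, T.RigidAt z)
    (hqp : T.Adj q p) (hN : N < 2 * (T.del q p).compCard p) (he : T.IsFarEdge q p N a b)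
    (he' : T.IsFarEdge q p N c d)
    (hf : ∃ φ : T.del a b ≃g T.del a b, ∃ u w, (T.del a b).Adj u w ∧
      (T.del a b).Reachable p u ∧ φ u = w ∧ φ w = u)
    (hf' : ∃ φ : T.del c d ≃g T.del c d, ∃ u w, (T.del c d).Adj u w ∧
      (T.del c d).Reachable p u ∧ φ u = w ∧ φ w = u) : s(a, b) = s(c, d) := by
  have hA := hT.isAcyclic
  obtain ⟨x, y, h1, h2, h3, h4⟩ := hA.exists_extremal_dart N hqp hN
  have h : T.IsExtremalDart q p N x y := ⟨h1, h2, h3, h4⟩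
  have key : ∀ {a b}, T.IsFarEdge q p N a b → (∃ φ : T.del a b ≃g T.del a b, ∃ u w,
      (T.del a b).Adj u w ∧ (T.del a b).Reachable p u ∧ φ u = w ∧ φ w = u) →
      ∃ v, T.Adj y v ∧ v ≠ x ∧ 2 * (T.del y v).compCard v = N ∧
        RootedIso ((T.del a b).cut v) y ((T.del a b).cut y) v := by
    rintro a b he ⟨φ, u, w, huw, hpu, hu, hw⟩
    have hpy := h.reachable he
    have hy : φ.toEquiv y ≠ y := (hA.del a b).ne_of_flip φ huw hu hw (hpu.symm.trans hpy)
    have hpp : (T.del a b).Reachable p (φ p) := by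
      have h5 : (T.del a b).Reachable (φ p) (φ u) := (Iso.reachable_iff (φ := φ)).2 hpu
      rw [hu] at h5
      exact (hpu.trans huw.reachable).trans h5.symm
    have hφ := IsRootedIso.of_iso φ p
    obtain ⟨h5, h6, h7, h8⟩ := h.exists_exchange hA he he hφ hpp hy
    exact ⟨_, h5, h6, h7, hφ.rootedIso_cut_of_exchange hpy (he.adj_del h h5) rfl h8⟩
  obtain ⟨v, h5, h6, h7, h8⟩ := key he hf
  obtain ⟨v', h5', h6', h7', h8'⟩ := key he' hf'
  -- Only one branch at `y` can have half of the vertices: a second one would fit into the other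
  -- half while missing `y`.
  have hv : v = v' := by
    by_contra hne
    have h10 := (hA.del a b).compCard_del_add (he.adj_del h h5)
    have hl : ∀ {v}, T.Adj y v → v ≠ x →
        ((T.del a b).del y v).compCard v = (T.del y v).compCard v := fun h5 h6 =>
      compCard_del_del (fun h' => he.left (h.side_of_adj hA h5 h6 h'))
        fun h' => he.right (h.side_of_adj hA h5 h6 h')
    rw [hl h5 h6, h.compCard_eq he] at h10
    have h11 : ∀ u, ((T.del a b).del y v').Reachable v' u →
        ((T.del a b).del y v).Reachable y u := fun u hu => by
      rw [del_comm]
      exact (hA.del a b).reachable_del_of_reachable_del (he.adj_del h h5') (Ne.symm hne) hu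
    have h12 := SimpleGraph.compCard_lt h11 (z := y) .rfl fun h' =>
      (hA.del a b).not_reachable_del (he.adj_del h h5') h'.symm
    rw [hl h5' h6'] at h12
    omega
  subst hv
  refine h.eq_of_rootedIso_cut hT hr he he' h5 h6 ?_
  exact ((h8.trans (h.rootedIso_cut hA he h5 h6)).trans
    (h.rootedIso_cut hA he' h5 h6).symm).trans h8'.symm

end EdgeRecovery

end Centroid

end SimpleGraph

namespace SimpleGraph

/-! ### Reductions of distinct deletions are not isomorphic -/

section OddDeletion

/-- If `i < j`, the odd number `1 + 2 ^ (j - i)`, which exceeds 1, would divide a power of 2. -/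
lemma eq_of_mul_two_pow_add {a i j k : ℕ} (h : a * 2 ^ i + a * 2 ^ j = 2 ^ k) : i = j := by
  have key : ∀ {i j : ℕ}, a * 2 ^ i + a * 2 ^ j = 2 ^ k → ¬ i < j := by
    intro i j h hij
    obtain ⟨d, rfl⟩ := Nat.exists_eq_add_of_lt hij
    have h1 : (1 + 2 ^ (d + 1)) ∣ 2 ^ k := ⟨a * 2 ^ i, by rw [← h]; ring⟩
    obtain ⟨m, -, hm⟩ := (Nat.dvd_prime_pow Nat.prime_two).1 h1
    rcases m with _ | m
    · have : 0 < 2 ^ (d + 1) := by positivity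
      omega
    · rw [pow_succ, pow_succ] at hm
      omega
  exact le_antisymm (not_lt.1 (key (by rwa [add_comm] at h))) (not_lt.1 (key h))

variable {V : Type*} {T R R' : SimpleGraph V} {p q a b c d : V} {i j i' j' k : ℕ}

/-- A flip-free reduction `R` of `T` without the edge `ab`. -/
structure IsReduction [Finite V] (T : SimpleGraph V) (a b : V) (R : SimpleGraph V) (i j : ℕ) :
    Prop where
  le : R ≤ T.del a b
  flipFree : R.FlipFree
  parityEq : ParityEq (T.del a b) R
  left : ∀ v, (T.del a b).Reachable a v → R.compCard v * 2 ^ i = (T.del a b).compCard a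
  right : ∀ v, (T.del a b).Reachable b v → R.compCard v * 2 ^ j = (T.del a b).compCard b
  zero : j = 0 → ∀ u w, (T.del a b).Reachable b u → (T.del a b).Adj u w → R.Adj u w
  pos : j ≠ 0 → ∃ φ : T.del a b ≃g T.del a b, ∃ u w, (T.del a b).Adj u w ∧
    (T.del a b).Reachable b u ∧ φ u = w ∧ φ w = u

lemma IsTree.exists_isReduction [Finite V] (hT : T.IsTree) (hab : T.Adj a b) :
    ∃ R i j, T.IsReduction a b R i j := by
  obtain ⟨R, h1, h2, h3, i, j, h4, h5, h6, h7⟩ := hT.exists_reduction_del hab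
  exact ⟨R, i, j, h1, h2, h3, h4, h5, h6, h7⟩

lemma compCard_pos [Finite V] (G : SimpleGraph V) (v : V) : 0 < G.compCard v :=
  (Set.ncard_pos (Set.toFinite _)).2 ⟨v, .rfl⟩

lemma IsTree.compCard_eq (hT : T.IsTree) (v : V) : T.compCard v = Nat.card V := by
  unfold compCard
  rw [← Set.ncard_univ]
  congr 1
  ext w
  simp [hT.connected.preconnected v w]

/-- A common component size `c` gives `c * 2 ^ i + c * 2 ^ j = 2 ^ k`, hence `i = j` and two sides
of equal size. -/
lemma IsReduction.compCard_ne [Finite V] (hT : T.IsTree) (hab : T.Adj a b)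
    (hk : Nat.card V = 2 ^ k) (hlt : (T.del a b).compCard a < (T.del a b).compCard b)
    (h : T.IsReduction a b R i j) {u v : V} (hu : (T.del a b).Reachable a u)
    (hv : (T.del a b).Reachable b v) : R.compCard u ≠ R.compCard v := by
  intro huv
  have h1 := h.left u hu
  have h2 := h.right v hv
  have h3 := hT.isAcyclic.compCard_del_add hab
  rw [hT.compCard_eq, hk, ← h1, ← h2, huv] at h3
  have := eq_of_mul_two_pow_add h3
  subst this
  rw [huv, h2] at h1
  omega

/-- Component sizes of `R` are constant on each side and differ between the sides, so `R` alone
shows which vertices form the larger side. -/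
lemma IsReduction.ncard_right [Finite V] (hT : T.IsTree) (hab : T.Adj a b)
    (hk : Nat.card V = 2 ^ k) (hlt : (T.del a b).compCard a < (T.del a b).compCard b)
    (h : T.IsReduction a b R i j) : {v | R.compCard v = R.compCard b}.ncard =
      (T.del a b).compCard b := by
  unfold compCard
  congr 1
  ext v
  constructor
  · intro hv
    refine (reachable_del (hT.connected.preconnected a v)).resolve_left fun hv' => ?_
    exact h.compCard_ne hT hab hk hlt hv' .rfl hv
  · intro hv
    exact Nat.eq_of_mul_eq_mul_right (by positivity : 0 < 2 ^ j)
      ((h.right v hv).trans (h.right b .rfl).symm)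

lemma IsReduction.ncard_left [Finite V] (hT : T.IsTree) (hab : T.Adj a b)
    (hk : Nat.card V = 2 ^ k) (hlt : (T.del a b).compCard a < (T.del a b).compCard b)
    (h : T.IsReduction a b R i j) : {v | R.compCard v = R.compCard a}.ncard =
      (T.del a b).compCard a := by
  unfold compCard
  congr 1
  ext v
  constructor
  · intro hv
    refine (reachable_del (hT.connected.preconnected a v)).resolve_right fun hv' => ?_
    exact h.compCard_ne hT hab hk hlt .rfl hv' hv.symm
  · intro hv
    exact Nat.eq_of_mul_eq_mul_right (by positivity : 0 < 2 ^ i)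
      ((h.left v hv).trans (h.left a .rfl).symm)

/-- The far edge is determined by its reduction. -/
theorem IsReduction.eq_of_iso [Finite V] (hT : T.IsTree) (hr : ∀ z, T.RigidAt z)
    (hk : Nat.card V = 2 ^ k) (hqp : T.Adj q p)
    (hqpc : 2 * (T.del q p).compCard p = Nat.card V)
    (hab : T.Adj a b) (ha : ¬ (T.del q p).Reachable p a) (hb : ¬ (T.del q p).Reachable p b)
    (hbp : (T.del a b).Reachable b p) (hlt : (T.del a b).compCard a < (T.del a b).compCard b)
    (hcd : T.Adj c d) (hc : ¬ (T.del q p).Reachable p c) (hd : ¬ (T.del q p).Reachable p d)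
    (hdp : (T.del c d).Reachable d p) (hlt' : (T.del c d).compCard c < (T.del c d).compCard d)
    (h : T.IsReduction a b R i j) (h' : T.IsReduction c d R' i' j') (e : R ≃g R') :
    s(a, b) = s(c, d) := by
  have hce : ∀ v, R'.compCard (e v) = R.compCard v := fun v =>
    (IsRootedIso.of_iso e v).compCard_eq.symm
  have hcount : ∀ n, {v | R.compCard v = n}.ncard = {v | R'.compCard v = n}.ncard := by
    intro n
    rw [← Set.ncard_image_of_injective _ e.injective]
    congr 1
    ext v
    constructor
    · rintro ⟨u, hu, rfl⟩
      exact (hce u).trans hu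
    · intro hv
      refine ⟨e.symm v, ?_, by simp⟩
      have := hce (e.symm v)
      rw [e.apply_symm_apply] at this
      exact this.symm.trans hv
  have hs := h.ncard_left hT hab hk hlt
  have ht := h.ncard_right hT hab hk hlt
  have hs' := h'.ncard_left hT hcd hk hlt'
  have ht' := h'.ncard_right hT hcd hk hlt'
  have hside : ∀ v, (T.del c d).Reachable d v ↔ R'.compCard v = R'.compCard d := by
    intro v
    constructor
    · intro hv
      exact Nat.eq_of_mul_eq_mul_right (by positivity : 0 < 2 ^ j')
        ((h'.right v hv).trans (h'.right d .rfl).symm)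
    · intro hv
      refine (reachable_del (hT.connected.preconnected c v)).resolve_left fun hv' => ?_
      exact h'.compCard_ne hT hcd hk hlt' hv' .rfl hv
  -- The isomorphism matches larger sides: a larger side has more than half of the vertices, so it
  -- cannot have the size of a smaller one.
  have hb1 : R.compCard b = R'.compCard d := by
    rw [← hce b, ← hside]
    refine (reachable_del (hT.connected.preconnected c (e b))).resolve_left fun hv => ?_
    have h1 : R.compCard b = R'.compCard c := by
      rw [← hce b]
      exact Nat.eq_of_mul_eq_mul_right (by positivity : 0 < 2 ^ i')
        ((h'.left _ hv).trans (h'.left c .rfl).symm)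
    rw [hcount, h1] at ht
    have h2 := hT.isAcyclic.compCard_del_add hab
    have h3 := hT.isAcyclic.compCard_del_add hcd
    rw [hT.compCard_eq] at h2 h3
    omega
  have hcard : (T.del a b).compCard b = (T.del c d).compCard d := by
    rw [← ht, ← ht', hcount, hb1]
  have hj : j = j' := by
    have h1 := h.right b .rfl
    rw [hcard, ← h'.right d .rfl, hb1] at h1
    exact Nat.pow_right_injective le_rfl (Nat.eq_of_mul_eq_mul_left (compCard_pos _ _) h1)
  subst hj
  have he : T.IsFarEdge q p ((T.del a b).compCard b) a b :=
    ⟨hab, ha, hb, (compCard_reachable hbp).symm⟩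
  have he' : T.IsFarEdge q p ((T.del a b).compCard b) c d :=
    ⟨hcd, hc, hd, by rw [hcard, compCard_reachable hdp]⟩
  have hN : (T.del a b).compCard b < 2 * (T.del q p).compCard p := by
    rw [hqpc, ← hT.isAcyclic.compCard_del_add hab |>.trans (hT.compCard_eq a)]
    have := compCard_pos (T.del a b) a
    omega
  -- For `j = 0` the larger sides survive entirely in the reductions, and `e` is an isomorphism
  -- between them. Otherwise each of them has a flipped edge.
  by_cases hj : j = 0
  · have hU : ∀ u, (T.del a b).Reachable p u → (T.del c d).Reachable d (e u) := by
      intro u hu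
      rw [hside, hce, ← hb1]
      exact Nat.eq_of_mul_eq_mul_right (by positivity : 0 < 2 ^ j)
        ((h.right u (hbp.trans hu)).trans (h.right b .rfl).symm)
    refine he.eq_of_isRootedIso hT hr hqp hN he' (p' := e p) (φ := e.toEquiv)
      ⟨rfl, fun u w hu => ?_⟩ (hdp.symm.trans (hU p .rfl))
    constructor
    · intro huw
      exact h'.le (e.map_adj_iff.2 (h.zero hj u w (hbp.trans hu) huw))
    · intro huw
      exact h.le (e.map_adj_iff.1 (h'.zero hj _ _ (hU u hu) huw))
  · obtain ⟨φ, u, w, h1, h2, h3, h4⟩ := h.pos hj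
    obtain ⟨φ', u', w', h1', h2', h3', h4'⟩ := h'.pos hj
    exact he.eq_of_flip hT hr hqp hN he' ⟨φ, u, w, h1, hbp.symm.trans h2, h3, h4⟩
      ⟨φ', u', w', h1', hdp.symm.trans h2', h3', h4'⟩

lemma IsReduction.ne_bot [Finite V] (hT : T.IsTree) (hab : T.Adj a b)
    (hk : Nat.card V = 2 ^ k) (hlt : (T.del a b).compCard a < (T.del a b).compCard b)
    (h : T.IsReduction a b R i j) : R ≠ ⊥ := by
  rintro rfl
  refine h.compCard_ne hT hab hk hlt .rfl .rfl ?_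
  simp [compCard, reachable_bot]

/-- Isomorphic graphs one of which contains the other are equal. -/
lemma eq_of_le_of_card_le [Finite V] {F G : SimpleGraph V} (h : F ≤ G)
    (hc : G.edgeSet.ncard ≤ F.edgeSet.ncard) : F = G :=
  edgeSet_injective (Set.eq_of_subset_of_ncard_le (edgeSet_subset_edgeSet.2 h) hc (Set.toFinite _))

lemma ncard_edgeSet_iso {F G : SimpleGraph V} (e : F ≃g G) :
    F.edgeSet.ncard = G.edgeSet.ncard :=
  Nat.card_congr e.mapEdgeSet

open Classical in
/-- The number of spanning subgraphs of `G` isomorphic to `F`. -/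
noncomputable def copies [Finite V] (F G : SimpleGraph V) : ℕ :=
  (G.subs.filter fun F' => Nonempty (F' ≃g F)).card

/-- Being isomorphic to a flip-free graph is an admissible test function. -/
lemma ParityEq.copies_eq [Finite V] {F G R : SimpleGraph V} (h : ParityEq G R)
    (hF : F.FlipFree) : (copies F G : ZMod 2) = copies F R := by
  classical
  have := h (fun F' => if Nonempty (F' ≃g F) then 1 else 0) ?_ ?_
  · rw [Finset.sum_boole, Finset.sum_boole] at this
    unfold copies
    exact this
  · rintro F1 F2 ⟨φ⟩
    refine if_congr ⟨?_, ?_⟩ rfl rfl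
    · rintro ⟨e⟩
      exact ⟨φ.symm.trans e⟩
    · rintro ⟨e⟩
      exact ⟨φ.trans e⟩
  · intro F' hF'
    refine if_neg ?_
    rintro ⟨e⟩
    exact hF' (hF.iso e.symm)

/-- A family of reductions of distinct far edges detects one of the edges by parity. -/
theorem exists_odd_copies [Finite V] {ι : Type*} (B : Finset ι) (hB : B.Nonempty)
    (G R : ι → SimpleGraph V) (hf : ∀ e ∈ B, (R e).FlipFree)
    (hp : ∀ e ∈ B, ParityEq (G e) (R e))
    (hinj : ∀ e ∈ B, ∀ e' ∈ B, Nonempty (R e ≃g R e') → e = e') :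
    ∃ e ∈ B, ((∑ e' ∈ B, copies (R e) (G e') : ℕ) : ZMod 2) = 1 := by
  classical
  -- Because `R e` has the most edges, another `R e'` contains a copy of it only by being isomorphic
  -- to it.
  obtain ⟨e, he, hmax⟩ := B.exists_max_image (fun e => (R e).edgeSet.ncard) hB
  refine ⟨e, he, ?_⟩
  push_cast
  rw [Finset.sum_congr rfl fun e' he' => (hp e' he').copies_eq (hf e he),
    Finset.sum_eq_single_of_mem e he]
  · have : ((R e).subs.filter fun F' => Nonempty (F' ≃g R e)) = {R e} := by
      ext F
      rw [Finset.mem_filter, mem_subs, Finset.mem_singleton]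
      constructor
      · rintro ⟨h1, ⟨φ⟩⟩
        exact eq_of_le_of_card_le h1 (ncard_edgeSet_iso φ).ge
      · rintro rfl
        exact ⟨le_rfl, ⟨Iso.refl⟩⟩
    rw [copies, this]
    simp
  · intro e' he' hne
    have : ((R e').subs.filter fun F' => Nonempty (F' ≃g R e)) = ∅ := by
      rw [Finset.filter_eq_empty_iff]
      rintro F hF ⟨φ⟩
      rw [mem_subs] at hF
      have h1 := eq_of_le_of_card_le hF ((hmax e' he').trans (ncard_edgeSet_iso φ).ge)
      subst h1
      exact hne (hinj e' he' e he ⟨φ⟩)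
    rw [copies, this]
    simp

end OddDeletion

end SimpleGraph

namespace SimpleGraph

/-! ### Invariant orientations and signs of copies -/

section Orientation

variable {V : Type*}

/-- A set of ordered pairs that orients the edges of `F` invariantly under automorphisms. -/
structure IsInvariantOrientation (F : SimpleGraph V) (I : Finset (V × V)) : Prop where
  adj_iff : ∀ x y, F.Adj x y ↔ (x, y) ∈ I ∨ (y, x) ∈ I
  asymm : ∀ x y, (x, y) ∈ I → (y, x) ∉ I
  map : ∀ (φ : F ≃g F) x y, (x, y) ∈ I → (φ x, φ y) ∈ I

/-- For an edge `xy` of a flip-free graph the pairs `(x, y)` and `(y, x)` lie in different orbits of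
the automorphism group. Number the orbits and keep the pair with the smaller number. -/
lemma FlipFree.exists_isInvariantOrientation [Finite V] {F : SimpleGraph V} (h : F.FlipFree) :
    ∃ I, F.IsInvariantOrientation I := by
  classical
  have := Fintype.ofFinite V
  let S : Setoid (V × V) := ⟨fun p q => ∃ φ : F ≃g F, φ p.1 = q.1 ∧ φ p.2 = q.2,
    fun p => ⟨Iso.refl, rfl, rfl⟩,
    fun ⟨φ, h1, h2⟩ => ⟨φ.symm, by rw [← h1, φ.symm_apply_apply], by
      rw [← h2, φ.symm_apply_apply]⟩,
    fun ⟨φ, h1, h2⟩ ⟨ψ, h3, h4⟩ => ⟨φ.trans ψ, by rw [← h3, ← h1]; rfl, by rw [← h4, ← h2]; rfl⟩⟩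
  have : Finite (Quotient S) := Quotient.finite S
  let q : V × V → ℕ := fun p => (Finite.equivFin (Quotient S) ⟦p⟧).1
  have hq : ∀ p p', q p = q p' ↔ S p p' := by
    intro p p'
    rw [← Quotient.eq, ← (Finite.equivFin (Quotient S)).apply_eq_iff_eq, Fin.ext_iff]
  refine ⟨Finset.univ.filter fun p => F.Adj p.1 p.2 ∧ q p < q p.swap, ?_, ?_, ?_⟩
  · intro x y
    simp only [Finset.mem_filter, Finset.mem_univ, true_and, Prod.swap_prod_mk]
    constructor
    · intro hxy
      have hne : q (x, y) ≠ q (y, x) := by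
        rw [Ne, hq]
        rintro ⟨φ, h1, h2⟩
        exact h φ x y hxy h1 h2
      rcases hne.lt_or_gt with h1 | h1
      · exact Or.inl ⟨hxy, h1⟩
      · exact Or.inr ⟨hxy.symm, h1⟩
    · rintro (h | h)
      · exact h.1
      · exact h.1.symm
  · intro x y
    simp only [Finset.mem_filter, Finset.mem_univ, true_and, Prod.swap_prod_mk]
    intro h1 h2
    exact lt_asymm h1.2 h2.2
  · intro φ x y
    simp only [Finset.mem_filter, Finset.mem_univ, true_and, Prod.swap_prod_mk]
    have h1 : q (φ x, φ y) = q (x, y) := ((hq _ _).2 ⟨φ, rfl, rfl⟩).symm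
    have h2 : q (φ y, φ x) = q (y, x) := ((hq _ _).2 ⟨φ, rfl, rfl⟩).symm
    rw [h1, h2, φ.map_adj_iff]
    exact id

variable {F F' : SimpleGraph V} {I : Finset (V × V)}

lemma IsInvariantOrientation.map_iff (h : F.IsInvariantOrientation I) (φ : F ≃g F) (x y : V) :
    (φ x, φ y) ∈ I ↔ (x, y) ∈ I := by
  refine ⟨fun h' => ?_, h.map φ x y⟩
  have := h.map φ.symm _ _ h'
  simpa using this

open Classical in
/-- The product of the signs of the edges of the copy `F'` of `F`, oriented according to `I`. -/
noncomputable def signProd (F : SimpleGraph V) (I : Finset (V × V)) (s : V → V → ℤ)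
    (F' : SimpleGraph V) : ℤ :=
  if h : Nonempty (F ≃g F') then ∏ p ∈ I, s (h.some p.1) (h.some p.2) else 0

/-- Two isomorphisms onto `F'` differ by an automorphism of `F`, which preserves `I`; so the chosen
isomorphism does not matter. -/
lemma IsInvariantOrientation.signProd_eq (h : F.IsInvariantOrientation I) (s : V → V → ℤ)
    (e : F ≃g F') : F.signProd I s F' = ∏ p ∈ I, s (e p.1) (e p.2) := by
  have hn : Nonempty (F ≃g F') := ⟨e⟩
  rw [signProd, dif_pos hn]
  let φ : F ≃g F := hn.some.trans e.symm
  refine Finset.prod_equiv (φ.toEquiv.prodCongr φ.toEquiv) (fun p => ?_) fun p _ => ?_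
  · exact (h.map_iff φ p.1 p.2).symm
  · simp [φ]

lemma signProd_of_isEmpty (I : Finset (V × V)) (s : V → V → ℤ) (h : ¬ Nonempty (F ≃g F')) :
    F.signProd I s F' = 0 := dif_neg h

/-- A sign function on `T`: it is supported on the edges of `T`, where its values are `1`
and `-1`. -/
structure IsSign (T : SimpleGraph V) (s : V → V → ℤ) : Prop where
  zero : ∀ x y, ¬ T.Adj x y → s x y = 0
  sq : ∀ x y, T.Adj x y → s x y = 1 ∨ s x y = -1
  antisymm : ∀ x y, s x y = -s y x

lemma IsInvariantOrientation.signProd_eq_one_or {T : SimpleGraph V}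
    (h : F.IsInvariantOrientation I) {s : V → V → ℤ} (hs : T.IsSign s) (hF : F' ≤ T)
    (e : F ≃g F') : F.signProd I s F' = 1 ∨ F.signProd I s F' = -1 := by
  rw [h.signProd_eq s e]
  refine Finset.prod_induction _ (fun x => x = 1 ∨ x = -1) ?_ (Or.inl rfl) ?_
  · rintro a b (rfl | rfl) (rfl | rfl) <;> simp
  · intro p hp
    exact hs.sq _ _ (hF (e.map_adj_iff.2 ((h.adj_iff _ _).2 (Or.inl hp))))

lemma IsInvariantOrientation.signProd_eq_zero {T : SimpleGraph V}
    (h : F.IsInvariantOrientation I) {s : V → V → ℤ} (hs : T.IsSign s) (hF : ¬ F' ≤ T) :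
    F.signProd I s F' = 0 := by
  by_cases hn : Nonempty (F ≃g F')
  · obtain ⟨e⟩ := hn
    rw [h.signProd_eq s e]
    have : ∃ a b, F'.Adj a b ∧ ¬ T.Adj a b := by
      by_contra hno
      push Not at hno
      exact hF fun a b hab => hno a b hab
    obtain ⟨a, b, hab, hT⟩ := this
    have hab' : F.Adj (e.symm a) (e.symm b) := e.symm.map_adj_iff.2 hab
    rcases (h.adj_iff _ _).1 hab' with h1 | h1
    · refine Finset.prod_eq_zero h1 ?_
      simp only [e.apply_symm_apply]
      exact hs.zero _ _ hT
    · refine Finset.prod_eq_zero h1 ?_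
      simp only [e.apply_symm_apply]
      exact hs.zero _ _ fun h => hT h.symm
  · exact signProd_of_isEmpty I s hn

/-- The sum over all permutations of the products of signs in terms of the copies of `F`. -/
lemma IsInvariantOrientation.sum_perm [Fintype V] [DecidableEq V] {T : SimpleGraph V}
    (h : F.IsInvariantOrientation I) {s : V → V → ℤ} (hs : T.IsSign s) :
    ∑ π : Equiv.Perm V, ∏ p ∈ I, s (π p.1) (π p.2) =
      Nat.card (F ≃g F) * ∑ F' ∈ T.subs, F.signProd I s F' := by
  classical
  have h0 : ∑ F' ∈ T.subs, F.signProd I s F' = ∑ F' : SimpleGraph V, F.signProd I s F' := by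
    refine Finset.sum_subset (Finset.subset_univ _) fun F' _ hF' => ?_
    rw [mem_subs] at hF'
    exact h.signProd_eq_zero hs hF'
  -- Permutations are grouped by the image `F.comap π.symm` of `F`; a nonempty fibre is in bijection
  -- with the automorphisms of `F`.
  rw [h0, Finset.mul_sum, ← Finset.sum_fiberwise (s := Finset.univ)
    (g := fun π : Equiv.Perm V => F.comap π.symm)]
  refine Finset.sum_congr rfl fun F' _ => ?_
  have h1 : ∀ π : Equiv.Perm V, F.comap π.symm = F' ↔ ∀ x y, F'.Adj (π x) (π y) ↔ F.Adj x y := by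
    intro π
    constructor
    · rintro rfl x y
      simp
    · intro h
      ext x y
      rw [comap_adj, ← h]
      simp
  by_cases hn : Nonempty (F ≃g F')
  · obtain ⟨e⟩ := hn
    rw [Finset.sum_congr rfl (g := fun _ => F.signProd I s F')]
    · rw [Finset.sum_const, nsmul_eq_mul]
      congr 2
      rw [← Fintype.card_subtype, ← Nat.card_eq_fintype_card]
      refine Nat.card_congr ⟨fun π => RelIso.trans ⟨π.1, fun {x y} => (h1 π.1).1 π.2 x y⟩ e.symm,
        fun φ => ⟨(φ.trans e).toEquiv, (h1 _).2 fun x y => (φ.trans e).map_rel_iff⟩, ?_, ?_⟩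
      · intro π
        ext x
        simp
      · intro φ
        ext x
        simp
    · intro π hπ
      have := (h1 π).1 (Finset.mem_filter.1 hπ).2
      exact (h.signProd_eq s (⟨π, fun {x y} => this x y⟩ : F ≃g F')).symm
  · rw [signProd_of_isEmpty I s hn, mul_zero]
    refine Finset.sum_eq_zero fun π hπ => absurd ?_ hn
    have := (h1 π).1 (Finset.mem_filter.1 hπ).2
    exact ⟨⟨π, fun {x y} => this x y⟩⟩

open Classical in
lemma IsInvariantOrientation.sum_signProd [Finite V] {T G : SimpleGraph V}
    (h : F.IsInvariantOrientation I) {s : V → V → ℤ} (hs : T.IsSign s) (hG : G ≤ T) :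
    ∑ F' ∈ G.subs, F.signProd I s F' = copies F G -
      2 * ((G.subs.filter fun F' => F.signProd I s F' = -1).card : ℤ) := by
  have h1 : ∀ F' ∈ G.subs, F.signProd I s F' = (if Nonempty (F' ≃g F) then 1 else 0) -
      2 * if F.signProd I s F' = -1 then 1 else 0 := by
    intro F' hF'
    rw [mem_subs] at hF'
    by_cases hn : Nonempty (F' ≃g F)
    · obtain ⟨e⟩ := hn
      rw [if_pos ⟨e⟩]
      rcases h.signProd_eq_one_or hs (hF'.trans hG) e.symm with h2 | h2 <;> rw [h2] <;> norm_num
    · have hn' : ¬ Nonempty (F ≃g F') := fun ⟨e⟩ => hn ⟨e.symm⟩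
      rw [if_neg hn, signProd_of_isEmpty I s hn']
      norm_num
  rw [Finset.sum_congr rfl h1, Finset.sum_sub_distrib, ← Finset.mul_sum, Finset.sum_boole,
    Finset.sum_boole, copies]

end Orientation

end SimpleGraph

namespace Digraph

/-! ### Consequences of balance for signs and copies -/

section SignSums

open Finset

variable {V : Type*}

lemma isSign_sgn {H : Digraph V} (hH : H.IsOriented) : H.toSimpleGraphInclusive.IsSign H.sgn where
  zero x y h := by
    by_cases hxy : x = y
    · subst hxy
      simp [sgn]
    · rw [toSimpleGraphInclusive_adj] at h
      have h1 : ¬ H.Adj x y := fun h' => h ⟨hxy, Or.inl h'⟩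
      have h2 : ¬ H.Adj y x := fun h' => h ⟨hxy, Or.inr h'⟩
      simp [sgn, h1, h2]
  sq x y h := by
    rw [toSimpleGraphInclusive_adj] at h
    have h1 := hH x y
    have h2 := hH y x
    by_cases h3 : H.Adj x y <;> by_cases h4 : H.Adj y x <;> simp [sgn, h3, h4] <;> tauto
  antisymm := H.sgn_antisymm

/-- The antisymmetric indicator of a set of ordered pairs. -/
def pairSign [DecidableEq V] (J : Finset (V × V)) (q : V × V) : ℤ :=
  (if q ∈ J then 1 else 0) - if q.swap ∈ J then 1 else 0

lemma one_add_pairSign [DecidableEq V] {J : Finset (V × V)} (hJ : ∀ q ∈ J, q.swap ∉ J)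
    (q : V × V) : 1 + pairSign J q = (if q ∈ J then 2 else 1) * if q.swap ∈ J then 0 else 1 := by
  unfold pairSign
  by_cases h1 : q ∈ J
  · simp [h1, hJ q h1]
  · by_cases h2 : q.swap ∈ J <;> simp [h1, h2]

/-- Both sides are 0 if a pair of one set occurs reversed in the other, and `2 ^ #(A ∩ J)`
otherwise. -/
lemma prod_pairSign_comm [Fintype V] [DecidableEq V] {A J : Finset (V × V)}
    (hA : ∀ q ∈ A, q.swap ∉ A) (hJ : ∀ q ∈ J, q.swap ∉ J) :
    ∏ q ∈ A, (1 + pairSign J q) = ∏ q ∈ J, (1 + pairSign A q) := by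
  have h1 : ∀ A J : Finset (V × V), ∏ q ∈ A, (if q ∈ J then (2 : ℤ) else 1) =
      ∏ q ∈ A ∩ J, 2 := fun A J => by
    rw [prod_ite_mem]
  have h2 : ∀ A J : Finset (V × V), ∏ q ∈ A, (if q.swap ∈ J then (0 : ℤ) else 1) =
      if ∃ q ∈ A, q.swap ∈ J then 0 else 1 := by
    intro A J
    split_ifs with h
    · obtain ⟨q, hq, hq'⟩ := h
      exact prod_eq_zero hq (if_pos hq')
    · push Not at h
      exact prod_eq_one fun q hq => if_neg (h q hq)
  have h3 : (∃ q ∈ A, q.swap ∈ J) ↔ ∃ q ∈ J, q.swap ∈ A :=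
    ⟨fun ⟨q, h, h'⟩ => ⟨q.swap, h', by simpa using h⟩,
      fun ⟨q, h, h'⟩ => ⟨q.swap, h', by simpa using h⟩⟩
  simp only [one_add_pairSign hA, one_add_pairSign hJ, prod_mul_distrib, h1, h2, h3,
    inter_comm A J]

/-- The roles of the arcs and of the weight are exchanged: balance for the indicator weight of `J`
becomes a statement about the signs of `H` along `J`. -/
lemma wt_pairSign [Fintype V] [DecidableEq V] {H : Digraph V} (hH : H.IsOriented)
    {J : Finset (V × V)} (hJ : ∀ q ∈ J, q.swap ∉ J) (π : Equiv.Perm V) :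
    H.wt (fun x y => pairSign J (x, y)) π = ∏ q ∈ J, (1 + H.sgn (π.symm q.1) (π.symm q.2)) := by
  classical
  have h1 : ∀ q, pairSign (H.arcs.map (π.prodCongr π).toEmbedding) q =
      H.sgn (π.symm q.1) (π.symm q.2) := by
    intro q
    unfold pairSign sgn
    have h2 : ∀ q, q ∈ H.arcs.map (π.prodCongr π).toEmbedding ↔
        H.Adj (π.symm q.1) (π.symm q.2) := by
      intro q
      rw [mem_map_equiv, mem_arcs]
      rfl
    refine congrArg₂ (fun x y : ℤ => x - y) ?_ ?_
    · exact if_congr (h2 q) rfl rfl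
    · exact if_congr (h2 q.swap) rfl rfl
  rw [prod_congr rfl fun q _ => congrArg (fun z => 1 + z) (h1 q).symm,
    ← prod_pairSign_comm _ hJ, prod_map, wt_eq_arcs]
  · rfl
  · intro q hq hq'
    rw [mem_map_equiv, mem_arcs] at hq hq'
    exact hH _ _ hq hq'

/-- The signs of the arcs of a balanced digraph are uncorrelated under permutations. -/
theorem Balanced.sum_prod_sgn [Fintype V] [DecidableEq V] {H : Digraph V} (hH : H.IsOriented)
    (h : H.Balanced) {I : Finset (V × V)} (hI : ∀ q ∈ I, q.swap ∉ I) (hne : I.Nonempty) :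
    ∑ π : Equiv.Perm V, ∏ q ∈ I, H.sgn (π q.1) (π q.2) = 0 := by
  have h1 : ∀ J ⊆ I, ∑ π : Equiv.Perm V, ∏ q ∈ J, (1 + H.sgn (π q.1) (π q.2)) =
      ((Fintype.card V).factorial : ℤ) := by
    intro J hJ
    have hJ' : ∀ q ∈ J, q.swap ∉ J := fun q hq hq' => hI q (hJ hq) (hJ hq')
    rw [← h.sum_perm (fun x y => pairSign J (x, y)) fun x y => by simp [pairSign],
      ← Equiv.sum_comp (Equiv.inv (Equiv.Perm V))]
    refine sum_congr rfl fun π _ => ?_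
    rw [wt_pairSign hH hJ']
    rfl
  -- Write each sign as `(1 + s) - 1` and expand. Every subset `J` contributes the same factorial up
  -- to sign, leaving a multiple of `(1 - 1) ^ #I`.
  have h2 : ∀ π : Equiv.Perm V, ∏ q ∈ I, H.sgn (π q.1) (π q.2) =
      ∑ J ∈ I.powerset, (∏ q ∈ J, (1 + H.sgn (π q.1) (π q.2))) * ∏ q ∈ I \ J, (-1) := by
    intro π
    rw [← prod_add]
    exact prod_congr rfl fun q _ => by ring
  rw [sum_congr rfl fun π _ => h2 π, sum_comm]
  rw [sum_congr rfl fun J hJ => by rw [← sum_mul, h1 J (mem_powerset.1 hJ)], ← mul_sum]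
  have h3 := prod_add (fun _ => (1 : ℤ)) (fun _ => (-1 : ℤ)) I
  simp only [prod_const_one, one_mul] at h3
  rw [← h3]
  obtain ⟨q, hq⟩ := hne
  rw [prod_eq_zero hq (by norm_num), mul_zero]

/-- The signed number of copies of a flip-free graph in a balanced digraph is zero. -/
theorem Balanced.sum_signProd [Finite V] {H : Digraph V} (hH : H.IsOriented) (h : H.Balanced)
    {F : SimpleGraph V} {I : Finset (V × V)} (hI : F.IsInvariantOrientation I) (hF : F ≠ ⊥) :
    ∑ F' ∈ H.toSimpleGraphInclusive.subs, F.signProd I H.sgn F' = 0 := by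
  classical
  have := Fintype.ofFinite V
  have h1 := hI.sum_perm (isSign_sgn hH)
  have hne : I.Nonempty := by
    rw [nonempty_iff_ne_empty]
    rintro rfl
    refine hF (SimpleGraph.ext ?_)
    ext x y
    simp [hI.adj_iff]
  rw [h.sum_prod_sgn hH (fun q hq => hI.asymm _ _ hq) hne] at h1
  have h2 : (Nat.card (F ≃g F) : ℤ) ≠ 0 := by
    have : Finite (F ≃g F) := Finite.of_injective _ RelIso.toEquiv_injective
    have : Nonempty (F ≃g F) := ⟨SimpleGraph.Iso.refl⟩
    exact_mod_cast Nat.card_pos.ne'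
  exact (mul_eq_zero.1 h1.symm).resolve_left h2

/-- The number of copies of a flip-free graph in the underlying graph is even. -/
theorem Balanced.even_copies [Finite V] {H : Digraph V} (hH : H.IsOriented) (h : H.Balanced)
    {F : SimpleGraph V} (hF : F.FlipFree) (hF' : F ≠ ⊥) :
    Even (SimpleGraph.copies F H.toSimpleGraphInclusive) := by
  classical
  obtain ⟨I, hI⟩ := hF.exists_isInvariantOrientation
  have h1 := h.sum_signProd hH hI hF'
  rw [hI.sum_signProd (isSign_sgn hH) le_rfl] at h1
  rw [Nat.even_iff]
  omega

/-- The underlying graph of a connected balanced digraph is a tree. -/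
theorem Balanced.isTree [Finite V] {H : Digraph V} (hH : H.IsOriented) (h : H.Balanced)
    (hc : H.toSimpleGraphInclusive.Connected) : H.toSimpleGraphInclusive.IsTree := by
  classical
  have := Fintype.ofFinite V
  -- On a transitive tournament each term of the permutation sum is 0 or `2 ^ #H.arcs`.
  have hdvd : (2 : ℤ) ^ #H.arcs ∣ ((Fintype.card V).factorial : ℤ) := by
    let K : Digraph V := ⟨fun x y => Fintype.equivFin V x < Fintype.equivFin V y⟩
    have hK : K.IsTournament := by
      refine ⟨fun x => lt_irrefl _, fun x y hxy => ?_⟩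
      have : Fintype.equivFin V x ≠ Fintype.equivFin V y := by simpa using hxy
      rcases this.lt_or_gt with h | h
      · exact Or.inl ⟨h, h.not_gt⟩
      · exact Or.inr ⟨h, h.not_gt⟩
    rw [← h.sum_perm K.sgn K.sgn_antisymm]
    refine dvd_sum fun π _ => ?_
    rw [wt_sgn hH hK π.injective]
    split_ifs
    · exact dvd_rfl
    · exact dvd_zero _
  have hdvd' : 2 ^ #H.arcs ∣ (Fintype.card V).factorial := by exact_mod_cast hdvd
  have hne : Fintype.card V ≠ 0 := by
    have := hc.nonempty
    exact Fintype.card_ne_zero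
  -- The exponent of 2 in `n!` is less than `n`.
  have hlt : #H.arcs < Fintype.card V := by
    have h1 := Nat.emultiplicity_two_factorial_lt hne
    have h2 := le_emultiplicity_of_pow_dvd hdvd'
    exact_mod_cast h2.trans_lt h1
  have hle : Nat.card H.toSimpleGraphInclusive.edgeSet ≤ #H.arcs := by
    have h1 : H.toSimpleGraphInclusive.edgeSet ⊆
        (H.arcs.image fun p => s(p.1, p.2) : Finset (Sym2 V)) := by
      intro e
      induction e with
      | _ x y =>
        intro hxy
        rw [SimpleGraph.mem_edgeSet, toSimpleGraphInclusive_adj] at hxy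
        rw [mem_coe, mem_image]
        rcases hxy.2 with h | h
        · exact ⟨(x, y), mem_arcs.2 h, rfl⟩
        · exact ⟨(y, x), mem_arcs.2 h, Sym2.eq_swap⟩
    calc Nat.card H.toSimpleGraphInclusive.edgeSet
        ≤ #(H.arcs.image fun p => s(p.1, p.2)) := by
          rw [Nat.card_coe_set_eq, ← Set.ncard_coe_finset]
          exact Set.ncard_le_ncard h1 (Set.toFinite _)
      _ ≤ #H.arcs := card_image_le
  rw [SimpleGraph.isTree_iff_connected_and_card]
  refine ⟨hc, ?_⟩
  have h1 := hc.card_vert_le_card_edgeSet_add_one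
  rw [Nat.card_eq_fintype_card (α := V)] at h1 ⊢
  omega

end SignSums

end Digraph

namespace SimpleGraph

/-! ### Copies in two disjoint copies of a graph, modulo 4 -/

section CopiesOfSum

variable {W : Type*} {K : SimpleGraph W} {F : SimpleGraph (W ⊕ W)}

lemma sum_subs_bot {V : Type*} [Finite V] {A : Type*} [AddCommMonoid A]
    (M : SimpleGraph V → A) : ∑ F ∈ (⊥ : SimpleGraph V).subs, M F = M ⊥ := by
  have : (⊥ : SimpleGraph V).subs = {⊥} := by
    ext F
    simp
  rw [this, Finset.sum_singleton]

open Classical in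
/-- The number of `F' ≤ K` for which `F' ⊕ F₂` is isomorphic to `F`. -/
noncomputable def leftCopies [Finite W] (K : SimpleGraph W) (F : SimpleGraph (W ⊕ W))
    (F₂ : SimpleGraph W) : ℕ :=
  (K.subs.filter fun F' => Nonempty (F' ⊕g F₂ ≃g F)).card

lemma copies_sum_eq [Finite W] : copies F (K ⊕g K) = ∑ F₂ ∈ K.subs, leftCopies K F F₂ := by
  classical
  unfold copies leftCopies
  simp only [Finset.card_filter]
  rw [sum_subs_sum, Finset.sum_comm]

open Classical in
lemma leftCopies_cast [Finite W] (hK : ParityEq K ⊥) (hF : F.FlipFree) (F₂ : SimpleGraph W) :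
    (leftCopies K F F₂ : ZMod 2) = if Nonempty ((⊥ : SimpleGraph W) ⊕g F₂ ≃g F) then 1 else 0 := by
  have h := hK (fun F' => if Nonempty (F' ⊕g F₂ ≃g F) then 1 else 0) ?_ ?_
  · rw [sum_subs_bot, Finset.sum_boole] at h
    exact h
  · rintro F1 F1' ⟨φ⟩
    refine if_congr ⟨?_, ?_⟩ rfl rfl
    · rintro ⟨e⟩
      exact ⟨(Iso.sumCongr φ.symm Iso.refl).trans e⟩
    · rintro ⟨e⟩
      exact ⟨(Iso.sumCongr φ Iso.refl).trans e⟩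
  · intro F' hF'
    refine if_neg ?_
    rintro ⟨e⟩
    exact hF' (hF.iso e.symm).of_sum

lemma leftCopies_eq_one [Finite W] {F₂ : SimpleGraph W}
    (h : Nonempty ((⊥ : SimpleGraph W) ⊕g F₂ ≃g F)) : leftCopies K F F₂ = 1 := by
  classical
  unfold leftCopies
  rw [Finset.card_eq_one]
  refine ⟨⊥, ?_⟩
  ext F'
  rw [Finset.mem_filter, mem_subs, Finset.mem_singleton]
  constructor
  · rintro ⟨-, ⟨e⟩⟩
    obtain ⟨e'⟩ := h
    have h1 : (⊥ : SimpleGraph W) ⊕g F₂ ≤ F' ⊕g F₂ := by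
      rintro (a | a) (b | b) hab <;> simp at hab ⊢
      exact hab
    have h2 := eq_of_le_of_card_le h1 (ncard_edgeSet_iso (e.trans e'.symm)).le
    ext a b
    rw [← sum_adj_inl (G := F') (H := F₂), ← h2, sum_adj_inl]
  · rintro rfl
    exact ⟨bot_le, h⟩

lemma leftCopies_congr [Finite W] {F₂ F₂' : SimpleGraph W} (φ : F₂ ≃g F₂') :
    leftCopies K F F₂ = leftCopies K F F₂' := by
  classical
  unfold leftCopies
  congr 1
  refine Finset.filter_congr fun F' _ => ⟨?_, ?_⟩
  · rintro ⟨e⟩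
    exact ⟨(Iso.sumCongr Iso.refl φ.symm).trans e⟩
  · rintro ⟨e⟩
    exact ⟨(Iso.sumCongr Iso.refl φ).trans e⟩

/-- Sort the copies by their right part `F₂`. If `⊥ ⊕g F₂` is isomorphic to `F`, there is one left
part; by symmetry the number of such `F₂` is `L = leftCopies K F ⊥`, which is even. For any other
`F₂` the number of left parts is even, and half of it is an admissible test function modulo 2, so
these halves sum to `L / 2` modulo 2. The total is `L + L` modulo 4. -/
theorem four_dvd_copies_sum [Finite W] (hK : ParityEq K ⊥) (hF : F.FlipFree) (hF' : F ≠ ⊥) :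
    4 ∣ copies F (K ⊕g K) := by
  classical
  let P : SimpleGraph W → Prop := fun F₂ => Nonempty ((⊥ : SimpleGraph W) ⊕g F₂ ≃g F)
  have hPbot : ¬ P ⊥ := by
    rintro ⟨e⟩
    refine hF' (SimpleGraph.ext ?_)
    ext a b
    rw [← e.symm.map_adj_iff]
    rcases e.symm a with u | u <;> rcases e.symm b with v | v <;> simp
  have h1 := hK (fun F₂ => if P F₂ then 0 else ((leftCopies K F F₂ / 2 : ℕ) : ZMod 2)) ?_ ?_
  · rw [sum_subs_bot, if_neg hPbot] at h1
    have h2 : ∀ F₂, leftCopies K F F₂ =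
        (if Nonempty (F₂ ⊕g (⊥ : SimpleGraph W) ≃g F) then 1 else 0) +
        2 * if P F₂ then 0 else leftCopies K F F₂ / 2 := by
      intro F₂
      have hcomm : Nonempty (F₂ ⊕g (⊥ : SimpleGraph W) ≃g F) ↔ P F₂ :=
        ⟨fun ⟨e⟩ => ⟨Iso.sumComm.trans e⟩, fun ⟨e⟩ => ⟨Iso.sumComm.trans e⟩⟩
      by_cases hP : P F₂
      · rw [if_pos (hcomm.2 hP), if_pos hP, leftCopies_eq_one hP]
      · have h3 := leftCopies_cast hK hF F₂
        rw [if_neg hP, ZMod.natCast_eq_zero_iff] at h3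
        rw [if_neg (fun h => hP (hcomm.1 h)), if_neg hP]
        omega
    rw [copies_sum_eq, Finset.sum_congr rfl fun F₂ _ => h2 F₂, Finset.sum_add_distrib,
      ← Finset.mul_sum, ← Finset.card_filter]
    have h3 : (K.subs.filter fun F₂ => Nonempty (F₂ ⊕g (⊥ : SimpleGraph W) ≃g F)).card =
      leftCopies K F ⊥ := rfl
    rw [h3]
    have h4 := leftCopies_cast hK hF ⊥
    rw [if_neg hPbot, ZMod.natCast_eq_zero_iff] at h4
    have h5 : ((∑ F₂ ∈ K.subs, if P F₂ then 0 else leftCopies K F F₂ / 2 : ℕ) : ZMod 2) =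
        ((leftCopies K F ⊥ / 2 : ℕ) : ZMod 2) := by
      rw [← h1]
      push_cast
      refine Finset.sum_congr rfl fun F₂ _ => ?_
      split_ifs <;> simp
    rw [ZMod.natCast_eq_natCast_iff] at h5
    unfold Nat.ModEq at h5
    omega
  · rintro F₂ F₂' ⟨φ⟩
    have hP : P F₂ ↔ P F₂' := by
      constructor
      · rintro ⟨e⟩
        exact ⟨(Iso.sumCongr Iso.refl φ.symm).trans e⟩
      · rintro ⟨e⟩
        exact ⟨(Iso.sumCongr Iso.refl φ).trans e⟩
    simp only [hP, leftCopies_congr (K := K) (F := F) φ]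
  · intro F₂ hF₂
    have h0 : leftCopies K F F₂ = 0 := by
      unfold leftCopies
      rw [Finset.card_eq_zero, Finset.filter_eq_empty_iff]
      rintro F' _ ⟨e⟩
      exact hF₂ (hF.iso e.symm).of_sum_right
    simp [h0]

end CopiesOfSum

/-! ### Mirrored sign functions -/

section MirrorSign

variable {V : Type*} {W : Type*} {K : SimpleGraph W} {r : W} {F : SimpleGraph (W ⊕ W)}

open Classical in
/-- The sign function that is `-1` exactly on the edge `uv`. -/
noncomputable def flipSign (u v x y : V) : ℤ :=
  if (x = u ∧ y = v) ∨ (x = v ∧ y = u) then -1 else 1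

open Classical in
-- The edge `uv`, if it belongs to the copy, is represented by exactly one pair of `I`.
lemma IsInvariantOrientation.prod_flipSign {F F' : SimpleGraph V} {I : Finset (V × V)}
    (h : F.IsInvariantOrientation I) (e : F ≃g F') (u v : V) :
    ∏ p ∈ I, flipSign u v (e p.1) (e p.2) = if F'.Adj u v then -1 else 1 := by
  have h1 : ∀ u v, (e.symm u, e.symm v) ∈ I →
      ∏ p ∈ I, flipSign u v (e p.1) (e p.2) = -1 := by
    intro u v huv
    rw [Finset.prod_eq_single_of_mem _ huv]
    · simp [flipSign]
    · rintro ⟨x, y⟩ hxy hne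
      refine if_neg ?_
      rintro (⟨rfl, rfl⟩ | ⟨rfl, rfl⟩)
      · simp at hne
      · simp only [e.symm_apply_apply] at huv
        exact h.asymm _ _ huv hxy
  have hsymm : ∀ x y, flipSign u v x y = flipSign v u x y := by
    intro x y
    unfold flipSign
    exact if_congr or_comm rfl rfl
  split_ifs with huv
  · have h2 : F.Adj (e.symm u) (e.symm v) := e.symm.map_adj_iff.2 huv
    rcases (h.adj_iff _ _).1 h2 with h3 | h3
    · exact h1 u v h3
    · simp only [hsymm]
      exact h1 v u h3
  · refine Finset.prod_eq_one fun p hp => if_neg ?_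
    have h2 : F'.Adj (e p.1) (e p.2) := e.map_adj_iff.2 ((h.adj_iff _ _).2 (Or.inl hp))
    rintro (⟨h3, h4⟩ | ⟨h3, h4⟩)
    · rw [h3, h4] at h2
      exact huv h2
    · rw [h3, h4] at h2
      exact huv h2.symm

/-- The sign function obtained by copying the signs on the left copy to the right copy. -/
def mirrorSign (s : W ⊕ W → W ⊕ W → ℤ) : W ⊕ W → W ⊕ W → ℤ
  | .inr a, .inr b => s (.inl a) (.inl b)
  | x, y => s x y

lemma IsSign.mirrorSign {s : W ⊕ W → W ⊕ W → ℤ} (hs : (K.mirror r).IsSign s) :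
    (K.mirror r).IsSign (mirrorSign s) where
  zero := by
    rintro (a | a) (b | b) h
    · exact hs.zero _ _ h
    · exact hs.zero _ _ h
    · exact hs.zero _ _ h
    · exact hs.zero (.inl a) (.inl b) h
  sq := by
    rintro (a | a) (b | b) h
    · exact hs.sq _ _ h
    · exact hs.sq _ _ h
    · exact hs.sq _ _ h
    · exact hs.sq (.inl a) (.inl b) h
  antisymm := by
    rintro (a | a) (b | b)
    · exact hs.antisymm _ _
    · exact hs.antisymm _ _
    · exact hs.antisymm _ _
    · exact hs.antisymm (.inl a) (.inl b)

lemma mirrorSign_swap_of_sum_adj (s : W ⊕ W → W ⊕ W → ℤ) {x y : W ⊕ W}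
    (h : (K ⊕g K).Adj x y) : mirrorSign s x.swap y.swap = mirrorSign s x y := by
  rcases x with x | x <;> rcases y with y | y
  · rfl
  · simp at h
  · simp at h
  · rfl

/-- The halves carry equal signs, so reflection changes only the sign of the central edge, whose
direction it reverses. -/
lemma mirrorSign_swap {s : W ⊕ W → W ⊕ W → ℤ} (hs : (K.mirror r).IsSign s) {x y : W ⊕ W}
    (h : (K.mirror r).Adj x y) : mirrorSign s x.swap y.swap =
      flipSign (.inl r) (.inr r) x y * mirrorSign s x y := by
  rcases x with x | x <;> rcases y with y | y
  · simp [flipSign, mirrorSign]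
  · obtain ⟨rfl, rfl⟩ := h
    have : s (.inr y) (.inl y) = -s (.inl y) (.inr y) := hs.antisymm _ _
    simpa [flipSign, mirrorSign] using this
  · obtain ⟨rfl, rfl⟩ := h
    have : s (.inl y) (.inr y) = -s (.inr y) (.inl y) := hs.antisymm _ _
    simpa [flipSign, mirrorSign] using this
  · simp [flipSign, mirrorSign]

/-- An isomorphism onto the reflected graph. -/
def isoReflect {F F' : SimpleGraph (W ⊕ W)} (e : F ≃g F') : F ≃g F'.reflect :=
  e.trans (Iso.comap (Equiv.sumComm W W) F').symm

variable {I : Finset ((W ⊕ W) × (W ⊕ W))} {s : W ⊕ W → W ⊕ W → ℤ}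

open Classical in
lemma IsInvariantOrientation.signProd_reflect (h : F.IsInvariantOrientation I)
    (hs : (K.mirror r).IsSign s) {F' : SimpleGraph (W ⊕ W)} (hF' : F' ≤ K.mirror r) :
    F.signProd I (mirrorSign s) F'.reflect =
      (if F'.Adj (.inl r) (.inr r) then -1 else 1) * F.signProd I (mirrorSign s) F' := by
  by_cases hn : Nonempty (F ≃g F')
  · obtain ⟨e⟩ := hn
    rw [h.signProd_eq _ e, h.signProd_eq _ (isoReflect e), ← h.prod_flipSign e,
      ← Finset.prod_mul_distrib]
    refine Finset.prod_congr rfl fun p hp => ?_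
    exact mirrorSign_swap hs (hF' (e.map_adj_iff.2 ((h.adj_iff _ _).2 (Or.inl hp))))
  · have hn' : ¬ Nonempty (F ≃g F'.reflect) := fun ⟨e⟩ =>
      hn ⟨e.trans (Iso.comap (Equiv.sumComm W W) F')⟩
    rw [signProd_of_isEmpty _ _ hn, signProd_of_isEmpty _ _ hn', mul_zero]

/-- The product of the mirrored signs of a symmetric copy is `1`. -/
lemma IsInvariantOrientation.signProd_eq_one (h : F.IsInvariantOrientation I)
    (hs : (K.mirror r).IsSign s) {F' : SimpleGraph (W ⊕ W)} (hF' : F' ≤ K ⊕g K)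
    (hr : F'.reflect = F') (e : F ≃g F') : F.signProd I (mirrorSign s) F' = 1 := by
  have hadj : ∀ x y, F'.Adj x.swap y.swap ↔ F'.Adj x y := by
    intro x y
    conv_rhs => rw [← hr]
    rfl
  let τ : F' ≃g F' := ⟨Equiv.sumComm W W, hadj _ _⟩
  let φ : F ≃g F := (e.trans τ).trans e.symm
  have hφ : ∀ x, e (φ x) = (e x).swap := fun x => by
    show e (e.symm (τ (e x))) = _
    rw [e.apply_symm_apply]
    rfl
  rw [h.signProd_eq _ e]
  -- The reflection acts on `I` without fixed pairs, and paired factors are equal signs with product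
  -- 1.
  refine Finset.prod_involution (fun p _ => (φ p.1, φ p.2)) ?_ ?_ ?_ ?_
  · intro p hp
    have h1 := hF' (e.map_adj_iff.2 ((h.adj_iff _ _).2 (Or.inl hp)))
    simp only [hφ]
    rw [mirrorSign_swap_of_sum_adj s h1]
    rcases hs.mirrorSign.sq _ _ (sum_le_mirror h1) with h2 | h2 <;> rw [h2] <;> norm_num
  · intro p hp _ h2
    have h3 := congrArg (fun p => e p.1) h2
    simp only [hφ] at h3
    rcases hx : e p.1 with x | x <;> rw [hx] at h3 <;> simp at h3
  · intro p hp
    exact h.map φ _ _ hp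
  · intro p hp
    have h1 : ∀ x, φ (φ x) = x := fun x => e.injective (by rw [hφ, hφ, Sum.swap_swap])
    simp [h1]

/-- Copies through the central edge cancel against their reflections. The others give the number of
copies in `K ⊕g K`, divisible by 4, minus twice the number of negative ones. The latter is even:
reflection preserves these signs, and a symmetric copy is positive. -/
lemma IsInvariantOrientation.sum_signProd_mirrorSign [Finite W] (hK : ParityEq K ⊥)
    (hF : F.FlipFree) (hF' : F ≠ ⊥) (h : F.IsInvariantOrientation I)
    (hs : (K.mirror r).IsSign s) :
    (4 : ℤ) ∣ ∑ F' ∈ (K.mirror r).subs, F.signProd I (mirrorSign s) F' := by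
  classical
  rw [← Finset.sum_filter_add_sum_filter_not _
    (fun F : SimpleGraph (W ⊕ W) => F.Adj (.inl r) (.inr r))]
  have h1 : ((K.mirror r).subs.filter fun F => ¬ F.Adj (.inl r) (.inr r)) = (K ⊕g K).subs := by
    ext F
    rw [Finset.mem_filter, mem_subs, mem_subs]
    refine ⟨fun h => le_sum_of_le_mirror h.1 h.2, fun h => ⟨h.trans sum_le_mirror, fun h' => ?_⟩⟩
    simpa using h h'
  have h2 : ∑ F' ∈ (K.mirror r).subs with F'.Adj (.inl r) (.inr r),
      F.signProd I (mirrorSign s) F' = 0 := by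
    have h3 : ∑ F' ∈ (K.mirror r).subs with F'.Adj (.inl r) (.inr r),
        F.signProd I (mirrorSign s) F' = ∑ F' ∈ (K.mirror r).subs with F'.Adj (.inl r) (.inr r),
        -F.signProd I (mirrorSign s) F' := by
      refine Finset.sum_nbij' reflect reflect ?_ ?_ (fun F' _ => reflect_reflect F')
        (fun F' _ => reflect_reflect F') ?_
      · intro F' hF'
        rw [Finset.mem_filter, mem_subs] at hF' ⊢
        exact ⟨reflect_le_mirror hF'.1, hF'.2.symm⟩
      · intro F' hF'
        rw [Finset.mem_filter, mem_subs] at hF' ⊢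
        exact ⟨reflect_le_mirror hF'.1, hF'.2.symm⟩
      · intro F' hF'
        rw [Finset.mem_filter, mem_subs] at hF'
        rw [h.signProd_reflect hs hF'.1, if_pos hF'.2]
        ring
    rw [Finset.sum_neg_distrib] at h3
    omega
  rw [h1, h2, zero_add, h.sum_signProd hs.mirrorSign sum_le_mirror]
  obtain ⟨c, hc⟩ := four_dvd_copies_sum hK hF hF'
  have h4 : ((((K ⊕g K).subs.filter fun F' => F.signProd I (mirrorSign s) F' = -1).card : ℕ) :
      ZMod 2) = 0 := by
    rw [Finset.card_eq_sum_ones]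
    push_cast
    refine Finset.sum_involution (fun F' _ => F'.reflect) ?_ ?_ ?_ ?_
    · intro _ _
      exact CharTwo.add_self_eq_zero _
    · intro F' hF' _ hr
      rw [Finset.mem_filter, mem_subs] at hF'
      have hn : Nonempty (F ≃g F') := by
        by_contra hn
        rw [signProd_of_isEmpty _ _ hn] at hF'
        norm_num at hF'
      obtain ⟨e⟩ := hn
      rw [h.signProd_eq_one hs hF'.1 hr e] at hF'
      norm_num at hF'
    · intro F' hF'
      rw [← h1, Finset.mem_filter, Finset.mem_filter, mem_subs] at hF' ⊢
      refine ⟨⟨reflect_le_mirror hF'.1.1, fun h' => hF'.1.2 h'.symm⟩, ?_⟩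
      rw [h.signProd_reflect hs hF'.1.1, if_neg hF'.1.2, hF'.2]
      norm_num
    · intro F' _
      exact reflect_reflect F'
  rw [ZMod.natCast_eq_zero_iff] at h4
  omega

end MirrorSign

end SimpleGraph

namespace SimpleGraph

/-! ### The parity condition on the disagreement set -/

section ParityOfDeletions

variable {W : Type*} {K : SimpleGraph W} {r : W} {F : SimpleGraph (W ⊕ W)}
  {I : Finset ((W ⊕ W) × (W ⊕ W))} {s : W ⊕ W → W ⊕ W → ℤ}

/-- `B` lists each edge on which the halves disagree once, as an ordered pair; flipping its right
copy turns the mirrored sign into `s`. -/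
lemma eq_mirrorSign_mul (hs : (K.mirror r).IsSign s) {B : Finset (W × W)}
    (hB : ∀ a b, K.Adj a b →
      (((a, b) ∈ B ∨ (b, a) ∈ B) ↔ s (.inr a) (.inr b) ≠ s (.inl a) (.inl b)))
    (hBa : ∀ a b, (a, b) ∈ B → (b, a) ∉ B) {x y : W ⊕ W} (h : (K.mirror r).Adj x y) :
    s x y = mirrorSign s x y * ∏ e ∈ B, flipSign (.inr e.1) (.inr e.2) x y := by
  have hone : (∀ e ∈ B, ¬ (x = .inr e.1 ∧ y = .inr e.2 ∨ x = .inr e.2 ∧ y = .inr e.1)) →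
      ∏ e ∈ B, flipSign (.inr e.1) (.inr e.2) x y = 1 := fun h =>
    Finset.prod_eq_one fun e he => if_neg (h e he)
  rcases x with a | a <;> rcases y with b | b
  · rw [hone (by simp), mul_one]
    rfl
  · rw [hone (by simp), mul_one]
    rfl
  · rw [hone (by simp), mul_one]
    rfl
  · by_cases h1 : (a, b) ∈ B ∨ (b, a) ∈ B
    · have h2 := (hB a b h).1 h1
      have h3 : ∏ e ∈ B, flipSign (.inr e.1) (.inr e.2) (.inr a : W ⊕ W) (.inr b) = -1 := by
        have h4 : ∀ c d, (c, d) ∈ B → (c = a ∧ d = b ∨ c = b ∧ d = a) →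
            ∏ e ∈ B, flipSign (.inr e.1) (.inr e.2) (.inr a : W ⊕ W) (.inr b) = -1 := by
          intro c d hcd h5
          rw [Finset.prod_eq_single_of_mem _ hcd]
          · refine if_pos ?_
            rcases h5 with ⟨rfl, rfl⟩ | ⟨rfl, rfl⟩ <;> simp
          · rintro ⟨c', d'⟩ he hne
            refine if_neg ?_
            simp only [Sum.inr.injEq]
            rintro (⟨rfl, rfl⟩ | ⟨rfl, rfl⟩) <;> rcases h5 with ⟨rfl, rfl⟩ | ⟨rfl, rfl⟩
            · exact hne rfl
            · exact hBa _ _ hcd he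
            · exact hBa _ _ hcd he
            · exact hne rfl
        rcases h1 with h1 | h1
        · exact h4 a b h1 (Or.inl ⟨rfl, rfl⟩)
        · exact h4 b a h1 (Or.inr ⟨rfl, rfl⟩)
      rw [h3]
      show _ = s (.inl a) (.inl b) * -1
      have h5 := hs.sq (.inr a) (.inr b) h
      have h6 := hs.sq (.inl a) (.inl b) h
      omega
    · have h2 : s (.inr a) (.inr b) = s (.inl a) (.inl b) := by
        by_contra h3
        exact h1 ((hB a b h).2 h3)
      rw [hone, mul_one]
      · exact h2
      · rintro ⟨c, d⟩ he
        simp only [Sum.inr.injEq]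
        rintro (⟨rfl, rfl⟩ | ⟨rfl, rfl⟩)
        · exact h1 (Or.inl he)
        · exact h1 (Or.inr he)

lemma prod_neg_one_zmod_four {ι : Type*} (B : Finset ι) (P : ι → Prop) [DecidablePred P] :
    ((∏ e ∈ B, (if P e then -1 else 1) : ℤ) : ZMod 4) = 1 - 2 * ∑ e ∈ B, if P e then 1 else 0 := by
  classical
  have h4 : (4 : ZMod 4) = 0 := by decide
  induction B using Finset.induction_on with
  | empty => simp
  | insert e B he ih =>
    rw [Finset.prod_insert he, Finset.sum_insert he, Int.cast_mul, ih]
    split_ifs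
    · push_cast
      linear_combination (∑ e ∈ B, if P e then 1 else 0) * h4
    · push_cast
      ring

open Classical in
lemma copies_del_add [Finite W] (T : SimpleGraph (W ⊕ W)) (x y : W ⊕ W) :
    (T.subs.filter fun F' => Nonempty (F' ≃g F) ∧ F'.Adj x y).card + copies F (T.del x y) =
      copies F T := by
  have h : copies F (T.del x y) =
      (T.subs.filter fun F' => Nonempty (F' ≃g F) ∧ ¬ F'.Adj x y).card := by
    unfold copies
    congr 1
    ext F'
    rw [Finset.mem_filter, Finset.mem_filter, mem_subs, mem_subs]
    constructor
    · rintro ⟨h1, h2⟩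
      exact ⟨h1.trans (del_le x y), h2, fun h3 => (del_adj.1 (h1 h3)).2 (Or.inl ⟨rfl, rfl⟩)⟩
    · rintro ⟨h1, h2, h3⟩
      refine ⟨fun a b hab => del_adj.2 ⟨h1 hab, ?_⟩, h2⟩
      rintro (⟨rfl, rfl⟩ | ⟨rfl, rfl⟩)
      · exact h3 hab
      · exact h3 hab.symm
  rw [h]
  unfold copies
  rw [← Finset.card_filter_add_card_filter_not (s := T.subs.filter fun F' => Nonempty (F' ≃g F))
    (fun F' => F'.Adj x y), Finset.filter_filter, Finset.filter_filter]

/-- If the signed number of copies of `F` vanishes, then the edges on which the signs of the two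
halves of the mirrored tree differ satisfy a parity condition. -/
theorem IsInvariantOrientation.even_sum_copies [Finite W] (hK : ParityEq K ⊥)
    (hF : F.FlipFree) (hF' : F ≠ ⊥) (h : F.IsInvariantOrientation I)
    (hs : (K.mirror r).IsSign s) {B : Finset (W × W)}
    (hB : ∀ a b, K.Adj a b →
      (((a, b) ∈ B ∨ (b, a) ∈ B) ↔ s (.inr a) (.inr b) ≠ s (.inl a) (.inl b)))
    (hBa : ∀ a b, (a, b) ∈ B → (b, a) ∉ B)
    (hsum : ∑ F' ∈ (K.mirror r).subs, F.signProd I s F' = 0)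
    (heven : Even (copies F (K.mirror r))) :
    Even (∑ e ∈ B, copies F ((K.mirror r).del (.inr e.1) (.inr e.2))) := by
  classical
  -- Flipping `m` edges multiplies by `1 - 2 * m` modulo 4, and the sign in front of `2 * m` is
  -- immaterial there.
  have h1 : ∀ F' ∈ (K.mirror r).subs, ((F.signProd I s F' : ℤ) : ZMod 4) =
      (F.signProd I (mirrorSign s) F' : ℤ) - 2 * ∑ e ∈ B,
        if Nonempty (F' ≃g F) ∧ F'.Adj (.inr e.1) (.inr e.2) then 1 else 0 := by
    intro F' hF'
    rw [mem_subs] at hF'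
    by_cases hn : Nonempty (F ≃g F')
    · obtain ⟨e⟩ := hn
      have h2 : F.signProd I s F' = F.signProd I (mirrorSign s) F' *
          ∏ e ∈ B, if F'.Adj (.inr e.1) (.inr e.2) then -1 else 1 := by
        rw [h.signProd_eq _ e, h.signProd_eq _ e]
        simp only [← h.prod_flipSign e]
        rw [Finset.prod_comm, ← Finset.prod_mul_distrib]
        refine Finset.prod_congr rfl fun p hp => ?_
        exact eq_mirrorSign_mul hs hB hBa
          (hF' (e.map_adj_iff.2 ((h.adj_iff _ _).2 (Or.inl hp))))
      have hn' : Nonempty (F' ≃g F) := ⟨e.symm⟩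
      rw [h2, Int.cast_mul, prod_neg_one_zmod_four]
      simp only [hn', true_and]
      have h4 : (4 : ZMod 4) = 0 := by decide
      rcases h.signProd_eq_one_or hs.mirrorSign hF' e with h3 | h3 <;> rw [h3]
      · push_cast
        ring
      · push_cast
        linear_combination
          (∑ e ∈ B, if F'.Adj (.inr e.1) (.inr e.2) then 1 else 0) * h4
    · have hn' : ¬ Nonempty (F' ≃g F) := fun ⟨e⟩ => hn ⟨e.symm⟩
      rw [signProd_of_isEmpty _ _ hn, signProd_of_isEmpty _ _ hn]
      simp [hn']
  have h2 : (((∑ F' ∈ (K.mirror r).subs, F.signProd I s F') : ℤ) : ZMod 4) = 0 := by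
    rw [hsum, Int.cast_zero]
  have h3 : (((∑ F' ∈ (K.mirror r).subs, F.signProd I (mirrorSign s) F') : ℤ) : ZMod 4) = 0 :=
    (ZMod.intCast_zmod_eq_zero_iff_dvd _ 4).2 (h.sum_signProd_mirrorSign hK hF hF' hs)
  rw [Int.cast_sum, Finset.sum_congr rfl h1, Finset.sum_sub_distrib, ← Int.cast_sum, h3,
    ← Finset.mul_sum, Finset.sum_comm] at h2
  simp only [Finset.sum_boole] at h2
  have h4 : ((2 * ∑ e ∈ B, ((K.mirror r).subs.filter fun F' => Nonempty (F' ≃g F) ∧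
      F'.Adj (.inr e.1) (.inr e.2)).card : ℕ) : ZMod 4) = 0 := by
    push_cast
    rw [zero_sub, neg_eq_zero] at h2
    exact h2
  rw [ZMod.natCast_eq_zero_iff] at h4
  -- Copies through an edge and copies in its deletion together are all copies, whose number is
  -- even, so the two sums have the same parity.
  have h5 : ∑ e ∈ B, ((K.mirror r).subs.filter fun F' => Nonempty (F' ≃g F) ∧
      F'.Adj (.inr e.1) (.inr e.2)).card +
      ∑ e ∈ B, copies F ((K.mirror r).del (.inr e.1) (.inr e.2)) =
      B.card * copies F (K.mirror r) := by
    rw [← Finset.sum_add_distrib, Finset.sum_congr rfl fun e _ => copies_del_add _ _ _,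
      Finset.sum_const, smul_eq_mul]
  have h6 : Even (∑ e ∈ B, ((K.mirror r).subs.filter fun F' => Nonempty (F' ≃g F) ∧
      F'.Adj (.inr e.1) (.inr e.2)).card) := by
    rw [Nat.even_iff]
    omega
  have h7 : Even (B.card * copies F (K.mirror r)) := heven.mul_left _
  rw [← h5, Nat.even_add] at h7
  exact h7.1 h6

end ParityOfDeletions

end SimpleGraph

namespace SimpleGraph

/-! ### Deleting an edge of the right half -/

section MirrorDeletions

variable {W : Type*} {K : SimpleGraph W} {r : W}

lemma reachable_mirror_del {u : W ⊕ W} :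
    ((K.mirror r).del (.inr r) (.inl r)).Reachable (.inl r) u ↔
      ∃ w, u = .inl w ∧ K.Reachable r w := by
  rw [del_comm, mirror_del]
  refine ⟨sum_reachable_inl, ?_⟩
  rintro ⟨w, rfl, hw⟩
  exact sum_reachable_inl_inl.2 hw

lemma compCard_mirror_del (hK : K.IsTree) :
    ((K.mirror r).del (.inr r) (.inl r)).compCard (.inl r) = Nat.card W := by
  rw [del_comm, mirror_del, compCard_eq_natCard, card_reachable_inl, ← compCard_eq_natCard,
    hK.compCard_eq]

/-- The data of a reduction of a mirrored tree without an edge of the right copy. -/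
lemma exists_isReduction_mirror [Finite W] (hT : (K.mirror r).IsTree) (hK : K.IsTree) {a b : W}
    (hab : K.Adj a b) : ∃ x y R i j, s(x, y) = s((.inr a : W ⊕ W), .inr b) ∧
      (K.mirror r).IsReduction x y R i j ∧
      ((K.mirror r).del x y).Reachable y (.inl r) ∧
      ((K.mirror r).del x y).compCard x < ((K.mirror r).del x y).compCard y := by
  -- The side containing `inl r` contains the whole left copy and also `inr r`, hence more than half
  -- of the vertices.
  have key : ∀ {a b}, K.Adj a b →
      ((K.mirror r).del (.inr a) (.inr b)).Reachable (.inr b) (.inl r) →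
      ((K.mirror r).del (.inr a) (.inr b)).compCard (.inr a) <
        ((K.mirror r).del (.inr a) (.inr b)).compCard (.inr b) := by
    intro a b hab h
    have hadj : (K.mirror r).Adj (.inr a) (.inr b) := hab
    have hfar : (K.mirror r).IsFarEdge (.inr r) (.inl r)
        (((K.mirror r).del (.inr a) (.inr b)).compCard (.inl r)) (.inr a) (.inr b) :=
      ⟨hadj, by simp [reachable_mirror_del], by simp [reachable_mirror_del], rfl⟩
    have h1 := compCard_lt (fun w hw => hfar.reachable hw) (z := .inr r)
      (Adj.reachable (del_adj.2 ⟨by simp, by simp⟩)) (by simp [reachable_mirror_del])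
    rw [compCard_mirror_del hK, ← compCard_reachable h] at h1
    have h2 := hT.isAcyclic.compCard_del_add hadj
    rw [hT.compCard_eq, Nat.card_sum] at h2
    omega
  have hadj : (K.mirror r).Adj (.inr a) (.inr b) := hab
  rcases reachable_del (y := .inr b) (hT.connected.preconnected (.inr a) (.inl r)) with h | h
  · rw [del_comm] at h
    obtain ⟨R, i, j, hR⟩ := hT.exists_isReduction hadj.symm
    exact ⟨_, _, R, i, j, Sym2.eq_swap, hR, h, key hab.symm h⟩
  · obtain ⟨R, i, j, hR⟩ := hT.exists_isReduction hadj
    exact ⟨_, _, R, i, j, rfl, hR, h, key hab h⟩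

lemma del_eq_of_sym2_eq {V : Type*} {T : SimpleGraph V} {x y a b : V} (h : s(x, y) = s(a, b)) :
    T.del x y = T.del a b := by
  unfold del
  rw [h]

lemma copies_self {V : Type*} [Finite V] (R : SimpleGraph V) : copies R R = 1 := by
  classical
  unfold copies
  rw [Finset.card_eq_one]
  refine ⟨R, ?_⟩
  ext F
  rw [Finset.mem_filter, mem_subs, Finset.mem_singleton]
  constructor
  · rintro ⟨h1, ⟨φ⟩⟩
    exact eq_of_le_of_card_le h1 (ncard_edgeSet_iso φ).ge
  · rintro rfl
    exact ⟨le_rfl, ⟨Iso.refl⟩⟩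

end MirrorDeletions

end SimpleGraph

namespace Digraph

/-! ### Connected balanced digraphs -/

open SimpleGraph

/-- A flip-free reduction of the underlying graph of a balanced digraph has no edges. -/
lemma Balanced.eq_bot_of_parityEq {V : Type*} [Finite V] {H : Digraph V} (hH : H.IsOriented)
    (h : H.Balanced) {R : SimpleGraph V} (hR : R.FlipFree)
    (hp : ParityEq H.toSimpleGraphInclusive R) : R = ⊥ := by
  by_contra hne
  have h1 := h.even_copies hH hR hne
  -- `R` contains one copy of itself, so the underlying graph contains an odd number.
  have h2 := hp.copies_eq hR
  rw [copies_self, ZMod.natCast_eq_natCast_iff] at h2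
  rw [Nat.even_iff] at h1
  unfold Nat.ModEq at h2
  omega

variable {W : Type u} {K : SimpleGraph W} {r : W}

/-- The two halves of a balanced orientation of a mirrored tree agree. -/
theorem Balanced.adj_inl_iff_adj_inr [Finite W] {H : Digraph (W ⊕ W)} (hH : H.IsOriented)
    (h : H.Balanced) (hK : K.IsTree) (hT : H.toSimpleGraphInclusive = K.mirror r)
    (hTree : H.toSimpleGraphInclusive.IsTree) (a b : W) :
    H.Adj (.inl a) (.inl b) ↔ H.Adj (.inr a) (.inr b) := by
  classical
  have := Fintype.ofFinite W
  have hadj : ∀ x y, (K.mirror r).Adj x y ↔ H.Adj x y ∨ H.Adj y x := by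
    intro x y
    rw [← hT, toSimpleGraphInclusive_adj]
    refine ⟨fun h => h.2, fun h => ⟨?_, h⟩⟩
    rcases h with h | h
    · exact hH.ne h
    · exact (hH.ne h).symm
  have hKadj : ∀ {a b}, K.Adj a b → (H.Adj (.inl a) (.inl b) ∨ H.Adj (.inl b) (.inl a)) ∧
      (H.Adj (.inr a) (.inr b) ∨ H.Adj (.inr b) (.inr a)) := fun {a b} hab =>
    ⟨(hadj (.inl a) (.inl b)).1 hab, (hadj (.inr a) (.inr b)).1 hab⟩
  -- Each edge of disagreement occurs once, directed as its right copy.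
  let B : Finset (W × W) := Finset.univ.filter fun e =>
    H.Adj (.inr e.1) (.inr e.2) ∧ ¬ H.Adj (.inl e.1) (.inl e.2)
  have hmem : ∀ a b, (a, b) ∈ B ↔ H.Adj (.inr a) (.inr b) ∧ ¬ H.Adj (.inl a) (.inl b) := by
    simp [B]
  have hBK : ∀ e ∈ B, K.Adj e.1 e.2 := fun e he =>
    (hadj (.inr e.1) (.inr e.2)).2 (Or.inl ((hmem e.1 e.2).1 he).1)
  have hBempty : B = ∅ := by
    by_contra hne
    have hs := isSign_sgn hH
    have hk := fun {R : SimpleGraph (W ⊕ W)} => h.eq_bot_of_parityEq hH (R := R)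
    have hsum := fun {F I} => h.sum_signProd hH (F := F) (I := I)
    have heven := fun {F} => h.even_copies hH (F := F)
    rw [hT] at hs hTree
    simp only [hT] at hk hsum heven
    -- The reduction of the whole tree has no edges, which gives rigidity at every vertex and an
    -- order that is a power of 2.
    obtain ⟨R, hRle, hRf, hRp, ⟨k, hkc, -⟩, hrig⟩ := hTree.exists_reduction
    have hR := hk hRf hRp
    have hrig' : ∀ z, (K.mirror r).RigidAt z := fun z φ hz u _ => hrig hR φ z hz u
    have hcard : Nat.card (W ⊕ W) = 2 ^ k := by
      rw [← hkc (.inl r), hR]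
      simp [reachable_bot]
    -- Two copies of a reduction of `K` form a flip-free reduction of the mirror, so they have no
    -- edges either.
    have hKbot : ParityEq K ⊥ := by
      obtain ⟨R', -, hRf', hRp', -, -⟩ := hK.exists_reduction
      have h1 := hk (hRf'.sum hRf') ((parityEq_mirror K r).trans (hRp'.sum hRp'))
      have h2 : R' = ⊥ := by
        ext a b
        rw [← sum_adj_inl (G := R') (H := R'), h1]
        simp
      rwa [h2] at hRp'
    have hred : ∀ e : W × W, ∃ x y R i j, e ∈ B →
        (s(x, y) = s((.inr e.1 : W ⊕ W), .inr e.2) ∧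
        (K.mirror r).IsReduction x y R i j ∧
        ((K.mirror r).del x y).Reachable y (.inl r) ∧
        ((K.mirror r).del x y).compCard x < ((K.mirror r).del x y).compCard y) := by
      intro e
      by_cases he : e ∈ B
      · obtain ⟨x, y, R, i, j, h⟩ := exists_isReduction_mirror hTree hK (hBK e he)
        exact ⟨x, y, R, i, j, fun _ => h⟩
      -- Dummy data outside `B`, so that the choices are total functions.
      · exact ⟨.inl r, .inl r, ⊥, 0, 0, fun h => absurd h he⟩
    choose x y R' i j hred using hred
    have hnl : ∀ e ∈ B, (K.mirror r).Adj (x e) (y e) ∧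
        ¬ ((K.mirror r).del (.inr r) (.inl r)).Reachable (.inl r) (x e) ∧
        ¬ ((K.mirror r).del (.inr r) (.inl r)).Reachable (.inl r) (y e) := by
      intro e he
      have h1 := (hred e he).1
      have h2 := hBK e he
      rw [reachable_mirror_del, reachable_mirror_del]
      rcases Sym2.eq_iff.1 h1 with ⟨h3, h4⟩ | ⟨h3, h4⟩ <;> rw [h3, h4]
      · exact ⟨h2, by simp, by simp⟩
      · exact ⟨h2.symm, by simp, by simp⟩
    obtain ⟨e, he, hodd⟩ := exists_odd_copies B (Finset.nonempty_iff_ne_empty.2 hne)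
      (fun e => (K.mirror r).del (.inr e.1) (.inr e.2)) R'
      (fun e he => (hred e he).2.1.flipFree) (fun e he => by
        rw [← del_eq_of_sym2_eq (hred e he).1]
        exact (hred e he).2.1.parityEq) (by
        rintro e he e' he' ⟨φ⟩
        have h1 := IsReduction.eq_of_iso hTree hrig' hcard (q := .inr r) (p := .inl r) (by simp)
          (by rw [compCard_mirror_del hK, Nat.card_sum]; ring)
          (hnl e he).1 (hnl e he).2.1 (hnl e he).2.2 (hred e he).2.2.1 (hred e he).2.2.2
          (hnl e' he').1 (hnl e' he').2.1 (hnl e' he').2.2 (hred e' he').2.2.1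
          (hred e' he').2.2.2 (hred e he).2.1 (hred e' he').2.1 φ
        rw [(hred e he).1, (hred e' he').1, Sym2.eq_iff] at h1
        simp only [Sum.inr.injEq] at h1
        rcases h1 with ⟨h2, h3⟩ | ⟨h2, h3⟩
        · exact Prod.ext h2 h3
        · have h4 := ((hmem e.1 e.2).1 he).1
          have h5 := ((hmem e'.1 e'.2).1 he').1
          rw [h2, h3] at h4
          exact absurd h5 (hH _ _ h4))
    have hflip := (hred e he).2.1.flipFree
    have hbot := (hred e he).2.1.ne_bot hTree (hnl e he).1 hcard (hred e he).2.2.2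
    obtain ⟨I, hI⟩ := hflip.exists_isInvariantOrientation
    have heven' := hI.even_sum_copies (B := B) hKbot hflip hbot hs (by
      intro a b hab
      have h1 := hKadj hab
      have h2 := hH (.inl a) (.inl b)
      have h3 := hH (.inr a) (.inr b)
      rw [hmem, hmem]
      unfold sgn
      by_cases h4 : H.Adj (.inl a) (.inl b) <;> by_cases h5 : H.Adj (.inl b) (.inl a) <;>
        by_cases h6 : H.Adj (.inr a) (.inr b) <;> by_cases h7 : H.Adj (.inr b) (.inr a) <;>
        simp [h4, h5, h6, h7] at h1 h2 h3 ⊢) (by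
      intro a b h1 h2
      exact hH _ _ ((hmem a b).1 h1).1 ((hmem b a).1 h2).1) (hsum hI hbot) (heven hflip hbot)
    rw [(ZMod.natCast_eq_zero_iff_even).2 heven'] at hodd
    exact absurd hodd (by decide)
  have hinr : ∀ a b, H.Adj (.inr a) (.inr b) → H.Adj (.inl a) (.inl b) := by
    intro a b hab
    by_contra hno
    have : (a, b) ∈ B := (hmem a b).2 ⟨hab, hno⟩
    rw [hBempty] at this
    simp at this
  refine ⟨fun hab => ?_, hinr a b⟩
  have h1 : K.Adj a b := (hadj (.inl a) (.inl b)).2 (Or.inl hab)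
  exact (hKadj h1).2.resolve_right fun h2 => hH _ _ hab (hinr b a h2)

/-- A balanced orientation of a mirrored tree is bridge-mirrored. -/
theorem Balanced.exists_bridgeMirror [Finite W] {H : Digraph (W ⊕ W)} (hH : H.IsOriented)
    (h : H.Balanced) (hK : K.IsTree) (hT : H.toSimpleGraphInclusive = K.mirror r)
    (hTree : H.toSimpleGraphInclusive.IsTree) : ∃ G : Digraph W, G.IsOriented ∧
      G.toSimpleGraphInclusive = K ∧ (G.bridgeMirror r).Isomorphic H := by
  have hiff := h.adj_inl_iff_adj_inr hH hK hT hTree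
  have hadj : ∀ x y, (K.mirror r).Adj x y ↔ x ≠ y ∧ (H.Adj x y ∨ H.Adj y x) := by
    intro x y
    rw [← hT, toSimpleGraphInclusive_adj]
  have hcross : ∀ {a b}, H.Adj (.inl a) (.inr b) ∨ H.Adj (.inr b) (.inl a) → a = r ∧ b = r :=
    fun {a b} h' => (hadj (.inl a) (.inr b)).2 ⟨by simp, h'⟩
  refine ⟨⟨fun a b => H.Adj (.inl a) (.inl b)⟩, fun a b => hH _ _, ?_, ?_⟩
  · ext a b
    rw [toSimpleGraphInclusive_adj]
    have := hadj (.inl a) (.inl b)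
    rw [mirror_inl_inl] at this
    rw [this]
    simp
  · have hc : H.Adj (.inl r) (.inr r) ∨ H.Adj (.inr r) (.inl r) :=
      ((hadj (.inl r) (.inr r)).1 (by simp)).2
    -- If the central arc points from the right copy to the left, the reflection provides the
    -- isomorphism, since the halves agree.
    rcases hc with hc | hc
    · refine ⟨⟨Equiv.refl _, ?_⟩⟩
      rintro (a | a) (b | b)
      · exact Iff.rfl
      · constructor
        · exact fun h' => hcross (Or.inl h')
        · rintro ⟨rfl, rfl⟩
          exact hc
      · constructor
        · intro h'
          obtain ⟨rfl, rfl⟩ := hcross (Or.inr h')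
          exact hH _ _ hc h'
        · exact fun h' => h'.elim
      · exact (hiff a b).symm
    · refine ⟨⟨Equiv.sumComm W W, ?_⟩⟩
      rintro (a | a) (b | b)
      · exact (hiff a b).symm
      · constructor
        · intro h'
          obtain ⟨rfl, rfl⟩ := hcross (Or.inr h')
          exact ⟨rfl, rfl⟩
        · rintro ⟨rfl, rfl⟩
          exact hc
      · constructor
        · intro h'
          obtain ⟨rfl, rfl⟩ := hcross (Or.inl h')
          exact hH _ _ hc h'
        · exact fun h' => h'.elim
      · exact Iff.rfl

/-- Connected balanced digraphs are recursively bridge-mirrored. -/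
theorem Balanced.isRecursivelyBridgeMirrored {V : Type u} [Finite V] {H : Digraph V}
    (hH : H.IsOriented) (hc : H.toSimpleGraphInclusive.Connected) (h : H.Balanced) :
    H.IsRecursivelyBridgeMirrored := by
  induction hn : Nat.card V using Nat.strong_induction_on generalizing V with
  | _ n ih =>
    subst hn
    have hTree := h.isTree hH hc
    have hne := hc.nonempty
    by_cases hsub : Subsingleton V
    · have hu : Nonempty (Unique V) := ⟨uniqueOfSubsingleton hne.some⟩
      obtain ⟨_⟩ := hu
      have hbot : H = ⊥ := by
        ext a b
        have : a = b := Subsingleton.elim _ _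
        subst this
        exact ⟨fun h' => hH _ _ h' h', fun h' => h'.elim⟩
      rw [hbot]
      exact .single
    -- A flip-free tree is its own reduction and would have no edges.
    · have hflip : ¬ H.toSimpleGraphInclusive.FlipFree := by
        intro hf
        have hbot := h.eq_bot_of_parityEq hH hf (ParityEq.refl _)
        refine hsub ⟨fun a b => ?_⟩
        have := hc.preconnected a b
        rwa [hbot, reachable_bot] at this
      obtain ⟨W, _, K, r, hK, ⟨e⟩⟩ := exists_mirror_iso hTree hflip
      let H' : Digraph (W ⊕ W) := ⟨fun x y => H.Adj (e x) (e y)⟩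
      let e' : H'.Adj ≃r H.Adj := ⟨e.toEquiv, Iff.rfl⟩
      have hT' : H'.toSimpleGraphInclusive = K.mirror r := by
        ext x y
        rw [← e.map_adj_iff, toSimpleGraphInclusive_adj, toSimpleGraphInclusive_adj,
          e.injective.ne_iff]
      have hTree' : H'.toSimpleGraphInclusive.IsTree := by
        rw [hT']
        exact e.isTree_iff.2 hTree
      have hH' : H'.IsOriented := fun x y => hH _ _
      have hB' : H'.Balanced := h.iso e'.symm
      obtain ⟨G, hG, hGK, ⟨f⟩⟩ := hB'.exists_bridgeMirror hH' hK hT' hTree'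
      have hGB : G.Balanced := (hB'.iso f.symm).of_bridgeMirror
      have hlt : Nat.card W < Nat.card V := by
        rw [← Nat.card_congr e.toEquiv, Nat.card_sum]
        have : Nonempty W := ⟨r⟩
        have : 0 < Nat.card W := Nat.card_pos
        omega
      have hGR := ih _ hlt hG (hGK ▸ hK.connected) hGB rfl
      exact .iso ⟨f.trans e'⟩ (.mirror r hGR)

end Digraph

theorem theorem1p3 {V : Type*} [Finite V] (H : Digraph V) (hH : H.IsOriented) :
    H.IsImpartial ↔ H.IsDisjointUnionOfRBM :=
  Digraph.isImpartial_iff_of_connected hH fun hG hc hB => hB.isRecursivelyBridgeMirrored hG hc
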